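/- **Setting.** Let $\Omega\subset\mathbb R^2$ be open and decomposed into finitely many disjoint spline patches $\Omega_k=\mathbf F_k((0,1)^2)\subset\Omega$ with $\bar\Omega=\bigcup_k\bar\Omega_k$. Each $\mathbf F_k$ is a tensor-product B-spline map on $[0,1]^2$ (open knot vectors, degrees $\ge 2$, inner knots of multiplicity at most degree minus one, so that all splines are $C^1$; degrees and knots may differ from patch to patch and direction to direction), injective with invertible Jacobian on $[0,1]^2$. Two different closed patches meet in the empty set, one common vertex, or one entire common edge; every edge of a patch lies in $\partial\Omega$ or has its relative interior in $\Omega$. On every interface $\Gamma$ (an edge common to two patches) one patch is called slave ($s$), the other master ($m$). $\mathcal X_b^h$ is the space of functions that on each $\Omega_k$ are of the form $w\circ\mathbf F_k^{-1}$, with $w$ in the same spline space as $\mathbf F_k$, and satisfy $u=\partial u/\partial\mathbf n=0$ on the edges in $\partial\Omega$. With $[\cdot]$ the jump from slave to master, $$b_0(\mu,u)=\sum_\Gamma\int_\Gamma[u]\,\mu\,d\Gamma,\qquad b_1(\mu,u)=\sum_\Gamma\int_\Gamma[\partial_\Gamma u]\,\mu\,d\Gamma ,$$ where $\partial_\Gamma$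 is the slave's parametric derivative transversal to $\Gamma$ ($\partial/\partial\xi_s$ if $\Gamma\parallel\eta_s$, $\partial/\partial\eta_s$ if $\Gamma\parallel\xi_s$), and $d\Gamma$ is arc length or the slave's edge parameter (the same choice in $b_0$, $b_1$ and the dual bases). Let $N_1,\dots,N_n$ be the slave's univariate B-splines along $\Gamma$. Their *global dual basis* is $\hat N_i=\sum_j(G^{-1})_{ij}N_j$, $G_{ij}=\int_\Gamma N_iN_j\,d\Gamma$. Their *Bézier dual basis* is given on each Bézier element $e$ by $\hat N_i=\omega_i^e\sum_j\big(C^{-T}(G^e)^{-1}\big)_{ij}B_j$, where the $B_j$ are the Bernstein polynomials on $e$, $N_i|_e=\sum_jC_{ij}B_j$, $G^e_{ij}=\int_eB_iB_j\,d\Gamma$ and $\omega_i^e=\int_eN_i\,d\Gamma/\int_\Gamma N_i\,d\Gamma$ ($i$ ranges over the B-splines living on $e$). $\mathcal K_b^h$ is the set of $u\in\mathcal X_b^h$ with $b_0(\mu_0,u)=0=b_1(\mu_1,u)$ for all $\mu_0,\mu_1$ that on each $\Gamma$ are in the span of one of the following: * (B) the Bézier dual basis; * (G) the global dual basis; * (GC)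 the global dual basis of the coarsened trace mesh (the two inner knots nearest to each end of $\Gamma$ removed; every slave trace mesh is supposed to have at least four inner knots), and in this case in addition $[u]=[\partial_\Gamma u]=0$ at both end points of every $\Gamma$. **Theorem.** Let $f\in L^2(\Omega)$ and $l(v)=\int_\Omega fv$. The discrete problem: find $u^h\in\mathcal K_b^h$ such that $a_b(u^h,v^h)=l(v^h)$ for all $v^h\in\mathcal K_b^h$, has a unique solution in each of the following cases. 1. $a_b(u,v)=\sum_k\int_{\Omega_k}D^2u:D^2v$, and $\mathcal K_b^h$ is built by (B), or by (G), or by (GC), where for (GC) it is supposed that for every interface, at one of its two end points at least, the direction of the derivative $\partial_\Gamma$ is not parallel to the chord between the end points. 2. $a_b(u,v)=\sum_k\int_{\Omega_k}\nabla u\cdot\nabla v$, and $\mathcal K_b^h$ is built by (B), (G) or (GC). 3. $a_b(u,v)=\sum_k\int_{\Omega_k}\Delta u\,\Delta v$, every patch has an edge on $\partial\Omega$, and $\mathcal K_b^h$ is built by (B), (G) or (GC). -/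

import Mathlib

open MeasureTheory Set

noncomputable section

/-! ### Univariate B-splines on `[0, 1]` -/

open Classical in
/-- Cox–de Boor recursion: `bspline t p i` is the `i`-th B-spline of degree `p` for the knots `t`
(quotients with vanishing denominator count as `0`). The last nonempty knot span is closed at the
right end `1` of the parameter interval. -/
def bspline (t : ℕ → ℝ) : ℕ → ℕ → ℝ → ℝ
  | 0, i, x =>
      if (t i ≤ x ∧ x < t (i + 1)) ∨ (x = 1 ∧ t i < 1 ∧ t (i + 1) = 1) then 1 else 0
  | q + 1, i, x =>
      (x - t i) / (t (i + q + 1) - t i) * bspline t q i x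
        + (t (i + q + 2) - x) / (t (i + q + 2) - t (i + 1)) * bspline t q (i + 1) x

/-- Open knot vectors on `[0, 1]` for `size` B-splines `N_0, …, N_{size-1}` of degree
`degree ≥ 2`; the knots are `knot 0 ≤ … ≤ knot (size + degree)`. The end knots have multiplicity
`degree + 1`, and inner knots have multiplicity at most `degree - 1`, so that all splines are
`C¹` (hence piecewise `H²` functions are in `H²`). -/
structure KnotVector where
  degree : ℕ
  size : ℕ
  knot : ℕ → ℝ
  two_le_degree : 2 ≤ degree
  degree_lt_size : degree < size
  monotone : Monotone knot
  knot_left : ∀ i, i ≤ degree → knot i = 0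
  knot_right : ∀ i, size ≤ i → knot i = 1
  knot_inner_pos : 0 < knot (degree + 1)
  knot_inner_lt : knot (size - 1) < 1
  multiplicity : ∀ i, 0 < knot i → knot i < 1 → knot i < knot (i + (degree - 1))

namespace KnotVector

/-- The B-spline basis functions `N_i`, `0 ≤ i < size`. -/
def basis (κ : KnotVector) (i : ℕ) : ℝ → ℝ := bspline κ.knot κ.degree i

/-- The knots of the coarsened mesh: of the inner knots, listed with multiplicity, the two nearest
to each of the end points `0` and `1` are removed. This is used when there are at least four inner
knots, i.e. `degree + 5 ≤ size`, and then gives `size - 4` B-splines of the same degree. -/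
def coarseKnot (κ : KnotVector) (i : ℕ) : ℝ :=
  if i ≤ κ.degree then 0 else if i < κ.size - 4 then κ.knot (i + 2) else 1

end KnotVector

/-! ### Dual bases

All inner products are taken in `L²([0, 1], ρ dx)`; on an interface, `ρ dx` is the measure `dΓ`. -/

/-- The Gramian `G_{ij} = ∫ N_i N_j ρ` of the first `n` B-splines. -/
def splineGram (t : ℕ → ℝ) (p n : ℕ) (ρ : ℝ → ℝ) : Matrix (Fin n) (Fin n) ℝ :=
  Matrix.of fun (i j : Fin n) => ∫ x in (0 : ℝ)..1, bspline t p i x * bspline t p j x * ρ x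

/-- The global dual basis `∑ j, (G⁻¹)_{ij} N_j`. -/
def globalDual (t : ℕ → ℝ) (p n : ℕ) (ρ : ℝ → ℝ) (i : Fin n) (x : ℝ) : ℝ :=
  ∑ j : Fin n, (splineGram t p n ρ)⁻¹ i j * bspline t p j x

namespace KnotVector

/-- The Bernstein polynomials of degree `degree` on the Bézier element
`[knot e, knot (e + 1)]`. -/
def bern (κ : KnotVector) (e : ℕ) (j : Fin (κ.degree + 1)) (x : ℝ) : ℝ :=
  (bernsteinPolynomial ℝ κ.degree j).eval ((x - κ.knot e) / (κ.knot (e + 1) - κ.knot e))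

/-- The Gramian of the Bernstein polynomials on an element. -/
def bernGram (κ : KnotVector) (ρ : ℝ → ℝ) (e : ℕ) :
    Matrix (Fin (κ.degree + 1)) (Fin (κ.degree + 1)) ℝ :=
  Matrix.of fun (i j : Fin (κ.degree + 1)) => ∫ x in κ.knot e..κ.knot (e + 1), κ.bern e i x * κ.bern e j x * ρ x

/-- The element extraction operator `C`: on the element, `N_{e-p+a} = ∑ j, C_{aj} B_j`, where
`N_{e-p}, …, N_e` are the B-splines of degree `p` that live on the element. As these are
polynomials of degree at most `p` there, their Bernstein coefficients are those of the
`L²`-projection onto the span of the `B_j`. -/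
def extraction (κ : KnotVector) (e : ℕ) :
    Matrix (Fin (κ.degree + 1)) (Fin (κ.degree + 1)) ℝ :=
  (Matrix.of fun (a j : Fin (κ.degree + 1)) => ∫ x in κ.knot e..κ.knot (e + 1),
      κ.basis (e - κ.degree + a) x * κ.bern e j x) * (κ.bernGram (fun _ => 1) e)⁻¹

/-- The Bézier projection weights `ω_i^e`. -/
def projWeight (κ : KnotVector) (ρ : ℝ → ℝ) (e i : ℕ) : ℝ :=
  (∫ x in κ.knot e..κ.knot (e + 1), κ.basis i x * ρ x) / ∫ x in (0 : ℝ)..1, κ.basis i x * ρ x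

/-- The element extraction operator of the dual basis, `diag(ω) Rᵀ G⁻¹` with `R = C⁻¹`
(the transpose belongs to the convention `N = C B` for `C`, and gives the biorthogonality
`∫_e N̂_i N_j = ω_i^e δ_{ij}`). -/
def dualExtraction (κ : KnotVector) (ρ : ℝ → ℝ) (e : ℕ) :
    Matrix (Fin (κ.degree + 1)) (Fin (κ.degree + 1)) ℝ :=
  Matrix.diagonal (fun a : Fin (κ.degree + 1) => κ.projWeight ρ e (e - κ.degree + a))
    * ((κ.extraction e)⁻¹).transpose * (κ.bernGram ρ e)⁻¹

open Classical in
/-- The Bézier dual basis function `N̂_i`, given element by element; `a` is the local index of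
`N_i` on the element `e`, that is `e - degree + a = i`. -/
def bezierDual (κ : KnotVector) (ρ : ℝ → ℝ) (i : Fin κ.size) (x : ℝ) : ℝ :=
  ∑ e ∈ Finset.Ico κ.degree κ.size, ∑ a : Fin (κ.degree + 1),
    if e - κ.degree + a = (i : ℕ) ∧ κ.knot e ≤ x ∧ x < κ.knot (e + 1) then
      ∑ j, κ.dualExtraction ρ e a j * κ.bern e j x
    else 0

end KnotVector

/-- The treatments of the interfaces: Bézier dual basis; global dual basis on the full trace mesh;
global dual basis on the coarsened trace mesh with pointwise constraints at the vertices. -/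
inductive DualBasis
  | bezier
  | globalFull
  | globalCoarse

/-- The discrete Lagrange multipliers on one interface, as functions of the slave's edge
parameter: the span of the dual basis. -/
def multipliers (κ : KnotVector) (ρ : ℝ → ℝ) : DualBasis → Submodule ℝ (ℝ → ℝ)
  | .bezier => Submodule.span ℝ (range (κ.bezierDual ρ))
  | .globalFull => Submodule.span ℝ (range (globalDual κ.knot κ.degree κ.size ρ))
  | .globalCoarse => Submodule.span ℝ (range (globalDual κ.coarseKnot κ.degree (κ.size - 4) ρ))

/-! ### Patches -/

/-- The physical plane. -/
abbrev Plane := EuclideanSpace ℝ (Fin 2)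

/-- The closed parametric square `[0, 1] × [0, 1]`. -/
def closedSquare : Set (ℝ × ℝ) := Icc 0 1 ×ˢ Icc 0 1

/-- The open parametric square. -/
def openSquare : Set (ℝ × ℝ) := Ioo 0 1 ×ˢ Ioo 0 1

/-- The four edges `ξ = 0`, `ξ = 1`, `η = 0`, `η = 1` of the parametric square. -/
inductive Side
  | xi0
  | xi1
  | eta0
  | eta1

namespace Side

/-- The point with edge parameter `r` on an edge of the parametric square. -/
def point : Side → ℝ → ℝ × ℝ
  | xi0, r => (0, r)
  | xi1, r => (1, r)
  | eta0, r => (r, 0)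
  | eta1, r => (r, 1)

/-- The coordinate direction transversal to the edge: `ξ` if the edge is parallel to `η`, and `η`
if it is parallel to `ξ`. -/
def transversal : Side → ℝ × ℝ
  | xi0 => (1, 0)
  | xi1 => (1, 0)
  | eta0 => (0, 1)
  | eta1 => (0, 1)

end Side

/-- Tensor-product spline with coefficients `c` in a real vector space. -/
def tensorSpline {E : Type*} [AddCommGroup E] [Module ℝ E] (κ₁ κ₂ : KnotVector)
    (c : Fin κ₁.size → Fin κ₂.size → E) (s : ℝ × ℝ) : E :=
  ∑ i : Fin κ₁.size, ∑ j : Fin κ₂.size, (κ₁.basis i s.1 * κ₂.basis j s.2) • c i j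

/-- A spline patch: the geometric mapping `F` of the closed square is a tensor-product spline with
control points in the plane; it is injective and its Jacobian is invertible everywhere. -/
structure Patch where
  knots₁ : KnotVector
  knots₂ : KnotVector
  control : Fin knots₁.size → Fin knots₂.size → Plane
  injOn : InjOn (tensorSpline knots₁ knots₂ control) closedSquare
  regular : ∀ s ∈ closedSquare,
    Function.Bijective (fderivWithin ℝ (tensorSpline knots₁ knots₂ control) closedSquare s)

namespace Patch

/-- The geometric mapping `F`. -/
def map (P : Patch) : ℝ × ℝ → Plane := tensorSpline P.knots₁ P.knots₂ P.control

/-- The inverse of the geometric mapping, on the closed patch. -/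
def inv (P : Patch) : Plane → ℝ × ℝ := Function.invFunOn P.map closedSquare

/-- The open patch. -/
def dom (P : Patch) : Set Plane := P.map '' openSquare

/-- The closed patch, which is the closure of the open one. -/
def closedDom (P : Patch) : Set Plane := P.map '' closedSquare

/-- The parametrization of an edge of the patch by `[0, 1]`. -/
def curve (P : Patch) (e : Side) (r : ℝ) : Plane := P.map (e.point r)

/-- The velocity of that parametrization. -/
def curveDeriv (P : Patch) (e : Side) (r : ℝ) : Plane := derivWithin (P.curve e) (Icc 0 1) r

/-- An edge of the patch in the plane. -/
def edge (P : Patch) (e : Side) : Set Plane := P.curve e '' Icc 0 1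

/-- An edge without its end points. -/
def openEdge (P : Patch) (e : Side) : Set Plane := P.curve e '' Ioo 0 1

/-- The vertices of the patch. -/
def vertices (P : Patch) : Set Plane := P.map '' ({0, 1} ×ˢ {0, 1})

/-- The knots along an edge. -/
def edgeKnots (P : Patch) : Side → KnotVector
  | .xi0 => P.knots₂
  | .xi1 => P.knots₂
  | .eta0 => P.knots₁
  | .eta1 => P.knots₁

/-- `∂F/∂ξ` on edges parallel to `η`, and `∂F/∂η` on edges parallel to `ξ`. -/
def transversalDeriv (P : Patch) (e : Side) (r : ℝ) : Plane :=
  fderivWithin ℝ P.map closedSquare (e.point r) e.transversal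

/-- The control values of a scalar spline on the patch. -/
abbrev Coeff (P : Patch) : Type := Fin P.knots₁.size → Fin P.knots₂.size → ℝ

/-- The scalar spline function on the closed physical patch with the given control values,
`(∑ c_{ij} N_i N_j) ∘ F⁻¹`. -/
def val (P : Patch) (c : P.Coeff) (x : Plane) : ℝ := tensorSpline P.knots₁ P.knots₂ c (P.inv x)

/-- Its derivative, one-sided at the boundary of the closed patch. -/
def grad (P : Patch) (c : P.Coeff) (x : Plane) : Plane →L[ℝ] ℝ :=
  fderivWithin ℝ (P.val c) P.closedDom x

end Patch

/-! ### Multi-patch domains -/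

/-- A multi-patch domain, together with the choice of a slave side on every interface. -/
structure MultiPatch where
  numPatches : ℕ
  patch : Fin numPatches → Patch
  Ω : Set Plane
  isOpen : IsOpen Ω
  dom_subset : ∀ k, (patch k).dom ⊆ Ω
  closure_eq : closure Ω = ⋃ k, (patch k).closedDom
  disjoint : ∀ k l, k ≠ l → Disjoint (patch k).dom (patch l).dom
  /-- Two different closed patches meet in nothing, in one vertex, or in one entire edge. -/
  inter : ∀ k l, k ≠ l →
    (patch k).closedDom ∩ (patch l).closedDom = ∅ ∨
    (∃ v, v ∈ (patch k).vertices ∧ v ∈ (patch l).vertices ∧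
      (patch k).closedDom ∩ (patch l).closedDom = {v}) ∨
    (∃ e e' : Side, (patch k).closedDom ∩ (patch l).closedDom = (patch k).edge e ∧
      (patch k).edge e = (patch l).edge e')
  /-- An edge is part of the boundary, or its relative interior is inside the domain. -/
  edge_cases : ∀ k e, (patch k).edge e ⊆ frontier Ω ∨ (patch k).openEdge e ⊆ Ω
  isSlave : Fin numPatches → Side → Prop
  slave_iff : ∀ k e l e', k ≠ l → (patch k).edge e = (patch l).edge e' →
    (isSlave k e ↔ ¬ isSlave l e')

/-- An interface: an edge of a slave patch that is also an edge of another, the master patch. -/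
structure MultiPatch.Interface (D : MultiPatch) where
  slave : Fin D.numPatches
  slaveSide : Side
  master : Fin D.numPatches
  masterSide : Side
  ne : slave ≠ master
  edge_eq : (D.patch slave).edge slaveSide = (D.patch master).edge masterSide
  isSlave : D.isSlave slave slaveSide

/-- The measure `dΓ` on the interfaces: arc length, or the slave's edge parameter. -/
inductive EdgeMeasure
  | arcLength
  | parameter

/-- The bilinear forms: `hessian` is `∫ D²u : D²v`, `laplacian` is `∫ Δu Δv`, and `gradient` is
`∫ ∇u · ∇v`. -/
inductive EnergyForm
  | hessian
  | laplacian
  | gradient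

/-- The standard unit vectors of the plane. -/
def unitVec (i : Fin 2) : Plane := EuclideanSpace.single i 1

/-- First partial derivatives. -/
def pderiv (u : Plane → ℝ) (i : Fin 2) (x : Plane) : ℝ := fderiv ℝ u x (unitVec i)

/-- Second partial derivatives. -/
def pderiv₂ (u : Plane → ℝ) (i j : Fin 2) (x : Plane) : ℝ :=
  fderiv ℝ (fderiv ℝ u) x (unitVec i) (unitVec j)

/-- The integrand of the bilinear form. For the splines below, which are `C¹` in each patch and
smooth with bounded derivatives in each Bézier element, the second derivatives exist almost
everywhere and are the weak ones. -/
def EnergyForm.density (a : EnergyForm) (u v : Plane → ℝ) (x : Plane) : ℝ :=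
  match a with
  | .hessian => ∑ i, ∑ j, pderiv₂ u i j x * pderiv₂ v i j x
  | .laplacian => (∑ i, pderiv₂ u i i x) * (∑ i, pderiv₂ v i i x)
  | .gradient => ∑ i, pderiv u i x * pderiv v i x

namespace MultiPatch

variable (D : MultiPatch)

/-- The broken spline functions on the domain, given by all their control values. -/
abbrev Broken : Type := ∀ k, (D.patch k).Coeff

/-- A broken spline as a function on the plane; it is given on the open patches, i.e. almost
everywhere in the domain. -/
def toFun (u : D.Broken) (x : Plane) : ℝ :=
  ∑ k, indicator (D.patch k).dom ((D.patch k).val (u k)) x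

/-- The broken bilinear form `a_b`. -/
def energy (a : EnergyForm) (u v : D.Broken) : ℝ :=
  ∑ k, ∫ x in (D.patch k).dom,
    a.density ((D.patch k).val (u k)) ((D.patch k).val (v k)) x

/-- The load `l(v) = ∫_Ω f v`. -/
def load (f : Plane → ℝ) (v : D.Broken) : ℝ := ∫ x in D.Ω, f x * D.toFun v x

/-- `u = 0` and `∂u/∂n = 0` on the boundary of the domain. -/
def boundaryCondition (u : D.Broken) : Prop :=
  ∀ k e, (D.patch k).edge e ⊆ frontier D.Ω → ∀ r ∈ Icc (0 : ℝ) 1,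
    (D.patch k).val (u k) ((D.patch k).curve e r) = 0 ∧
    ∀ n : Plane, inner ℝ n ((D.patch k).curveDeriv e r) = 0 →
      (D.patch k).grad (u k) ((D.patch k).curve e r) n = 0

namespace Interface

variable {D}

/-- The interface, parametrized by the slave's edge parameter. -/
def curve (Γ : D.Interface) (r : ℝ) : Plane := (D.patch Γ.slave).curve Γ.slaveSide r

/-- The direction of differentiation `∂/∂ξ_s` (or `∂/∂η_s`) transversal to the interface. -/
def direction (Γ : D.Interface) (r : ℝ) : Plane :=
  (D.patch Γ.slave).transversalDeriv Γ.slaveSide r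

/-- The density of `dΓ` with respect to the slave's edge parameter. -/
def weight (Γ : D.Interface) : EdgeMeasure → ℝ → ℝ
  | .arcLength, r => ‖(D.patch Γ.slave).curveDeriv Γ.slaveSide r‖
  | .parameter, _ => 1

/-- The jump `[u]` from slave to master. -/
def jump (Γ : D.Interface) (u : D.Broken) (r : ℝ) : ℝ :=
  (D.patch Γ.slave).val (u Γ.slave) (Γ.curve r) -
    (D.patch Γ.master).val (u Γ.master) (Γ.curve r)

/-- The jump `[∂u/∂ξ_s]` on `Γ ∥ η_s`, or `[∂u/∂η_s]` on `Γ ∥ ξ_s`; the derivative of `u_m` is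
given by the chain rule. -/
def derivJump (Γ : D.Interface) (u : D.Broken) (r : ℝ) : ℝ :=
  (D.patch Γ.slave).grad (u Γ.slave) (Γ.curve r) (Γ.direction r) -
    (D.patch Γ.master).grad (u Γ.master) (Γ.curve r) (Γ.direction r)

/-- The knots of the slave's trace mesh. -/
def knots (Γ : D.Interface) : KnotVector := (D.patch Γ.slave).edgeKnots Γ.slaveSide

end Interface

/-- `b₀(μ, u)`, the sum over the skeleton of `∫_Γ [u] μ dΓ`. -/
def b₀ (m : EdgeMeasure) (μ : D.Interface → ℝ → ℝ) (u : D.Broken) : ℝ :=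
  ∑ᶠ Γ : D.Interface, ∫ r in (0 : ℝ)..1, Γ.jump u r * μ Γ r * Γ.weight m r

/-- `b₁(μ, u)`, the sum over the skeleton of `∫_Γ [∂u/∂ξ_s] μ dΓ` (or with `η_s`). -/
def b₁ (m : EdgeMeasure) (μ : D.Interface → ℝ → ℝ) (u : D.Broken) : ℝ :=
  ∑ᶠ Γ : D.Interface, ∫ r in (0 : ℝ)..1, Γ.derivJump u r * μ Γ r * Γ.weight m r

/-- The discrete Lagrange multipliers on the skeleton (both for `b₀` and for `b₁`: the nonzero
scaling constants in the basis for `b₁` do not change the span). -/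
def multiplierSpace (β : DualBasis) (m : EdgeMeasure) : Set (D.Interface → ℝ → ℝ) :=
  {μ | ∀ Γ, μ Γ ∈ multipliers Γ.knots (Γ.weight m) β}

/-- The pointwise constraints at both end vertices of every interface. -/
def vertexConstraint (u : D.Broken) : Prop :=
  ∀ Γ : D.Interface, Γ.jump u 0 = 0 ∧ Γ.jump u 1 = 0 ∧
    Γ.derivJump u 0 = 0 ∧ Γ.derivJump u 1 = 0

/-- The constrained discrete space `K_b^h`. -/
def constrainedSpace (β : DualBasis) (m : EdgeMeasure) : Set D.Broken :=
  {u | D.boundaryCondition u ∧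
    (∀ μ ∈ D.multiplierSpace β m, D.b₀ m μ u = 0) ∧
    (∀ μ ∈ D.multiplierSpace β m, D.b₁ m μ u = 0) ∧
    (β = .globalCoarse → D.vertexConstraint u)}

/-- The discrete problem: `a_b(u, v) = l(v)` for all `v ∈ K_b^h` has exactly one solution
`u ∈ K_b^h`. -/
def UniquelySolvable (a : EnergyForm) (β : DualBasis) (m : EdgeMeasure) (f : Plane → ℝ) : Prop :=
  ∃! u : D.Broken, u ∈ D.constrainedSpace β m ∧
    ∀ v ∈ D.constrainedSpace β m, D.energy a u v = D.load f v

/-- Every slave trace mesh has at least four inner knots, so that it can be coarsened. -/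
def Coarsenable : Prop := ∀ Γ : D.Interface, Γ.knots.degree + 5 ≤ Γ.knots.size

/-- For every interface, at one of its two end points at least, the direction of `∂/∂ξ_s`
(or `∂/∂η_s`) is not parallel to the chord between the end points. -/
def ChordTransversal : Prop :=
  ∀ Γ : D.Interface, ∃ r ∈ ({0, 1} : Set ℝ),
    LinearIndependent ℝ ![Γ.direction r, Γ.curve 1 - Γ.curve 0]

/-- Every patch has an edge on the boundary of the domain. -/
def AllPatchesAtBoundary : Prop := ∀ k, ∃ e, (D.patch k).edge e ⊆ frontier D.Ω

end MultiPatch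

end

/-! The constraints are linear on a finite-dimensional space of control values, so the constrained
splines form a subspace, and unique solvability follows from definiteness of `energy` on it
(`existsUnique_of_definite`). It remains to show that a constrained spline of zero energy is zero.
The energy density is nonnegative, and continuous on the images of the open Bézier elements, so zero
energy makes it vanish at every point of these.

Both the Laplacian form and the passage from one element to the whole patch rest on unique
continuation. On one element, multiplication by the cube of the Jacobian determinant turns the
pulled back Laplace equation into a polynomial identity. A polynomial solution with zero Cauchy data
on a segment of the line ξ = t is divisible by every power of ξ - t, because that line is
noncharacteristic (`eq_zero_of_laplaceNumerator`). As splines are C¹, the zero Cauchy data pass on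
to the neighbouring elements (`eq_zero_of_polyPiece_eq_zero`, `eq_zero_of_cauchyData_side`). For the
Laplacian form this settles each patch from its own boundary edge.

For the Hessian and the gradient form the function is affine, respectively constant, on every patch
(`exists_eq_affine`, `exists_eq_affine_zero`). Scalar splines use the spline space of the geometric
mapping, so the jumps of affine pieces and of their transversal derivatives lie in the slave's trace
space. Both dual bases on the full trace mesh are biorthogonal to the slave B-splines, so the
constraints force these jumps to vanish (`eq_zero_of_orthogonal_multipliers`) and neighbouring
pieces coincide. In the coarsened case the vertex conditions already suffice: the jump functional
vanishes on the chord and on a transversal direction not parallel to it. Pieces with an edge on the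
boundary are zero, and every patch is joined to such a patch by interfaces, because finitely many
vertices do not disconnect the plane (`forall_of_boundary_of_interface`). -/

noncomputable section

/-! ### Polynomial pieces of B-splines -/

/-- The polynomial that agrees on the knot span `e` with the `i`-th B-spline of degree `q`. -/
def bpiece (t : ℕ → ℝ) (e : ℕ) : ℕ → ℕ → Polynomial ℝ
  | 0, i => if i = e then 1 else 0
  | q + 1, i =>
      Polynomial.C (t (i + q + 1) - t i)⁻¹ * (Polynomial.X - Polynomial.C (t i)) * bpiece t e q i
      + Polynomial.C (t (i + q + 2) - t (i + 1))⁻¹ * (Polynomial.C (t (i + q + 2)) - Polynomial.X)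
        * bpiece t e q (i + 1)

theorem bpiece_zero (t : ℕ → ℝ) (e i : ℕ) : bpiece t e 0 i = if i = e then 1 else 0 := rfl

theorem bpiece_succ (t : ℕ → ℝ) (e q i : ℕ) : bpiece t e (q + 1) i =
      Polynomial.C (t (i + q + 1) - t i)⁻¹ * (Polynomial.X - Polynomial.C (t i)) * bpiece t e q i
      + Polynomial.C (t (i + q + 2) - t (i + 1))⁻¹ * (Polynomial.C (t (i + q + 2)) - Polynomial.X)
        * bpiece t e q (i + 1) := rfl

theorem eval_bpiece_succ (t : ℕ → ℝ) (e q i : ℕ) (x : ℝ) : (bpiece t e (q + 1) i).eval x =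
      (x - t i) / (t (i + q + 1) - t i) * (bpiece t e q i).eval x
      + (t (i + q + 2) - x) / (t (i + q + 2) - t (i + 1)) * (bpiece t e q (i + 1)).eval x := by
  simp [bpiece_succ]
  ring

/-- Functions and pieces obey the same recursion, so agreement in degree zero at the single point
`x` suffices. This form of the hypothesis also covers `x = 1`, where the last nonempty span is
closed. -/
theorem bspline_eq_eval_bpiece {t : ℕ → ℝ} {e : ℕ} {x : ℝ}
    (h : ∀ i, bspline t 0 i x = if i = e then 1 else 0) (q i : ℕ) :
    bspline t q i x = (bpiece t e q i).eval x := by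
  induction q generalizing i with
  | zero => rw [h, bpiece_zero]; split_ifs <;> simp
  | succ q ih => rw [eval_bpiece_succ, ← ih, ← ih]; rfl

theorem bpiece_eq_zero (t : ℕ → ℝ) {e q i : ℕ} (h : i + q < e ∨ e < i) : bpiece t e q i = 0 := by
  induction q generalizing i with
  | zero => rw [bpiece_zero, if_neg (by omega)]
  | succ q ih => rw [bpiece_succ, ih (by omega), ih (by omega)]; simp

theorem natDegree_bpiece_le (t : ℕ → ℝ) (e q i : ℕ) : (bpiece t e q i).natDegree ≤ q := by
  induction q generalizing i with
  | zero => rw [bpiece_zero]; split_ifs <;> simp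
  | succ q ih =>
    rw [bpiece_succ]
    refine Polynomial.natDegree_add_le_of_degree_le ?_ ?_
    · refine Polynomial.natDegree_mul_le.trans ?_
      have h1 : (Polynomial.C (t (i + q + 1) - t i)⁻¹ *
          (Polynomial.X - Polynomial.C (t i))).natDegree ≤ 1 :=
        (Polynomial.natDegree_C_mul_le _ _).trans (Polynomial.natDegree_X_sub_C_le _)
      have := ih i
      omega
    · refine Polynomial.natDegree_mul_le.trans ?_
      have h1 : (Polynomial.C (t (i + q + 2) - t (i + 1))⁻¹ *
          (Polynomial.C (t (i + q + 2)) - Polynomial.X)).natDegree ≤ 1 := by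
        refine (Polynomial.natDegree_C_mul_le _ _).trans ?_
        rw [← Polynomial.natDegree_neg, neg_sub]
        exact Polynomial.natDegree_X_sub_C_le _
      have := ih (i + 1)
      omega

/-- On a nonempty span, the knots of a B-spline that lives there do not all coincide. -/
theorem knot_sub_ne_zero {t : ℕ → ℝ} (ht : Monotone t) {e : ℕ} (he : t e < t (e + 1)) {q i : ℕ}
    (h1 : i ≤ e) (h2 : e ≤ i + q) : t (i + q + 1) - t i ≠ 0 := by
  have h3 := ht h1
  have h4 := ht (show e + 1 ≤ i + q + 1 by omega)
  exact (sub_pos.mpr (h3.trans_lt (he.trans_le h4))).ne'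

/-- Partition of unity. A shift of the index in the second half of the recursion gives every piece
of degree `q` the total weight 1. The end terms of the shift vanish, since the indices `0` and `n`
do not live on the span `e`. -/
theorem sum_bpiece {t : ℕ → ℝ} (ht : Monotone t) {e : ℕ} (he : t e < t (e + 1)) {q n : ℕ}
    (hq : q ≤ e) (hn : e < n) : ∑ i ∈ Finset.range n, bpiece t e q i = 1 := by
  induction q with
  | zero => simp [bpiece_zero, hn]
  | succ q ih =>
    rw [← ih (by omega)]
    simp only [bpiece_succ, Finset.sum_add_distrib]
    have h0 : bpiece t e q 0 = 0 := bpiece_eq_zero t (by omega)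
    have h1 : bpiece t e q n = 0 := bpiece_eq_zero t (by omega)
    have key : ∑ i ∈ Finset.range n, Polynomial.C (t (i + q + 2) - t (i + 1))⁻¹ *
        (Polynomial.C (t (i + q + 2)) - Polynomial.X) * bpiece t e q (i + 1) =
        ∑ i ∈ Finset.range n, Polynomial.C (t (i + q + 1) - t i)⁻¹ *
        (Polynomial.C (t (i + q + 1)) - Polynomial.X) * bpiece t e q i := by
      have h2 := Finset.sum_range_succ' (fun i => Polynomial.C (t (i + q + 1) - t i)⁻¹ *
        (Polynomial.C (t (i + q + 1)) - Polynomial.X) * bpiece t e q i) n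
      rw [Finset.sum_range_succ, h0, h1, mul_zero, mul_zero, add_zero, add_zero] at h2
      rw [h2]
      refine Finset.sum_congr rfl fun i _ => ?_
      rw [show i + 1 + q + 1 = i + q + 2 by ring]
    rw [key, ← Finset.sum_add_distrib]
    refine Finset.sum_congr rfl fun i _ => ?_
    by_cases h : i ≤ e ∧ e ≤ i + q
    · have h3 := knot_sub_ne_zero ht he h.1 h.2
      have h4 : Polynomial.C (t (i + q + 1) - t i)⁻¹ *
          (Polynomial.C (t (i + q + 1)) - Polynomial.C (t i)) = (1 : Polynomial ℝ) := by
        rw [← Polynomial.C_sub, ← Polynomial.C_mul, inv_mul_cancel₀ h3, Polynomial.C_1]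
      linear_combination bpiece t e q i * h4
    · rw [bpiece_eq_zero t (by omega)]; simp

/-- Induction on the degree: once both sides are expanded, they differ by a multiple of the piece `i
+ 1`, and its factor vanishes because two normalized knot differences both equal 1. Where these
quotients could be degenerate, that piece is zero. -/
theorem derivative_bpiece_succ {t : ℕ → ℝ} (ht : Monotone t) {e : ℕ} (he : t e < t (e + 1))
    (q i : ℕ) : Polynomial.derivative (bpiece t e (q + 1) i) =
      ((q : Polynomial ℝ) + 1) * (Polynomial.C (t (i + q + 1) - t i)⁻¹ * bpiece t e q i
        - Polynomial.C (t (i + q + 2) - t (i + 1))⁻¹ * bpiece t e q (i + 1)) := by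
  induction q generalizing i with
  | zero =>
    simp only [bpiece_succ, bpiece_zero]
    split_ifs <;> simp [sub_eq_add_neg]
  | succ q ih =>
    rw [bpiece_succ t e (q + 1)]
    simp only [Polynomial.derivative_add, Polynomial.derivative_mul, Polynomial.derivative_sub,
      Polynomial.derivative_C, Polynomial.derivative_X, ih]
    rw [bpiece_succ t e q i, bpiece_succ t e q (i + 1)]
    simp only [show i + (q + 1) + 1 = i + q + 2 by ring, show i + (q + 1) + 2 = i + q + 3 by ring,
      show i + 1 + q + 1 = i + q + 2 by ring, show i + 1 + q + 2 = i + q + 3 by ring,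
      show i + 1 + 1 = i + 2 by ring]
    by_cases h : i + 1 ≤ e ∧ e ≤ i + 1 + q
    · have h1 : t (i + q + 2) - t i ≠ 0 :=
        knot_sub_ne_zero ht he (q := q + 1) (show i ≤ e by omega) (by omega)
      have h2 : t (i + q + 3) - t (i + 1) ≠ 0 := by
        have := knot_sub_ne_zero ht he (q := q + 1) h.1 (by omega)
        rwa [show i + 1 + (q + 1) + 1 = i + q + 3 by ring] at this
      have h3 : Polynomial.C (t (i + q + 2) - t i)⁻¹ *
          (Polynomial.C (t (i + q + 2)) - Polynomial.C (t i)) = (1 : Polynomial ℝ) := by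
        rw [← Polynomial.C_sub, ← Polynomial.C_mul, inv_mul_cancel₀ h1, Polynomial.C_1]
      have h4 : Polynomial.C (t (i + q + 3) - t (i + 1))⁻¹ *
          (Polynomial.C (t (i + q + 3)) - Polynomial.C (t (i + 1))) = (1 : Polynomial ℝ) := by
        rw [← Polynomial.C_sub, ← Polynomial.C_mul, inv_mul_cancel₀ h2, Polynomial.C_1]
      push_cast
      linear_combination (((q : Polynomial ℝ) + 1) * Polynomial.C (t (i + q + 2) - t (i + 1))⁻¹ *
        bpiece t e q (i + 1)) * (h4 - h3)
    · rw [bpiece_eq_zero t (i := i + 1) (by omega)]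
      push_cast
      ring

/-- Local linear independence. The derivative of the sum has coefficients proportional to `c i - c
(i - 1)`; by induction these vanish, so the active coefficients are all equal, and the partition of
unity shows that their common value is zero. -/
theorem eq_zero_of_sum_bpiece_eq_zero {t : ℕ → ℝ} (ht : Monotone t) {e : ℕ}
    (he : t e < t (e + 1)) {q n : ℕ} (hq : q ≤ e) (hn : e < n) {c : ℕ → ℝ}
    (hc : ∑ i ∈ Finset.range n, Polynomial.C (c i) * bpiece t e q i = 0) {i : ℕ} (h1 : i ≤ e)
    (h2 : e ≤ i + q) : c i = 0 := by
  induction q generalizing c i with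
  | zero =>
    obtain rfl : i = e := by omega
    simpa [bpiece_zero, hn] using hc
  | succ q ih =>
    have hd := congrArg Polynomial.derivative hc
    simp only [Polynomial.derivative_sum, Polynomial.derivative_mul, Polynomial.derivative_C,
      zero_mul, zero_add, derivative_bpiece_succ ht he, Polynomial.derivative_zero] at hd
    have h0 : bpiece t e q 0 = 0 := bpiece_eq_zero t (by omega)
    have hn0 : bpiece t e q n = 0 := bpiece_eq_zero t (by omega)
    -- The truncation of `i - 1` at `i = 0` is harmless: the piece `0` of degree `q` does not reach
    -- the span `e`.
    have key : ∑ i ∈ Finset.range n,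
        Polynomial.C ((c i - c (i - 1)) * (t (i + q + 1) - t i)⁻¹) * bpiece t e q i = 0 := by
      have e1 : ∑ i ∈ Finset.range n, Polynomial.C (c i) *
          (Polynomial.C (t (i + q + 2) - t (i + 1))⁻¹ * bpiece t e q (i + 1)) =
          ∑ i ∈ Finset.range n, Polynomial.C (c (i - 1)) *
          (Polynomial.C (t (i + q + 1) - t i)⁻¹ * bpiece t e q i) := by
        have h2 := Finset.sum_range_succ' (fun i => Polynomial.C (c (i - 1)) *
          (Polynomial.C (t (i + q + 1) - t i)⁻¹ * bpiece t e q i)) n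
        rw [Finset.sum_range_succ, h0, hn0, mul_zero, mul_zero, mul_zero, mul_zero, add_zero,
          add_zero] at h2
        rw [h2]
        refine Finset.sum_congr rfl fun i _ => ?_
        rw [show i + 1 + q + 1 = i + q + 2 by ring, Nat.add_sub_cancel]
      have e2 : ((q : Polynomial ℝ) + 1) * ∑ i ∈ Finset.range n,
          Polynomial.C ((c i - c (i - 1)) * (t (i + q + 1) - t i)⁻¹) * bpiece t e q i = 0 := by
        rw [← hd]
        simp only [mul_sub, mul_left_comm (Polynomial.C (c _)) ((q : Polynomial ℝ) + 1),
          Finset.sum_sub_distrib, ← Finset.mul_sum, e1]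
        rw [← mul_sub, ← Finset.sum_sub_distrib]
        congr 1
        refine Finset.sum_congr rfl fun i _ => ?_
        rw [Polynomial.C_mul, Polynomial.C_sub]
        ring
      have h3 : ((q : Polynomial ℝ) + 1) ≠ 0 := by exact_mod_cast Nat.succ_ne_zero q
      exact (mul_eq_zero.mp e2).resolve_left h3
    have hstep : ∀ i, i ≤ e → e ≤ i + q → c i = c (i - 1) := by
      intro i hi1 hi2
      have h4 := ih (by omega) key hi1 hi2
      have h5 := inv_ne_zero (knot_sub_ne_zero ht he hi1 hi2)
      linarith [(mul_eq_zero.mp h4).resolve_right h5]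
    have hconst : ∀ i, i ≤ e → e ≤ i + (q + 1) → c i = c e := by
      intro i hi1 hi2
      induction hi1 using Nat.decreasingInduction with
      | self => rfl
      | of_succ k hk ihk =>
        rw [← ihk (by omega), hstep (k + 1) (by omega) (by omega), Nat.add_sub_cancel]
    have h6 : Polynomial.C (c e) = 0 := by
      rw [← mul_one (Polynomial.C (c e)), ← sum_bpiece ht he hq hn, Finset.mul_sum, ← hc]
      refine Finset.sum_congr rfl fun j _ => ?_
      by_cases hj : j ≤ e ∧ e ≤ j + (q + 1)
      · rw [hconst j hj.1 hj.2]
      · rw [bpiece_eq_zero t (by omega)]; simp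
    rw [hconst i h1 h2]
    simpa using h6

/-- The pieces on two neighbouring nonempty spans match at the knot between them if its
multiplicity is at most the degree. -/
theorem eval_bpiece_knot {t : ℕ → ℝ} {e m : ℕ} {τ : ℝ} (h1 : t e < τ)
    (h2 : ∀ j, e < j → j ≤ e + m → t j = τ) (h3 : τ < t (e + m + 1)) {q : ℕ} (hq : m ≤ q) (i : ℕ) :
    (bpiece t e q i).eval τ = (bpiece t (e + m) q i).eval τ := by
  -- Up to degree `m` exactly one piece is nonzero at `τ`: index `e` seen from the left, index `e +
  -- m - q` seen from the right. In degree `m` the two indices coincide, and in higher degrees the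
  -- common recursion preserves the agreement.
  have hL : ∀ q ≤ m, ∀ i, (bpiece t e q i).eval τ = if i = e then 1 else 0 := by
    intro q
    induction q with
    | zero => intro _ i; rw [bpiece_zero]; split_ifs <;> simp
    | succ q ih =>
      intro hq i
      rw [eval_bpiece_succ, ih (by omega), ih (by omega)]
      by_cases hi : i = e
      · subst hi
        rw [if_pos rfl, if_neg (by omega), h2 (i + q + 1) (by omega) (by omega),
          div_self (sub_ne_zero.mpr h1.ne')]
        ring
      · rw [if_neg hi]
        by_cases hi' : i + 1 = e
        · rw [h2 (i + q + 2) (by omega) (by omega)]; simp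
        · rw [if_neg hi']; simp
  have hR : ∀ q ≤ m, ∀ i, (bpiece t (e + m) q i).eval τ = if i + q = e + m then 1 else 0 := by
    intro q
    induction q with
    | zero => intro _ i; rw [bpiece_zero, add_zero]; split_ifs <;> simp
    | succ q ih =>
      intro hq i
      rw [eval_bpiece_succ, ih (by omega), ih (by omega)]
      by_cases hi : i + (q + 1) = e + m
      · rw [if_pos hi, if_neg (by omega), if_pos (by omega), h2 (i + 1) (by omega) (by omega),
          show i + q + 2 = e + m + 1 by omega, div_self (sub_ne_zero.mpr h3.ne')]
        ring
      · rw [if_neg hi, if_neg (show ¬ i + 1 + q = e + m by omega)]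
        by_cases hi' : i + q = e + m
        · rw [h2 i (by omega) (by omega)]; simp
        · rw [if_neg hi']; simp
  induction q, hq using Nat.le_induction generalizing i with
  | base => rw [hL m le_rfl, hR m le_rfl]; simp
  | succ q hq ih => rw [eval_bpiece_succ, eval_bpiece_succ, ih, ih]

/-! ### B-splines on closed Bézier elements: values, derivatives, C¹ regularity. -/

namespace KnotVector

variable (κ : KnotVector)

/-- The index of a nonempty knot span, i.e. of a Bézier element. -/
def IsSpan (e : ℕ) : Prop := κ.degree ≤ e ∧ e < κ.size ∧ κ.knot e < κ.knot (e + 1)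

/-- The closed Bézier element. -/
def span (e : ℕ) : Set ℝ := Icc (κ.knot e) (κ.knot (e + 1))

theorem knot_nonneg (i : ℕ) : 0 ≤ κ.knot i := by
  rw [← κ.knot_left 0 (Nat.zero_le _)]; exact κ.monotone (Nat.zero_le _)

theorem knot_le_one (i : ℕ) : κ.knot i ≤ 1 := by
  rw [← κ.knot_right (max i κ.size) (le_max_right _ _)]; exact κ.monotone (le_max_left _ _)

theorem span_subset (e : ℕ) : κ.span e ⊆ Icc 0 1 := fun _ hx =>
  ⟨(κ.knot_nonneg _).trans hx.1, hx.2.trans (κ.knot_le_one _)⟩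

theorem isSpan_of_lt {e : ℕ} (h : κ.knot e < κ.knot (e + 1)) : κ.IsSpan e := by
  refine ⟨?_, ?_, h⟩
  · by_contra! h1
    rw [κ.knot_left e h1.le, κ.knot_left (e + 1) h1] at h
    exact h.false
  · by_contra! h1
    rw [κ.knot_right e h1, κ.knot_right (e + 1) (by omega)] at h
    exact h.false

theorem isSpan_degree : κ.IsSpan κ.degree := by
  refine ⟨le_rfl, κ.degree_lt_size, ?_⟩
  rw [κ.knot_left _ le_rfl]
  exact κ.knot_inner_pos

theorem size_pos : 0 < κ.size := (Nat.zero_le _).trans_lt κ.degree_lt_size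

theorem isSpan_last : κ.IsSpan (κ.size - 1) := by
  have := κ.degree_lt_size
  refine ⟨by omega, by omega, ?_⟩
  rw [κ.knot_right (κ.size - 1 + 1) (by omega)]
  exact κ.knot_inner_lt

/-- The span that contains a given parameter, with the last span closed. -/
theorem exists_bspline_zero {x : ℝ} (hx : x ∈ Icc (0 : ℝ) 1) :
    ∃ e, κ.IsSpan e ∧ x ∈ κ.span e ∧ (x < κ.knot (e + 1) ∨ x = 1) ∧
      ∀ i, bspline κ.knot 0 i x = if i = e then 1 else 0 := by
  rcases hx.2.lt_or_eq with h1 | rfl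
  · have hex : ∃ j, x < κ.knot j := ⟨κ.size, by rwa [κ.knot_right _ le_rfl]⟩
    classical
    obtain ⟨e, he⟩ : ∃ e, Nat.find hex = e + 1 := by
      refine Nat.exists_eq_succ_of_ne_zero fun h => ?_
      have := Nat.find_spec hex
      rw [h, κ.knot_left 0 (Nat.zero_le _)] at this
      exact this.not_ge hx.1
    have hlt : x < κ.knot (e + 1) := he ▸ Nat.find_spec hex
    have hle : κ.knot e ≤ x := not_lt.mp (Nat.find_min hex (by omega))
    refine ⟨e, κ.isSpan_of_lt (hle.trans_lt hlt), ⟨hle, hlt.le⟩, Or.inl hlt, fun i => ?_⟩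
    rw [bspline]
    congr 1
    simp only [eq_iff_iff]
    constructor
    · rintro (⟨h2, h3⟩ | ⟨h2, -⟩)
      · by_contra hne
        rcases lt_or_gt_of_ne hne with h | h
        · exact absurd (κ.monotone (show i + 1 ≤ e from h)) (not_le.mpr (hle.trans_lt h3))
        · exact absurd (κ.monotone (show e + 1 ≤ i from h)) (not_le.mpr (h2.trans_lt hlt))
      · exact absurd h2 h1.ne
    · rintro rfl
      exact Or.inl ⟨hle, hlt⟩
  · have hs := κ.isSpan_last
    have hn := κ.size_pos
    have h1 : κ.knot (κ.size - 1 + 1) = 1 := κ.knot_right _ (by omega)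
    refine ⟨κ.size - 1, hs, ⟨κ.knot_le_one _, h1.ge⟩, Or.inr rfl, fun i => ?_⟩
    rw [bspline]
    congr 1
    simp only [eq_iff_iff]
    constructor
    · rintro (⟨-, h3⟩ | ⟨-, h3, h4⟩)
      · exact absurd (κ.knot_le_one _) (not_le.mpr h3)
      · by_contra hne
        rcases lt_or_gt_of_ne hne with h | h
        · exact absurd (κ.monotone (show i + 1 ≤ κ.size - 1 from h))
            (not_le.mpr (by rw [h4]; exact κ.knot_inner_lt))
        · exact h3.ne (κ.knot_right i (by omega))
    · rintro rfl
      exact Or.inr ⟨trivial, κ.knot_inner_lt, h1⟩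

theorem exists_mem_span {x : ℝ} (hx : x ∈ Icc (0 : ℝ) 1) : ∃ e, κ.IsSpan e ∧ x ∈ κ.span e :=
  let ⟨e, h1, h2, _⟩ := κ.exists_bspline_zero hx
  ⟨e, h1, h2⟩

/-- B-splines of degree at least `degree - 1` agree with their polynomial pieces on closed
Bézier elements. -/
theorem bspline_eq_eval_of_mem_span {e : ℕ} (he : κ.IsSpan e) {x : ℝ} (hx : x ∈ κ.span e) {q : ℕ}
    (hq : κ.degree - 1 ≤ q) (i : ℕ) : bspline κ.knot q i x = (bpiece κ.knot e q i).eval x := by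
  obtain ⟨e', he', hx', hx1, h0⟩ := κ.exists_bspline_zero (κ.span_subset e hx)
  rw [bspline_eq_eval_bpiece h0]
  -- The half-open convention may assign `x` to another span `e'`, but only to one on the right of
  -- `e`. Then `x` is the knot between them, and its multiplicity, at most `degree - 1`, lets the
  -- two pieces match.
  rcases lt_trichotomy e' e with h | rfl | h
  · exfalso
    have h2 := κ.monotone (show e' + 1 ≤ e from h)
    rcases hx1 with h3 | h3
    · exact (h3.trans_le (h2.trans hx.1)).false
    · exact (he.2.2.trans_le ((κ.knot_le_one _).trans (h3.ge.trans (hx'.2.trans h2)))).false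
  · rfl
  · have hτ : ∀ j, e < j → j ≤ e' → κ.knot j = x := fun j h1 h2 =>
      le_antisymm ((κ.monotone h2).trans hx'.1) (hx.2.trans (κ.monotone h1))
    have hlt : x < κ.knot (e' + 1) := by
      rcases hx1 with h3 | h3
      · exact h3
      · have h4 := hτ e' h le_rfl
        exact h4 ▸ he'.2.2
    have hgt : κ.knot e < x := by rw [← hτ (e + 1) (by omega) h]; exact he.2.2
    obtain ⟨m, rfl⟩ := Nat.exists_eq_add_of_le h.le
    refine (eval_bpiece_knot hgt hτ hlt (le_trans ?_ hq) i).symm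
    by_contra! hm
    have h5 : κ.knot (e + 1) = x := hτ _ (by omega) (by omega)
    have h6 := κ.multiplicity (e + 1) (by rw [h5]; exact (κ.knot_nonneg _).trans_lt hgt)
      (by rw [h5]; exact hlt.trans_le (κ.knot_le_one _))
    rw [h5, hτ (e + 1 + (κ.degree - 1)) (by omega) (by omega)] at h6
    exact h6.false

theorem basis_eq_eval {e : ℕ} (he : κ.IsSpan e) {x : ℝ} (hx : x ∈ κ.span e) (i : ℕ) :
    κ.basis i x = (bpiece κ.knot e κ.degree i).eval x :=
  κ.bspline_eq_eval_of_mem_span he hx (Nat.sub_le _ _) i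

/-- The derivatives of the B-splines. -/
def basisDeriv (i : ℕ) (x : ℝ) : ℝ :=
  κ.degree * ((κ.knot (i + κ.degree) - κ.knot i)⁻¹ * bspline κ.knot (κ.degree - 1) i x
    - (κ.knot (i + κ.degree + 1) - κ.knot (i + 1))⁻¹ * bspline κ.knot (κ.degree - 1) (i + 1) x)

/-- Here the bound `degree - 1` on the multiplicity is needed in full: the B-splines of degree
`degree - 1` must match their pieces on closed elements, so that the one-sided derivatives at a knot
agree. -/
theorem basisDeriv_eq_eval {e : ℕ} (he : κ.IsSpan e) {x : ℝ} (hx : x ∈ κ.span e) (i : ℕ) :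
    κ.basisDeriv i x = (Polynomial.derivative (bpiece κ.knot e κ.degree i)).eval x := by
  obtain ⟨q, hq⟩ : ∃ q, κ.degree = q + 1 :=
    Nat.exists_eq_succ_of_ne_zero (by have := κ.two_le_degree; omega)
  have h1 := fun i => κ.bspline_eq_eval_of_mem_span he hx le_rfl i
  simp only [basisDeriv, h1]
  rw [hq, derivative_bpiece_succ κ.monotone he.2.2, Nat.add_sub_cancel]
  simp [add_assoc]

/-- The closed Bézier elements cover the parameter interval. -/
theorem Icc_subset_iUnion_span : Icc (0 : ℝ) 1 ⊆ ⋃ e : {e : Fin κ.size // κ.IsSpan e}, κ.span e := by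
  intro x hx
  obtain ⟨e, he, h⟩ := κ.exists_mem_span hx
  exact mem_iUnion.mpr ⟨⟨⟨e, he.2.1⟩, he⟩, h⟩

/-- Derivatives within finitely many closed sets combine to one within their union; a closed element
that misses `x` imposes no condition. -/
theorem hasDerivWithinAt_of_span {f : ℝ → ℝ} {f' x : ℝ}
    (h : ∀ e, κ.IsSpan e → x ∈ κ.span e → HasDerivWithinAt f f' (κ.span e) x) :
    HasDerivWithinAt f f' (Icc 0 1) x := by
  classical
  refine HasDerivWithinAt.mono ?_ κ.Icc_subset_iUnion_span
  have key : ∀ s : Finset {e : Fin κ.size // κ.IsSpan e},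
      HasFDerivWithinAt f (ContinuousLinearMap.toSpanSingleton ℝ f') (⋃ e ∈ s, κ.span e) x := by
    intro s
    induction s using Finset.induction_on with
    | empty =>
      simp only [Finset.notMem_empty, iUnion_of_empty, iUnion_empty]
      exact .of_notMem_closure (by simp)
    | insert a s _ ih =>
      rw [Finset.set_biUnion_insert]
      refine HasFDerivWithinAt.union ?_ ih
      by_cases hx : x ∈ κ.span a
      · exact (h a a.2 hx).hasFDerivWithinAt
      · exact .of_notMem_closure (by rwa [show κ.span a = Icc _ _ from rfl, closure_Icc])
  have := key Finset.univ
  simp only [Finset.mem_univ, iUnion_true] at this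
  simpa using this.hasDerivWithinAt

theorem hasDerivWithinAt_basis (i : ℕ) {x : ℝ} :
    HasDerivWithinAt (κ.basis i) (κ.basisDeriv i x) (Icc 0 1) x := by
  refine κ.hasDerivWithinAt_of_span fun e he hx => ?_
  rw [κ.basisDeriv_eq_eval he hx]
  exact ((bpiece κ.knot e κ.degree i).hasDerivAt x).hasDerivWithinAt.congr
    (fun y hy => κ.basis_eq_eval he hy i) (κ.basis_eq_eval he hx i)

theorem continuousOn_of_span {f : ℝ → ℝ}
    (h : ∀ e, κ.IsSpan e → ContinuousOn f (κ.span e)) : ContinuousOn f (Icc 0 1) := by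
  refine ContinuousOn.mono ?_ κ.Icc_subset_iUnion_span
  exact (locallyFinite_of_finite _).continuousOn_iUnion (fun e => isClosed_Icc) fun e => h e e.2

theorem continuousOn_basisDeriv (i : ℕ) : ContinuousOn (κ.basisDeriv i) (Icc 0 1) :=
  κ.continuousOn_of_span fun _ he =>
    (Polynomial.continuous _).continuousOn.congr fun _ hx => κ.basisDeriv_eq_eval he hx i

theorem continuousOn_basis (i : ℕ) : ContinuousOn (κ.basis i) (Icc 0 1) :=
  κ.continuousOn_of_span fun _ he =>
    (Polynomial.continuous _).continuousOn.congr fun _ hx => κ.basis_eq_eval he hx i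

theorem sum_basis {x : ℝ} (hx : x ∈ Icc (0 : ℝ) 1) : ∑ i : Fin κ.size, κ.basis i x = 1 := by
  obtain ⟨e, he, hxe⟩ := κ.exists_mem_span hx
  have h := congrArg (Polynomial.eval x) (sum_bpiece κ.monotone he.2.2 he.1 he.2.1)
  rw [Polynomial.eval_finsetSum, ← Fin.sum_univ_eq_sum_range
    (fun i => (bpiece κ.knot e κ.degree i).eval x)] at h
  simpa [κ.basis_eq_eval he hxe] using h

end KnotVector

/-! ### Gramians and dual bases -/

theorem intervalIntegrable_finsetSum {ι : Type*} (s : Finset ι) {f : ι → ℝ → ℝ} {a b : ℝ}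
    (h : ∀ i ∈ s, IntervalIntegrable (f i) volume a b) :
    IntervalIntegrable (fun x => ∑ i ∈ s, f i x) volume a b := by
  have := IntervalIntegrable.sum s h
  rwa [show (∑ i ∈ s, f i) = fun x => ∑ i ∈ s, f i x from funext fun x => Finset.sum_apply ..]
    at this

theorem intervalIntegral_congr_Ico {f g : ℝ → ℝ} {a b : ℝ} (hab : a ≤ b)
    (h : ∀ x ∈ Ico a b, f x = g x) : ∫ x in a..b, f x = ∫ x in a..b, g x :=
  intervalIntegral.integral_congr_Ioo_of_le hab fun x hx => h x ⟨hx.1.le, hx.2⟩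

theorem eqOn_zero_of_integral_sq_mul {a b : ℝ} (hab : a < b) {f ρ : ℝ → ℝ}
    (hf : ContinuousOn f (Icc a b)) (hρ : ContinuousOn ρ (Icc a b)) (hρ0 : ∀ x ∈ Icc a b, 0 < ρ x)
    (h : ∫ x in a..b, f x * f x * ρ x = 0) : ∀ x ∈ Icc a b, f x = 0 := by
  by_contra! hne
  obtain ⟨x, hx, hfx⟩ := hne
  refine (intervalIntegral.integral_pos hab ((hf.mul hf).mul hρ) (fun y hy => ?_)
    ⟨x, hx, ?_⟩).ne' h
  · exact mul_nonneg (mul_self_nonneg _) (hρ0 y ⟨hy.1.le, hy.2⟩).le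
  · exact mul_pos (mul_self_pos.mpr hfx) (hρ0 x hx)

/-- The Gramian of linearly independent continuous functions is regular. -/
theorem isUnit_det_gram {ι : Type*} [Fintype ι] [DecidableEq ι] {a b : ℝ} (hab : a < b)
    {f : ι → ℝ → ℝ} {ρ : ℝ → ℝ} (hf : ∀ i, ContinuousOn (f i) (Icc a b))
    (hρ : ContinuousOn ρ (Icc a b)) (hρ0 : ∀ x ∈ Icc a b, 0 < ρ x)
    (hli : ∀ c : ι → ℝ, (∀ x ∈ Icc a b, ∑ i, c i * f i x = 0) → c = 0) :
    IsUnit (Matrix.of fun i j => ∫ x in a..b, f i x * f j x * ρ x).det := by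
  rw [isUnit_iff_ne_zero]
  intro h0
  obtain ⟨v, hv, hv0⟩ := Matrix.exists_mulVec_eq_zero_iff.mpr h0
  refine hv (hli v (eqOn_zero_of_integral_sq_mul hab
    (continuousOn_finsetSum _ fun i _ => continuousOn_const.mul (hf i)) hρ hρ0 ?_))
  have hint : ∀ i j, IntervalIntegrable (fun x => f i x * f j x * ρ x) volume a b := fun i j =>
    (((hf i).mul (hf j)).mul hρ).intervalIntegrable_of_Icc hab.le
  -- The quadratic form of the Gramian at a kernel vector `v` is the weighted integral of the square
  -- of `∑ v i * f i`.
  have h1 : ∑ i, v i * ∑ j, (∫ x in a..b, f i x * f j x * ρ x) * v j = 0 := by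
    refine Finset.sum_eq_zero fun i _ => ?_
    have := congrFun hv0 i
    simp only [Matrix.mulVec, dotProduct, Matrix.of_apply, Pi.zero_apply] at this
    rw [this, mul_zero]
  rw [← h1]
  simp only [Finset.mul_sum, ← intervalIntegral.integral_const_mul,
    ← intervalIntegral.integral_mul_const]
  have h2 : ∀ i j, IntervalIntegrable (fun x => v i * (f i x * f j x * ρ x * v j)) volume a b :=
    fun i j => ((hint i j).mul_const _).const_mul _
  simp only [← intervalIntegral.integral_finsetSum (fun j _ => h2 _ j)]
  rw [← intervalIntegral.integral_finsetSum
    (fun i _ => intervalIntegrable_finsetSum _ fun j _ => h2 i j)]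
  refine intervalIntegral.integral_congr fun x _ => ?_
  simp only [Finset.sum_mul]
  rw [Finset.sum_comm]
  exact Finset.sum_congr rfl fun i _ => Finset.sum_congr rfl fun j _ => by ring

theorem Polynomial.eq_zero_of_eval_eq_zero_Icc {P : Polynomial ℝ} {a b : ℝ} (hab : a < b)
    (h : ∀ x ∈ Icc a b, P.eval x = 0) : P = 0 :=
  Polynomial.eq_zero_of_infinite_isRoot P ((Icc_infinite hab).mono h)

/-- The Bernstein polynomials are linearly independent over the reals. -/
theorem eq_zero_of_sum_bernsteinPolynomial {n : ℕ} {c : Fin (n + 1) → ℝ}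
    (h : ∀ x ∈ Icc (0 : ℝ) 1, ∑ j, c j * (bernsteinPolynomial ℝ n j).eval x = 0) : c = 0 := by
  have h1 : (∑ j : Fin (n + 1),
      Polynomial.C (c j * (n.choose j : ℝ)) * Polynomial.X ^ (j : ℕ)) = 0 := by
    -- The substitution `x = y / (1 + y)` turns the Bernstein polynomials, up to the common factor
    -- `(1 + y)⁻¹ ^ n`, into binomial multiples of the monomials in `y`.
    refine Polynomial.eq_zero_of_eval_eq_zero_Icc (zero_lt_one' ℝ) fun y hy => ?_
    have hy1 : 0 < 1 + y := by linarith [hy.1]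
    have h2 := h (y / (1 + y)) ⟨div_nonneg hy.1 hy1.le, (div_le_one hy1).mpr (by linarith)⟩
    have h3 : 1 - y / (1 + y) = 1 / (1 + y) := by field_simp; ring
    rw [Polynomial.eval_finsetSum]
    rw [← mul_eq_zero_iff_left (pow_pos (inv_pos.mpr hy1) n).ne', Finset.mul_sum, ← h2]
    refine Finset.sum_congr rfl fun j _ => ?_
    have hj : (1 + y)⁻¹ ^ n = (1 + y)⁻¹ ^ (j : ℕ) * (1 + y)⁻¹ ^ (n - j) := by
      rw [← pow_add, Nat.add_sub_cancel' (Nat.le_of_lt_succ j.2)]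
    simp only [bernsteinPolynomial, Polynomial.eval_mul, Polynomial.eval_C, Polynomial.eval_pow,
      Polynomial.eval_X, Polynomial.eval_natCast, Polynomial.eval_sub, Polynomial.eval_one, h3]
    simp only [hj, div_eq_mul_inv, mul_pow, one_mul]
    ring
  ext j
  have h2 := congrArg (Polynomial.coeff · (j : ℕ)) h1
  simp only [Polynomial.finsetSum_coeff, Polynomial.coeff_C_mul_X_pow, Polynomial.coeff_zero] at h2
  rw [Finset.sum_eq_single j (fun b _ hb => if_neg fun h => hb (Fin.ext h.symm)) (by simp),
    if_pos rfl] at h2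
  exact (mul_eq_zero.mp h2).resolve_right
    (by exact_mod_cast (Nat.choose_pos (by omega : (j : ℕ) ≤ n)).ne')

/-! ### Bernstein coefficients, linear independence and positivity of B-splines. -/

namespace KnotVector

variable (κ : KnotVector)

theorem continuous_bern (e : ℕ) (j : Fin (κ.degree + 1)) : Continuous (κ.bern e j) := by
  unfold bern
  exact (Polynomial.continuous _).comp (by fun_prop)

theorem eq_zero_of_sum_bern {e : ℕ} (he : κ.IsSpan e) {c : Fin (κ.degree + 1) → ℝ}
    (h : ∀ x ∈ Icc (κ.knot e) (κ.knot (e + 1)), ∑ j, c j * κ.bern e j x = 0) : c = 0 := by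
  refine eq_zero_of_sum_bernsteinPolynomial fun y hy => ?_
  have hd : 0 < κ.knot (e + 1) - κ.knot e := sub_pos.mpr he.2.2
  have := h (κ.knot e + y * (κ.knot (e + 1) - κ.knot e))
    ⟨by nlinarith [hy.1], by nlinarith [hy.2]⟩
  simpa [bern, hd.ne'] using this

/-- The Bernstein polynomials span the polynomials of degree at most `degree`. -/
theorem exists_eval_eq_sum_bern {e : ℕ} (he : κ.IsSpan e) {P : Polynomial ℝ}
    (hP : P.natDegree ≤ κ.degree) :
    ∃ α : Fin (κ.degree + 1) → ℝ, ∀ x, P.eval x = ∑ j, α j * κ.bern e j x := by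
  let L : Polynomial ℝ := Polynomial.C (κ.knot (e + 1) - κ.knot e)⁻¹ *
    (Polynomial.X - Polynomial.C (κ.knot e))
  have hL : ∀ x, L.eval x = (x - κ.knot e) / (κ.knot (e + 1) - κ.knot e) := fun x => by
    simp [L]; ring
  have hLd : L.natDegree ≤ 1 :=
    (Polynomial.natDegree_C_mul_le _ _).trans (Polynomial.natDegree_X_sub_C_le _)
  have hmem : ∀ Q : Polynomial ℝ, Q.natDegree ≤ κ.degree →
      Q ∈ Polynomial.degreeLT ℝ (κ.degree + 1) := fun Q hQ =>
    Polynomial.mem_degreeLT.mpr ((Polynomial.degree_le_natDegree).trans_lt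
      (by exact_mod_cast Nat.lt_succ_of_le hQ))
  let b : Fin (κ.degree + 1) → Polynomial ℝ := fun j => (bernsteinPolynomial ℝ κ.degree j).comp L
  have hb : ∀ j, (b j).natDegree ≤ κ.degree := fun j => by
    refine Polynomial.natDegree_comp_le.trans ?_
    have h1 : (bernsteinPolynomial ℝ κ.degree j).natDegree ≤ κ.degree := by
      unfold bernsteinPolynomial
      refine Polynomial.natDegree_mul_le.trans ?_
      have h2 : (((κ.degree.choose j : ℕ) : Polynomial ℝ) * Polynomial.X ^ (j : ℕ)).natDegree
          ≤ (j : ℕ) := by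
        refine Polynomial.natDegree_mul_le.trans ?_
        simp
      have h3 : ((1 - Polynomial.X : Polynomial ℝ) ^ (κ.degree - (j : ℕ))).natDegree
          ≤ κ.degree - j := by
        refine Polynomial.natDegree_pow_le.trans ?_
        have : (1 - Polynomial.X : Polynomial ℝ).natDegree ≤ 1 := by
          rw [← Polynomial.natDegree_neg, neg_sub]
          exact Polynomial.natDegree_X_sub_C_le 1
        nlinarith
      have := j.2
      omega
    nlinarith
  have hbe : ∀ j x, (b j).eval x = κ.bern e j x := fun j x => by
    rw [Polynomial.eval_comp, hL]; rfl
  have hli : LinearIndependent ℝ fun j => (⟨b j, hmem _ (hb j)⟩ :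
      Polynomial.degreeLT ℝ (κ.degree + 1)) := by
    rw [Fintype.linearIndependent_iff]
    intro c hc
    refine congrFun (κ.eq_zero_of_sum_bern he fun x _ => ?_)
    have h2 := congrArg (fun Q : Polynomial.degreeLT ℝ (κ.degree + 1) =>
      (Q : Polynomial ℝ).eval x) hc
    simpa [Polynomial.eval_finsetSum, hbe] using h2
  have hfin : Module.finrank ℝ (Polynomial.degreeLT ℝ (κ.degree + 1)) = κ.degree + 1 := by
    rw [(Polynomial.degreeLTEquiv ℝ (κ.degree + 1)).finrank_eq]; simp
  have hspan := hli.span_eq_top_of_card_eq_finrank' (by simp [hfin])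
  have hP' : (⟨P, hmem P hP⟩ : Polynomial.degreeLT ℝ (κ.degree + 1)) ∈
      Submodule.span ℝ (range fun j => (⟨b j, hmem _ (hb j)⟩ :
      Polynomial.degreeLT ℝ (κ.degree + 1))) := hspan ▸ Submodule.mem_top
  obtain ⟨α, hα⟩ := (Submodule.mem_span_range_iff_exists_fun ℝ).mp hP'
  refine ⟨α, fun x => ?_⟩
  have h2 := congrArg (fun Q : Polynomial.degreeLT ℝ (κ.degree + 1) =>
    (Q : Polynomial ℝ).eval x) hα
  simpa [Polynomial.eval_finsetSum, hbe] using h2.symm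

theorem isUnit_det_bernGram {e : ℕ} (he : κ.IsSpan e) {ρ : ℝ → ℝ}
    (hρ : ContinuousOn ρ (Icc 0 1)) (hρ0 : ∀ x ∈ Icc (0 : ℝ) 1, 0 < ρ x) :
    IsUnit (κ.bernGram ρ e).det :=
  isUnit_det_gram he.2.2 (fun j => (κ.continuous_bern e j).continuousOn)
    (hρ.mono (κ.span_subset e)) (fun x hx => hρ0 x (κ.span_subset e hx))
    fun _ hc => κ.eq_zero_of_sum_bern he hc

/-- The element extraction operator gives the Bernstein coefficients of the B-splines. -/
theorem basis_eq_sum_extraction {e : ℕ} (he : κ.IsSpan e) (a : Fin (κ.degree + 1)) {x : ℝ}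
    (hx : x ∈ κ.span e) :
    κ.basis (e - κ.degree + a) x = ∑ j, κ.extraction e a j * κ.bern e j x := by
  choose α hα using fun a : Fin (κ.degree + 1) => κ.exists_eval_eq_sum_bern he
    (natDegree_bpiece_le κ.knot e κ.degree (e - κ.degree + a))
  have hα' : ∀ a : Fin (κ.degree + 1), ∀ x ∈ κ.span e, κ.basis (e - κ.degree + a) x = ∑ j, α a j * κ.bern e j x :=
    fun a x hx => (κ.basis_eq_eval he hx _).trans (hα a x)
  -- With N = αB on the element, the moments of N against B are α times the unweighted Gramian, so
  -- the `L²`-projection that defines `extraction` returns α.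
  have h1 : (Matrix.of fun (a j : Fin (κ.degree + 1)) => ∫ x in κ.knot e..κ.knot (e + 1),
      κ.basis (e - κ.degree + a) x * κ.bern e j x) =
      Matrix.of α * κ.bernGram (fun _ => 1) e := by
    ext a j
    rw [Matrix.mul_apply]
    simp only [Matrix.of_apply, bernGram, ← intervalIntegral.integral_const_mul]
    rw [← intervalIntegral.integral_finsetSum]
    · refine intervalIntegral.integral_congr fun x hx => ?_
      rw [uIcc_of_le he.2.2.le] at hx
      simp only [hα' a x hx, Finset.sum_mul]
      exact Finset.sum_congr rfl fun k _ => by ring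
    · intro k _
      have h1 := κ.continuous_bern e k
      have h2 := κ.continuous_bern e j
      exact Continuous.intervalIntegrable (by fun_prop) _ _
  have h2 : κ.extraction e = Matrix.of α := by
    rw [extraction, h1, Matrix.mul_nonsing_inv_cancel_right]
    exact κ.isUnit_det_bernGram he continuousOn_const fun _ _ => one_pos
  rw [h2]
  exact hα' a x hx

/-- The B-splines that live on an element are linearly independent there. -/
theorem eq_zero_of_sum_basis_span {e : ℕ} (he : κ.IsSpan e) {c : Fin κ.size → ℝ}
    (h : ∀ x ∈ κ.span e, ∑ i, c i * κ.basis i x = 0) {i : Fin κ.size} (h1 : (i : ℕ) ≤ e)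
    (h2 : e ≤ i + κ.degree) : c i = 0 := by
  let c' : ℕ → ℝ := fun i => if hi : i < κ.size then c ⟨i, hi⟩ else 0
  have hc' : ∀ i : Fin κ.size, c' i = c i := fun i => dif_pos i.2
  rw [← hc' i]
  refine eq_zero_of_sum_bpiece_eq_zero κ.monotone he.2.2 he.1 he.2.1 (c := c') ?_ h1 h2
  refine Polynomial.eq_zero_of_eval_eq_zero_Icc he.2.2 fun x hx => ?_
  rw [← h x hx, Polynomial.eval_finsetSum, ← Fin.sum_univ_eq_sum_range
    (fun i => (Polynomial.C (c' i) * bpiece κ.knot e κ.degree i).eval x)]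
  refine Finset.sum_congr rfl fun i _ => ?_
  rw [hc', Polynomial.eval_mul, Polynomial.eval_C, κ.basis_eq_eval he hx]

/-- Every B-spline lives on some element. -/
theorem exists_isSpan_mem_support {i : ℕ} (hi : i < κ.size) :
    ∃ e, κ.IsSpan e ∧ i ≤ e ∧ e ≤ i + κ.degree := by
  by_contra! h
  -- If all spans in the support were empty, `degree + 2` consecutive knots would coincide; by
  -- openness of the knot vector they would be inner knots, against the bound on the multiplicity.
  have hconst : ∀ k, k ≤ κ.degree + 1 → κ.knot (i + k) = κ.knot i := by
    intro k
    induction k with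
    | zero => intro _; rfl
    | succ k ih =>
      intro hk
      rw [← ih (by omega)]
      refine le_antisymm (not_lt.mp fun hlt => ?_) (κ.monotone (by omega))
      have := h (i + k) (κ.isSpan_of_lt hlt) (by omega)
      omega
  have hp := κ.two_le_degree
  have h0 : 0 < κ.knot i := by
    rw [← hconst (κ.degree + 1) le_rfl]
    exact κ.knot_inner_pos.trans_le (κ.monotone (by omega))
  have h1 : κ.knot i < 1 := (κ.monotone (by omega)).trans_lt κ.knot_inner_lt
  have := κ.multiplicity i h0 h1
  rw [hconst _ (by omega)] at this
  exact this.false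

theorem eq_zero_of_sum_basis {c : Fin κ.size → ℝ}
    (h : ∀ x ∈ Icc (0 : ℝ) 1, ∑ i, c i * κ.basis i x = 0) : c = 0 := by
  ext i
  obtain ⟨e, he, h1, h2⟩ := κ.exists_isSpan_mem_support i.2
  exact κ.eq_zero_of_sum_basis_span he (fun x hx => h x (κ.span_subset e hx)) h1 h2

theorem eval_bpiece_nonneg {e : ℕ} {x : ℝ} (hx : x ∈ κ.span e) (q i : ℕ) :
    0 ≤ (bpiece κ.knot e q i).eval x := by
  induction q generalizing i with
  | zero => rw [bpiece_zero]; split_ifs <;> simp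
  | succ q ih =>
    by_cases h : e ≤ i + (q + 1) ∧ i ≤ e
    · rw [eval_bpiece_succ]
      have hm : ∀ {a b : ℕ}, a ≤ b → 0 ≤ κ.knot b - κ.knot a := fun h =>
        sub_nonneg.mpr (κ.monotone h)
      refine add_nonneg ?_ ?_
      · exact mul_nonneg (div_nonneg (sub_nonneg.mpr ((κ.monotone h.2).trans hx.1))
          (hm (by omega))) (ih i)
      · exact mul_nonneg (div_nonneg (sub_nonneg.mpr (hx.2.trans (κ.monotone (by omega))))
          (hm (by omega))) (ih (i + 1))
    · rw [bpiece_eq_zero _ (by omega)]; simp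

theorem basis_nonneg (i : ℕ) {x : ℝ} (hx : x ∈ Icc (0 : ℝ) 1) : 0 ≤ κ.basis i x := by
  obtain ⟨e, he, hxe⟩ := κ.exists_mem_span hx
  rw [κ.basis_eq_eval he hxe]
  exact κ.eval_bpiece_nonneg hxe _ _

variable {ρ : ℝ → ℝ}

/-- Keeps the denominators of the projection weights away from zero: a B-spline is nonnegative and,
by linear independence, not identically zero. -/
theorem integral_basis_pos (hρ : ContinuousOn ρ (Icc 0 1)) (hρ0 : ∀ x ∈ Icc (0 : ℝ) 1, 0 < ρ x)
    (i : Fin κ.size) : 0 < ∫ x in (0 : ℝ)..1, κ.basis i x * ρ x := by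
  refine intervalIntegral.integral_pos one_pos ((κ.continuousOn_basis i).mul hρ)
    (fun y hy => mul_nonneg (κ.basis_nonneg i ⟨hy.1.le, hy.2⟩) (hρ0 y ⟨hy.1.le, hy.2⟩).le) ?_
  by_contra! h
  have h1 : (Pi.single i 1 : Fin κ.size → ℝ) = 0 := by
    refine κ.eq_zero_of_sum_basis fun x hx => ?_
    have h2 := (mul_nonpos_iff_pos_imp_nonpos.mp (h x hx)).2
    simp only [Pi.single_apply, ite_mul, one_mul, zero_mul, Finset.sum_ite_eq', Finset.mem_univ,
      if_true]
    refine le_antisymm ?_ (κ.basis_nonneg i hx)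
    by_contra! h3
    exact (mul_pos h3 (hρ0 x hx)).not_ge (h x hx)
  simpa using congrFun h1 i

end KnotVector

/-! ### Integrability of the multipliers. -/

/-- The knots are arbitrary, so that the coarsened knots are covered as well. -/
theorem intervalIntegrable_bspline (t : ℕ → ℝ) (q i : ℕ) (a b : ℝ) :
    IntervalIntegrable (bspline t q i) volume a b := by
  induction q generalizing i with
  | zero =>
    classical
    have h1 : bspline t 0 i = indicator (Ico (t i) (t (i + 1)) ∪
        (if t i < 1 ∧ t (i + 1) = 1 then {1} else ∅)) fun _ => 1 := by
      ext x
      rw [bspline, indicator_apply]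
      congr 1
      by_cases h : t i < 1 ∧ t (i + 1) = 1 <;> simp [h, mem_Ico]
      tauto
    rw [h1, intervalIntegrable_iff]
    refine (integrableOn_const (by simp)).indicator (measurableSet_Ico.union ?_)
    split_ifs <;> simp
  | succ q ih =>
    have h1 : bspline t (q + 1) i = fun x => (x - t i) / (t (i + q + 1) - t i) * bspline t q i x
        + (t (i + q + 2) - x) / (t (i + q + 2) - t (i + 1)) * bspline t q (i + 1) x := rfl
    rw [h1]
    exact ((ih i).continuousOn_mul (g := fun x => (x - t i) / (t (i + q + 1) - t i))
      (by fun_prop)).add ((ih (i + 1)).continuousOn_mul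
      (g := fun x => (t (i + q + 2) - x) / (t (i + q + 2) - t (i + 1))) (by fun_prop))

theorem intervalIntegrable_bezierDual (κ : KnotVector) (ρ : ℝ → ℝ) (i : Fin κ.size) (a b : ℝ) :
    IntervalIntegrable (κ.bezierDual ρ i) volume a b := by
  classical
  unfold KnotVector.bezierDual
  refine intervalIntegrable_finsetSum _ fun e _ => intervalIntegrable_finsetSum _ fun l _ => ?_
  have hc : Continuous fun x => ∑ j, κ.dualExtraction ρ e l j * κ.bern e j x :=
    continuous_finsetSum _ fun j _ => continuous_const.mul (κ.continuous_bern e j)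
  by_cases h : e - κ.degree + l = (i : ℕ)
  · have h1 : (fun x => if e - κ.degree + l = (i : ℕ) ∧ κ.knot e ≤ x ∧ x < κ.knot (e + 1) then
        ∑ j, κ.dualExtraction ρ e l j * κ.bern e j x else 0) =
        indicator (Ico (κ.knot e) (κ.knot (e + 1)))
          fun x => ∑ j, κ.dualExtraction ρ e l j * κ.bern e j x := by
      ext x
      rw [indicator_apply]
      simp [h, mem_Ico]
    rw [h1, intervalIntegrable_iff]
    exact (intervalIntegrable_iff.mp (hc.intervalIntegrable a b)).indicator measurableSet_Ico
  · simp [h]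

theorem intervalIntegrable_globalDual (t : ℕ → ℝ) (p n : ℕ) (ρ : ℝ → ℝ) (i : Fin n) (a b : ℝ) :
    IntervalIntegrable (globalDual t p n ρ i) volume a b :=
  intervalIntegrable_finsetSum _ fun j _ => (intervalIntegrable_bspline t p j a b).const_mul _

/-- Needed to split the constraint integrals; in particular it makes the constraints linear. -/
theorem intervalIntegrable_of_mem_multipliers {κ : KnotVector} {ρ : ℝ → ℝ} {β : DualBasis}
    {μ : ℝ → ℝ} (hμ : μ ∈ multipliers κ ρ β) (a b : ℝ) : IntervalIntegrable μ volume a b := by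
  have key : ∀ s : Set (ℝ → ℝ), (∀ f ∈ s, IntervalIntegrable f volume a b) →
      ∀ f ∈ Submodule.span ℝ s, IntervalIntegrable f volume a b := by
    intro s hs f hf
    induction hf using Submodule.span_induction with
    | mem x h => exact hs x h
    | zero => exact IntervalIntegrable.zero
    | add x y _ _ hx hy => exact hx.add hy
    | smul c x _ hx => exact hx.smul c
  cases β with
  | bezier => exact key _ (by rintro _ ⟨i, rfl⟩; exact intervalIntegrable_bezierDual ..) μ hμ
  | globalFull => exact key _ (by rintro _ ⟨i, rfl⟩; exact intervalIntegrable_globalDual ..) μ hμ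
  | globalCoarse => exact key _ (by rintro _ ⟨i, rfl⟩; exact intervalIntegrable_globalDual ..) μ hμ

/-! ### Biorthogonality of the dual bases. -/

namespace KnotVector

variable (κ : KnotVector) {ρ : ℝ → ℝ}

theorem isUnit_det_splineGram (hρ : ContinuousOn ρ (Icc 0 1))
    (hρ0 : ∀ x ∈ Icc (0 : ℝ) 1, 0 < ρ x) :
    IsUnit (splineGram κ.knot κ.degree κ.size ρ).det :=
  isUnit_det_gram one_pos (fun j : Fin κ.size => κ.continuousOn_basis j) hρ hρ0
    fun _ hc => κ.eq_zero_of_sum_basis hc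

/-- The integral is an entry of G⁻¹G. -/
theorem integral_basis_mul_globalDual (hρ : ContinuousOn ρ (Icc 0 1))
    (hρ0 : ∀ x ∈ Icc (0 : ℝ) 1, 0 < ρ x) (i j : Fin κ.size) :
    ∫ x in (0 : ℝ)..1, κ.basis j x * globalDual κ.knot κ.degree κ.size ρ i x * ρ x =
      if i = j then 1 else 0 := by
  have h := Matrix.nonsing_inv_mul _ (κ.isUnit_det_splineGram hρ hρ0)
  have h1 := congrFun (congrFun h i) j
  rw [Matrix.one_apply, Matrix.mul_apply] at h1
  rw [← h1]
  simp only [globalDual, splineGram, Matrix.of_apply, ← intervalIntegral.integral_const_mul]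
  rw [← intervalIntegral.integral_finsetSum]
  · refine intervalIntegral.integral_congr fun x _ => ?_
    simp only [Finset.mul_sum, Finset.sum_mul, basis]
    exact Finset.sum_congr rfl fun k _ => by ring
  · exact fun k _ => ((((κ.continuousOn_basis k).mul (κ.continuousOn_basis j)).mul hρ
      ).intervalIntegrable_of_Icc zero_le_one).const_mul _

/-- The half-open elements are disjoint, so only the summands of the element that contains `x` can
be nonzero. -/
theorem bezierDual_eq_zero {e : ℕ} (he : κ.IsSpan e) {i : Fin κ.size}
    (hi : ¬ (e - κ.degree ≤ (i : ℕ) ∧ (i : ℕ) ≤ e)) {x : ℝ}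
    (hx : x ∈ Ico (κ.knot e) (κ.knot (e + 1))) : κ.bezierDual ρ i x = 0 := by
  refine Finset.sum_eq_zero fun e' _ => Finset.sum_eq_zero fun a _ => if_neg ?_
  rintro ⟨h1, h2, h3⟩
  have : e' = e := by
    rcases lt_trichotomy e' e with h | h | h
    · exact absurd (h3.trans_le (κ.monotone h)) (not_lt.mpr hx.1)
    · exact h
    · exact absurd (hx.2.trans_le (κ.monotone h)) (not_lt.mpr h2)
  subst this
  have := a.2
  have := he.1
  omega

theorem bezierDual_eq_sum {e : ℕ} (he : κ.IsSpan e) {i : Fin κ.size} {a : Fin (κ.degree + 1)}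
    (ha : e - κ.degree + a = (i : ℕ)) {x : ℝ} (hx : x ∈ Ico (κ.knot e) (κ.knot (e + 1))) :
    κ.bezierDual ρ i x = ∑ j, κ.dualExtraction ρ e a j * κ.bern e j x := by
  unfold bezierDual
  rw [Finset.sum_eq_single e, Finset.sum_eq_single a, if_pos ⟨ha, hx⟩]
  · exact fun b _ hb => if_neg fun h => hb (Fin.ext (by omega))
  · simp
  · refine fun e' _ hne => Finset.sum_eq_zero fun a _ => if_neg ?_
    rintro ⟨-, h2, h3⟩
    rcases lt_or_gt_of_ne hne with h | h
    · exact absurd (h3.trans_le (κ.monotone h)) (not_lt.mpr hx.1)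
    · exact absurd (hx.2.trans_le (κ.monotone h)) (not_lt.mpr h2)
  · exact fun h => absurd (Finset.mem_Ico.mpr ⟨he.1, he.2.1⟩) h

theorem basis_eq_zero {e : ℕ} (he : κ.IsSpan e) {i : ℕ}
    (hi : ¬ (e - κ.degree ≤ i ∧ i ≤ e)) {x : ℝ} (hx : x ∈ κ.span e) : κ.basis i x = 0 := by
  rw [κ.basis_eq_eval he hx, bpiece_eq_zero _ (by omega), Polynomial.eval_zero]

/-- A relation among the rows would be a linear relation among the B-splines living on the element,
which local linear independence excludes. -/
theorem isUnit_det_extraction {e : ℕ} (he : κ.IsSpan e) : IsUnit (κ.extraction e).det := by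
  rw [isUnit_iff_ne_zero]
  intro h0
  obtain ⟨v, hv, hv0⟩ := Matrix.exists_vecMul_eq_zero_iff.mpr h0
  refine hv (funext fun a => ?_)
  have hp := he.1
  have hn := he.2.1
  -- For `i < e - degree` the truncated subtraction yields the value `v 0`, which is irrelevant
  -- since those B-splines vanish on the element.
  let c : ℕ → ℝ := fun i =>
    if hi : i - (e - κ.degree) < κ.degree + 1 then v ⟨i - (e - κ.degree), hi⟩ else 0
  have hca : ∀ a : Fin (κ.degree + 1), c (e - κ.degree + a) = v a := fun a => by
    have h1 : e - κ.degree + a - (e - κ.degree) = a := by omega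
    simp only [c, h1, a.2, dif_pos]
  rw [← hca a, Pi.zero_apply]
  have ha := a.2
  refine κ.eq_zero_of_sum_basis_span he (c := fun i => c i) (i := ⟨e - κ.degree + a, by omega⟩)
    (fun x hx => ?_) (by simp; omega) (by simp; omega)
  have h1 : ∑ i : Fin κ.size, c i * κ.basis i x =
      ∑ a : Fin (κ.degree + 1), v a * κ.basis (e - κ.degree + a) x := by
    rw [Fin.sum_univ_eq_sum_range (fun i => c i * κ.basis i x)]
    simp only [← hca]
    rw [Fin.sum_univ_eq_sum_range
      (fun a => c (e - κ.degree + a) * κ.basis (e - κ.degree + a) x)]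
    rw [← Finset.sum_subset (s₁ := Finset.Ico (e - κ.degree) (e + 1)), Finset.sum_Ico_eq_sum_range]
    · rw [show e + 1 - (e - κ.degree) = κ.degree + 1 by omega]
    · intro i hi
      simp only [Finset.mem_Ico, Finset.mem_range] at hi ⊢
      omega
    · intro i _ hi
      rw [κ.basis_eq_zero he (fun h => hi (Finset.mem_Ico.mpr ⟨h.1, by omega⟩)) hx, mul_zero]
  rw [h1]
  simp only [κ.basis_eq_sum_extraction he _ hx, Finset.mul_sum]
  rw [Finset.sum_comm]
  refine Finset.sum_eq_zero fun j _ => ?_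
  have h2 := congrFun hv0 j
  simp only [Matrix.vecMul, dotProduct, Pi.zero_apply] at h2
  rw [← zero_mul (κ.bern e j x), ← h2, Finset.sum_mul]
  exact Finset.sum_congr rfl fun b _ => by ring

theorem intervalIntegrable_bern_mul {e : ℕ} (he : κ.IsSpan e) (hρ : ContinuousOn ρ (Icc 0 1))
    (c d : ℝ) (k l : Fin (κ.degree + 1)) :
    IntervalIntegrable (fun x => c * (κ.bern e l x * κ.bern e k x * ρ x) * d) volume
      (κ.knot e) (κ.knot (e + 1)) :=
  ((((((κ.continuous_bern e l).mul (κ.continuous_bern e k)).continuousOn).mul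
    (hρ.mono (κ.span_subset e))).intervalIntegrable_of_Icc he.2.2.le).const_mul c).mul_const d

/-- The local biorthogonality `∫_e N̂_i N_j = ω_i^e δ_{ij}`. -/
theorem integral_span_basis_mul_bezierDual (hρ : ContinuousOn ρ (Icc 0 1))
    (hρ0 : ∀ x ∈ Icc (0 : ℝ) 1, 0 < ρ x) {e : ℕ} (he : κ.IsSpan e) (i j : Fin κ.size) :
    ∫ x in κ.knot e..κ.knot (e + 1), κ.basis j x * κ.bezierDual ρ i x * ρ x =
      if i = j then κ.projWeight ρ e i else 0 := by
  have hp := he.1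
  have hIco : ∀ {x}, x ∈ Ico (κ.knot e) (κ.knot (e + 1)) → x ∈ κ.span e := fun h => ⟨h.1, h.2.le⟩
  by_cases hi : e - κ.degree ≤ (i : ℕ) ∧ (i : ℕ) ≤ e
  swap
  · have h1 : κ.projWeight ρ e i = 0 := by
      rw [projWeight, intervalIntegral_congr_Ico (g := fun _ => 0) he.2.2.le fun x hx => by
        rw [κ.basis_eq_zero he hi (hIco hx), zero_mul]]
      simp
    rw [h1, ite_self, intervalIntegral_congr_Ico (g := fun _ => 0) he.2.2.le fun x hx => by
      rw [κ.bezierDual_eq_zero he hi hx, mul_zero, zero_mul]]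
    simp
  obtain ⟨a, ha⟩ : ∃ a : Fin (κ.degree + 1), e - κ.degree + a = (i : ℕ) :=
    ⟨⟨i - (e - κ.degree), by omega⟩, by simp; omega⟩
  by_cases hj : e - κ.degree ≤ (j : ℕ) ∧ (j : ℕ) ≤ e
  swap
  · rw [if_neg (by rintro rfl; exact hj hi),
      intervalIntegral_congr_Ico (g := fun _ => 0) he.2.2.le fun x hx => by
        rw [κ.basis_eq_zero he hj (hIco hx), zero_mul, zero_mul]]
    simp
  obtain ⟨b, hb⟩ : ∃ b : Fin (κ.degree + 1), e - κ.degree + b = (j : ℕ) :=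
    ⟨⟨j - (e - κ.degree), by omega⟩, by simp; omega⟩
  -- The left side is the matrix of the wanted integrals. The Gramian and the transposed extraction
  -- operator cancel against the inverses in `dualExtraction`, and only the weights remain.
  have hM : κ.dualExtraction ρ e * κ.bernGram ρ e * (κ.extraction e).transpose =
      Matrix.diagonal (fun a : Fin (κ.degree + 1) => κ.projWeight ρ e (e - κ.degree + a)) := by
    have h1 := Matrix.nonsing_inv_mul _ (κ.isUnit_det_bernGram he hρ hρ0)
    have h2 := Matrix.mul_nonsing_inv _ (κ.isUnit_det_extraction he)
    rw [dualExtraction, Matrix.mul_assoc _ _ (κ.bernGram ρ e), h1, Matrix.mul_one,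
      Matrix.mul_assoc, ← Matrix.transpose_mul, h2, Matrix.transpose_one, Matrix.mul_one]
  have hM' := congrFun (congrFun hM a) b
  have hab : (a = b) = (i = j) := by
    rw [eq_iff_iff, Fin.ext_iff, Fin.ext_iff]; omega
  rw [Matrix.diagonal_apply, ha] at hM'
  simp only [hab] at hM'
  rw [← hM', intervalIntegral_congr_Ico (g := fun x => ∑ k, ∑ l,
    κ.dualExtraction ρ e a l * (κ.bern e l x * κ.bern e k x * ρ x) * κ.extraction e b k) he.2.2.le]
  · rw [intervalIntegral.integral_finsetSum, Matrix.mul_apply]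
    · refine Finset.sum_congr rfl fun k _ => ?_
      rw [intervalIntegral.integral_finsetSum, Matrix.mul_apply, Finset.sum_mul]
      · refine Finset.sum_congr rfl fun l _ => ?_
        rw [intervalIntegral.integral_mul_const, intervalIntegral.integral_const_mul]
        rfl
      · exact fun l _ => κ.intervalIntegrable_bern_mul he hρ _ _ _ _
    · exact fun k _ => intervalIntegrable_finsetSum _ fun l _ =>
        κ.intervalIntegrable_bern_mul he hρ _ _ _ _
  · intro x hx
    rw [κ.bezierDual_eq_sum he ha hx, ← hb, κ.basis_eq_sum_extraction he b (hIco hx),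
      Finset.sum_mul_sum, Finset.sum_mul]
    refine Finset.sum_congr rfl fun k _ => ?_
    rw [Finset.sum_mul]
    exact Finset.sum_congr rfl fun l _ => by ring

theorem integral_basis_mul_bezierDual (hρ : ContinuousOn ρ (Icc 0 1))
    (hρ0 : ∀ x ∈ Icc (0 : ℝ) 1, 0 < ρ x) (i j : Fin κ.size) :
    ∫ x in (0 : ℝ)..1, κ.basis j x * κ.bezierDual ρ i x * ρ x = if i = j then 1 else 0 := by
  have h01 : κ.knot κ.degree = 0 ∧ κ.knot κ.size = 1 :=
    ⟨κ.knot_left _ le_rfl, κ.knot_right _ le_rfl⟩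
  have hsplit : ∀ f : ℝ → ℝ, IntervalIntegrable f volume 0 1 →
      ∫ x in (0 : ℝ)..1, f x =
        ∑ e ∈ Finset.Ico κ.degree κ.size, ∫ x in κ.knot e..κ.knot (e + 1), f x := by
    intro f hf
    rw [intervalIntegral.sum_integral_adjacent_intervals_Ico κ.degree_lt_size.le, h01.1, h01.2]
    intro k _
    refine hf.mono_set ?_
    rw [uIcc_of_le (κ.monotone k.le_succ), uIcc_of_le zero_le_one]
    exact κ.span_subset k
  have hu : uIcc (0 : ℝ) 1 = Icc 0 1 := uIcc_of_le zero_le_one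
  have hb : IntervalIntegrable (fun x => κ.basis j x * κ.bezierDual ρ i x * ρ x) volume 0 1 :=
    ((intervalIntegrable_bezierDual κ ρ i 0 1).continuousOn_mul (g := fun x => κ.basis j x)
      (by rw [hu]; exact κ.continuousOn_basis j)).mul_continuousOn (by rwa [hu])
  -- Repeated knots give empty elements, which stay in the sum and contribute zero on both sides.
  have hspan : ∀ e ∈ Finset.Ico κ.degree κ.size,
      ∫ x in κ.knot e..κ.knot (e + 1), κ.basis j x * κ.bezierDual ρ i x * ρ x =
        if i = j then κ.projWeight ρ e i else 0 := by
    intro e he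
    rw [Finset.mem_Ico] at he
    rcases (κ.monotone e.le_succ).lt_or_eq with h | h
    · exact κ.integral_span_basis_mul_bezierDual hρ hρ0 ⟨he.1, he.2, h⟩ i j
    · simp [projWeight, ← Nat.succ_eq_add_one, ← h]
  rw [hsplit _ hb, Finset.sum_congr rfl hspan]
  by_cases hij : i = j
  -- The weights of one B-spline sum to 1 because the elements tile `[0, 1]`.
  · simp only [if_pos hij, projWeight, ← Finset.sum_div]
    rw [← hsplit (fun x => κ.basis i x * ρ x) (((κ.continuousOn_basis i).mul hρ).intervalIntegrable_of_Icc zero_le_one),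
      div_self (κ.integral_basis_pos hρ hρ0 i).ne']
  · simp [hij]

/-- A spline that is orthogonal to the dual basis vanishes. -/
theorem eq_zero_of_orthogonal_multipliers (hρ : ContinuousOn ρ (Icc 0 1))
    (hρ0 : ∀ x ∈ Icc (0 : ℝ) 1, 0 < ρ x) {β : DualBasis} (hβ : β ≠ .globalCoarse) {f : ℝ → ℝ}
    {c : Fin κ.size → ℝ} (hf : ∀ x ∈ Icc (0 : ℝ) 1, f x = ∑ j, c j * κ.basis j x)
    (h : ∀ μ ∈ multipliers κ ρ β, ∫ x in (0 : ℝ)..1, f x * μ x * ρ x = 0) :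
    ∀ x ∈ Icc (0 : ℝ) 1, f x = 0 := by
  suffices hc : ∀ i, c i = 0 by
    intro x hx
    rw [hf x hx]
    exact Finset.sum_eq_zero fun i _ => by rw [hc, zero_mul]
  intro i
  -- The multiplier dual to `N_i` extracts the coefficient `c i` from `f`.
  obtain ⟨μ, hμ, hd⟩ : ∃ μ ∈ multipliers κ ρ β, ∀ j : Fin κ.size,
      ∫ x in (0 : ℝ)..1, κ.basis j x * μ x * ρ x = if i = j then 1 else 0 := by
    cases β with
    | bezier => exact ⟨κ.bezierDual ρ i, Submodule.subset_span ⟨i, rfl⟩,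
        κ.integral_basis_mul_bezierDual hρ hρ0 i⟩
    | globalFull => exact ⟨_, Submodule.subset_span ⟨i, rfl⟩,
        κ.integral_basis_mul_globalDual hρ hρ0 i⟩
    | globalCoarse => exact absurd rfl hβ
  rw [← h μ hμ]
  have hint : ∀ j : Fin κ.size,
      IntervalIntegrable (fun x => κ.basis j x * μ x * ρ x) volume 0 1 := fun j => by
    have h1 := (intervalIntegrable_of_mem_multipliers hμ 0 1).continuousOn_mul
      (g := fun x => κ.basis j x) (by rw [uIcc_of_le zero_le_one]; exact κ.continuousOn_basis j)
    exact h1.mul_continuousOn (by rwa [uIcc_of_le zero_le_one])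
  have h2 : ∫ x in (0 : ℝ)..1, f x * μ x * ρ x =
      ∑ j, c j * ∫ x in (0 : ℝ)..1, κ.basis j x * μ x * ρ x := by
    simp only [← intervalIntegral.integral_const_mul]
    rw [← intervalIntegral.integral_finsetSum fun j _ => (hint j).const_mul _]
    refine intervalIntegral.integral_congr fun x hx => ?_
    rw [uIcc_of_le zero_le_one] at hx
    simp only [hf x hx, Finset.sum_mul]
    exact Finset.sum_congr rfl fun j _ => by ring
  rw [h2]
  simp [hd]

end KnotVector

/-! ### Calculus of tensor-product splines -/

theorem isCompact_closedSquare : IsCompact closedSquare := isCompact_Icc.prod isCompact_Icc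

theorem isOpen_openSquare : IsOpen openSquare := isOpen_Ioo.prod isOpen_Ioo

theorem openSquare_subset : openSquare ⊆ closedSquare := prod_mono Ioo_subset_Icc_self
  Ioo_subset_Icc_self

theorem uniqueDiffOn_closedSquare : UniqueDiffOn ℝ closedSquare :=
  (uniqueDiffOn_Icc one_pos).prod (uniqueDiffOn_Icc one_pos)

theorem Side.point_mem (e : Side) {r : ℝ} (hr : r ∈ Icc (0 : ℝ) 1) : e.point r ∈ closedSquare := by
  have h0 : (0 : ℝ) ∈ Icc (0 : ℝ) 1 := ⟨le_rfl, zero_le_one⟩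
  have h1 : (1 : ℝ) ∈ Icc (0 : ℝ) 1 := ⟨zero_le_one, le_rfl⟩
  cases e
  exacts [⟨h0, hr⟩, ⟨h1, hr⟩, ⟨hr, h0⟩, ⟨hr, h1⟩]

theorem Polynomial.contDiff_eval (p : Polynomial ℝ) (n : WithTop ℕ∞) :
    ContDiff ℝ n (fun x => p.eval x) := by
  simpa [Polynomial.aeval_def, Polynomial.eval₂_eq_eval_map] using p.contDiff_aeval (𝕜 := ℝ) n

section Tensor

variable {E : Type*} [NormedAddCommGroup E] [NormedSpace ℝ E] (κ₁ κ₂ : KnotVector)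

/-- The derivative of a tensor-product spline. -/
def tensorDeriv (c : Fin κ₁.size → Fin κ₂.size → E) (s : ℝ × ℝ) : ℝ × ℝ →L[ℝ] E :=
  ∑ i : Fin κ₁.size, ∑ j : Fin κ₂.size,
    ((κ₁.basisDeriv i s.1 * κ₂.basis j s.2) • ContinuousLinearMap.fst ℝ ℝ ℝ
      + (κ₁.basis i s.1 * κ₂.basisDeriv j s.2) • ContinuousLinearMap.snd ℝ ℝ ℝ).smulRight (c i j)

theorem hasFDerivWithinAt_tensorSpline (c : Fin κ₁.size → Fin κ₂.size → E) (s : ℝ × ℝ) :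
    HasFDerivWithinAt (tensorSpline κ₁ κ₂ c) (tensorDeriv κ₁ κ₂ c s) closedSquare s := by
  unfold tensorSpline tensorDeriv
  refine HasFDerivWithinAt.fun_sum fun i _ => HasFDerivWithinAt.fun_sum fun j _ => ?_
  have h1 : HasFDerivWithinAt (fun s : ℝ × ℝ => κ₁.basis i s.1)
      (κ₁.basisDeriv i s.1 • ContinuousLinearMap.fst ℝ ℝ ℝ) closedSquare s :=
    (κ₁.hasDerivWithinAt_basis i).comp_hasFDerivWithinAt s hasFDerivWithinAt_fst
      fun y hy => hy.1
  have h2 : HasFDerivWithinAt (fun s : ℝ × ℝ => κ₂.basis j s.2)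
      (κ₂.basisDeriv j s.2 • ContinuousLinearMap.snd ℝ ℝ ℝ) closedSquare s :=
    (κ₂.hasDerivWithinAt_basis j).comp_hasFDerivWithinAt s hasFDerivWithinAt_snd
      fun y hy => hy.2
  have h3 := (h1.mul h2).smul_const (c i j)
  refine h3.congr_fderiv ?_
  ext <;> simp [mul_comm]

theorem continuousOn_tensorSpline (c : Fin κ₁.size → Fin κ₂.size → E) :
    ContinuousOn (tensorSpline κ₁ κ₂ c) closedSquare := fun s _ =>
  (hasFDerivWithinAt_tensorSpline κ₁ κ₂ c s).continuousWithinAt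

theorem continuousOn_tensorDeriv (c : Fin κ₁.size → Fin κ₂.size → E) :
    ContinuousOn (tensorDeriv κ₁ κ₂ c) closedSquare := by
  have hf : ∀ f : ℝ → ℝ, ContinuousOn f (Icc 0 1) →
      ContinuousOn (fun s : ℝ × ℝ => f s.1) closedSquare := fun f hf =>
    hf.comp continuousOn_fst fun s hs => hs.1
  have hg : ∀ f : ℝ → ℝ, ContinuousOn f (Icc 0 1) →
      ContinuousOn (fun s : ℝ × ℝ => f s.2) closedSquare := fun f hf =>
    hf.comp continuousOn_snd fun s hs => hs.2
  unfold tensorDeriv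
  refine continuousOn_finsetSum _ fun i _ => continuousOn_finsetSum _ fun j _ => ?_
  have h1 := ((hf _ (κ₁.continuousOn_basisDeriv i)).mul (hg _ (κ₂.continuousOn_basis j))).smul
    (continuousOn_const (c := ContinuousLinearMap.fst ℝ ℝ ℝ))
  have h2 := ((hf _ (κ₁.continuousOn_basis i)).mul (hg _ (κ₂.continuousOn_basisDeriv j))).smul
    (continuousOn_const (c := ContinuousLinearMap.snd ℝ ℝ ℝ))
  have h3 : Continuous fun l : ℝ × ℝ →L[ℝ] ℝ => l.smulRight (c i j) := by fun_prop
  exact h3.comp_continuousOn (h1.add h2)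

theorem fderivWithin_tensorSpline (c : Fin κ₁.size → Fin κ₂.size → E) {s : ℝ × ℝ}
    (hs : s ∈ closedSquare) :
    fderivWithin ℝ (tensorSpline κ₁ κ₂ c) closedSquare s = tensorDeriv κ₁ κ₂ c s :=
  (hasFDerivWithinAt_tensorSpline κ₁ κ₂ c s).fderivWithin (uniqueDiffOn_closedSquare s hs)

theorem closedSquare_mem_nhds {s : ℝ × ℝ} (hs : s ∈ openSquare) : closedSquare ∈ nhds s :=
  Filter.mem_of_superset (isOpen_openSquare.mem_nhds hs) openSquare_subset

theorem hasStrictFDerivAt_tensorSpline (c : Fin κ₁.size → Fin κ₂.size → E) {s : ℝ × ℝ}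
    (hs : s ∈ openSquare) :
    HasStrictFDerivAt (tensorSpline κ₁ κ₂ c) (tensorDeriv κ₁ κ₂ c s) s := by
  refine hasStrictFDerivAt_of_hasFDerivAt_of_continuousAt ?_
    ((continuousOn_tensorDeriv κ₁ κ₂ c).continuousAt (closedSquare_mem_nhds hs))
  filter_upwards [isOpen_openSquare.mem_nhds hs] with y hy
  exact (hasFDerivWithinAt_tensorSpline κ₁ κ₂ c y).hasFDerivAt (closedSquare_mem_nhds hy)

/-- The closed element with the given knot spans. -/
def closedElement (e₁ e₂ : ℕ) : Set (ℝ × ℝ) := κ₁.span e₁ ×ˢ κ₂.span e₂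

/-- The open element with the given knot spans. -/
def openElement (e₁ e₂ : ℕ) : Set (ℝ × ℝ) :=
  Ioo (κ₁.knot e₁) (κ₁.knot (e₁ + 1)) ×ˢ Ioo (κ₂.knot e₂) (κ₂.knot (e₂ + 1))

theorem isOpen_openElement (e₁ e₂ : ℕ) : IsOpen (openElement κ₁ κ₂ e₁ e₂) :=
  isOpen_Ioo.prod isOpen_Ioo

theorem openElement_subset_closedElement (e₁ e₂ : ℕ) :
    openElement κ₁ κ₂ e₁ e₂ ⊆ closedElement κ₁ κ₂ e₁ e₂ :=
  prod_mono Ioo_subset_Icc_self Ioo_subset_Icc_self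

theorem closedElement_subset (e₁ e₂ : ℕ) : closedElement κ₁ κ₂ e₁ e₂ ⊆ closedSquare :=
  prod_mono (κ₁.span_subset e₁) (κ₂.span_subset e₂)

theorem openElement_subset (e₁ e₂ : ℕ) : openElement κ₁ κ₂ e₁ e₂ ⊆ openSquare := by
  rintro s ⟨h1, h2⟩
  exact ⟨⟨(κ₁.knot_nonneg _).trans_lt h1.1, h1.2.trans_le (κ₁.knot_le_one _)⟩,
    ⟨(κ₂.knot_nonneg _).trans_lt h2.1, h2.2.trans_le (κ₂.knot_le_one _)⟩⟩

theorem isCompact_closedElement (e₁ e₂ : ℕ) : IsCompact (closedElement κ₁ κ₂ e₁ e₂) :=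
  isCompact_Icc.prod isCompact_Icc

theorem exists_mem_closedElement {s : ℝ × ℝ} (hs : s ∈ closedSquare) :
    ∃ e₁ e₂, κ₁.IsSpan e₁ ∧ κ₂.IsSpan e₂ ∧ s ∈ closedElement κ₁ κ₂ e₁ e₂ := by
  obtain ⟨e₁, h1, h1'⟩ := κ₁.exists_mem_span hs.1
  obtain ⟨e₂, h2, h2'⟩ := κ₂.exists_mem_span hs.2
  exact ⟨e₁, e₂, h1, h2, h1', h2'⟩

/-- The polynomial map that agrees with a tensor-product spline on an element. -/
def tensorPiece (e₁ e₂ : ℕ) (c : Fin κ₁.size → Fin κ₂.size → E) (s : ℝ × ℝ) : E :=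
  ∑ i : Fin κ₁.size, ∑ j : Fin κ₂.size, ((bpiece κ₁.knot e₁ κ₁.degree i).eval s.1 *
    (bpiece κ₂.knot e₂ κ₂.degree j).eval s.2) • c i j

theorem contDiff_tensorPiece (e₁ e₂ : ℕ) (c : Fin κ₁.size → Fin κ₂.size → E) {n : WithTop ℕ∞} :
    ContDiff ℝ n (tensorPiece κ₁ κ₂ e₁ e₂ c) := by
  unfold tensorPiece
  refine ContDiff.sum fun i _ => ContDiff.sum fun j _ => ContDiff.smul (ContDiff.mul ?_ ?_)
    contDiff_const
  · exact (Polynomial.contDiff_eval _ _).comp contDiff_fst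
  · exact (Polynomial.contDiff_eval _ _).comp contDiff_snd

variable {κ₁ κ₂} {e₁ e₂ : ℕ} (h1 : κ₁.IsSpan e₁) (h2 : κ₂.IsSpan e₂)
include h1 h2

theorem tensorSpline_eq_tensorPiece (c : Fin κ₁.size → Fin κ₂.size → E) {s : ℝ × ℝ}
    (hs : s ∈ closedElement κ₁ κ₂ e₁ e₂) :
    tensorSpline κ₁ κ₂ c s = tensorPiece κ₁ κ₂ e₁ e₂ c s := by
  simp only [tensorSpline, tensorPiece, κ₁.basis_eq_eval h1 hs.1, κ₂.basis_eq_eval h2 hs.2]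

theorem uniqueDiffOn_closedElement : UniqueDiffOn ℝ (closedElement κ₁ κ₂ e₁ e₂) :=
  (uniqueDiffOn_Icc h1.2.2).prod (uniqueDiffOn_Icc h2.2.2)

/-- Valid up to the boundary of the element: both sides are derivatives of one function within the
closed element, where such derivatives are unique. -/
theorem fderiv_tensorPiece (c : Fin κ₁.size → Fin κ₂.size → E) {s : ℝ × ℝ}
    (hs : s ∈ closedElement κ₁ κ₂ e₁ e₂) :
    fderiv ℝ (tensorPiece κ₁ κ₂ e₁ e₂ c) s = tensorDeriv κ₁ κ₂ c s := by
  refine (uniqueDiffOn_closedElement h1 h2 s hs).eq (f := tensorSpline κ₁ κ₂ c) ?_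
    ((hasFDerivWithinAt_tensorSpline κ₁ κ₂ c s).mono (closedElement_subset κ₁ κ₂ e₁ e₂))
  exact (((contDiff_tensorPiece κ₁ κ₂ e₁ e₂ c).differentiable (n := 1) one_ne_zero s
    ).hasFDerivAt.hasFDerivWithinAt).congr
    (fun y hy => tensorSpline_eq_tensorPiece h1 h2 c hy) (tensorSpline_eq_tensorPiece h1 h2 c hs)

end Tensor

/-! ### The inverse of the geometric mapping and the regularity of scalar splines on the physical
patch. -/

namespace Patch

variable (P : Patch)

/-- The derivative of the geometric mapping. -/
def mapDeriv (s : ℝ × ℝ) : ℝ × ℝ →L[ℝ] Plane := tensorDeriv P.knots₁ P.knots₂ P.control s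

theorem hasFDerivWithinAt_map (s : ℝ × ℝ) :
    HasFDerivWithinAt P.map (P.mapDeriv s) closedSquare s :=
  hasFDerivWithinAt_tensorSpline _ _ _ s

theorem continuousOn_map : ContinuousOn P.map closedSquare := continuousOn_tensorSpline _ _ _

theorem injOn_map : InjOn P.map closedSquare := P.injOn

theorem exists_equiv {s : ℝ × ℝ} (hs : s ∈ closedSquare) :
    ∃ A : (ℝ × ℝ) ≃L[ℝ] Plane, (A : ℝ × ℝ →L[ℝ] Plane) = P.mapDeriv s := by
  have h := P.regular s hs
  rw [fderivWithin_tensorSpline _ _ _ hs] at h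
  exact ⟨(LinearEquiv.ofBijective (P.mapDeriv s : ℝ × ℝ →ₗ[ℝ] Plane) h).toContinuousLinearEquiv,
    by ext <;> rfl⟩

theorem inv_map {s : ℝ × ℝ} (hs : s ∈ closedSquare) : P.inv (P.map s) = s :=
  P.injOn_map.leftInvOn_invFunOn hs

theorem inv_mem {x : Plane} (hx : x ∈ P.closedDom) : P.inv x ∈ closedSquare := by
  obtain ⟨s, hs, rfl⟩ := hx
  rwa [P.inv_map hs]

theorem map_inv {x : Plane} (hx : x ∈ P.closedDom) : P.map (P.inv x) = x := by
  obtain ⟨s, hs, rfl⟩ := hx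
  rw [P.inv_map hs]

theorem map_mem {s : ℝ × ℝ} (hs : s ∈ closedSquare) : P.map s ∈ P.closedDom :=
  mem_image_of_mem _ hs

theorem val_map (c : P.Coeff) {s : ℝ × ℝ} (hs : s ∈ closedSquare) :
    P.val c (P.map s) = tensorSpline P.knots₁ P.knots₂ c s := by
  rw [val, P.inv_map hs]

theorem isCompact_closedDom : IsCompact P.closedDom :=
  isCompact_closedSquare.image_of_continuousOn P.continuousOn_map

theorem dom_subset_closedDom : P.dom ⊆ P.closedDom := image_mono openSquare_subset

/-- A continuous injection of a compact set sends closed subsets to closed sets. -/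
theorem continuousOn_inv : ContinuousOn P.inv P.closedDom := by
  have : CompactSpace closedSquare := isCompact_iff_compactSpace.mp isCompact_closedSquare
  rw [continuousOn_iff_isClosed]
  intro t ht
  refine ⟨P.map '' (t ∩ closedSquare), ((isCompact_closedSquare.inter_left ht
    ).image_of_continuousOn (P.continuousOn_map.mono inter_subset_right)).isClosed, ?_⟩
  ext x
  constructor
  · rintro ⟨hx, hxd⟩
    exact ⟨⟨P.inv x, ⟨hx, P.inv_mem hxd⟩, P.map_inv hxd⟩, hxd⟩
  · rintro ⟨⟨s, ⟨hst, hs⟩, rfl⟩, hxd⟩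
    exact ⟨by rwa [mem_preimage, P.inv_map hs], hxd⟩

theorem hasStrictFDerivAt_map {s : ℝ × ℝ} (hs : s ∈ openSquare) :
    HasStrictFDerivAt P.map (P.mapDeriv s) s := hasStrictFDerivAt_tensorSpline _ _ _ hs

theorem isOpen_map_image {U : Set (ℝ × ℝ)} (hU : IsOpen U) (hUs : U ⊆ openSquare) :
    IsOpen (P.map '' U) := by
  rw [isOpen_iff_mem_nhds]
  rintro _ ⟨s, hs, rfl⟩
  obtain ⟨A, hA⟩ := P.exists_equiv (openSquare_subset (hUs hs))
  have h := P.hasStrictFDerivAt_map (hUs hs)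
  rw [← hA] at h
  rw [← h.map_nhds_eq_of_equiv]
  exact Filter.image_mem_map (hU.mem_nhds hs)

theorem isOpen_dom : IsOpen P.dom := P.isOpen_map_image isOpen_openSquare subset_rfl

theorem closedDom_mem_nhds {x : Plane} (hx : x ∈ P.dom) : P.closedDom ∈ nhds x :=
  Filter.mem_of_superset (P.isOpen_dom.mem_nhds hx) P.dom_subset_closedDom

/-- Makes the one-sided derivative `grad` well determined on the edges; the property is carried over
from the square by the invertible Jacobian. -/
theorem uniqueDiffOn_closedDom : UniqueDiffOn ℝ P.closedDom := by
  rintro _ ⟨s, hs, rfl⟩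
  obtain ⟨A, hA⟩ := P.exists_equiv hs
  have h := P.hasFDerivWithinAt_map s
  rw [← hA] at h
  exact h.uniqueDiffWithinAt_of_continuousLinearEquiv A (uniqueDiffOn_closedSquare s hs)

/-- A continuous inverse of a map with invertible derivative is differentiable, also within the
closed patch; the rest is the chain rule. -/
theorem hasFDerivWithinAt_val (c : P.Coeff) {s : ℝ × ℝ} (hs : s ∈ closedSquare)
    {A : (ℝ × ℝ) ≃L[ℝ] Plane} (hA : (A : ℝ × ℝ →L[ℝ] Plane) = P.mapDeriv s) :
    HasFDerivWithinAt (P.val c)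
      ((tensorDeriv P.knots₁ P.knots₂ c s).comp (A.symm : Plane →L[ℝ] ℝ × ℝ))
      P.closedDom (P.map s) := by
  have h1 : HasFDerivWithinAt P.inv (A.symm : Plane →L[ℝ] ℝ × ℝ) P.closedDom (P.map s) := by
    have h := P.hasFDerivWithinAt_map s
    rw [← hA, ← P.inv_map hs] at h
    refine HasFDerivWithinAt.of_local_left_inverse (t := closedSquare) ?_ h (P.map_mem hs)
      (Filter.eventually_of_mem self_mem_nhdsWithin fun y hy => P.map_inv hy)
    rw [tendsto_nhdsWithin_iff]
    exact ⟨P.continuousOn_inv _ (P.map_mem hs),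
      Filter.eventually_of_mem self_mem_nhdsWithin fun y hy => P.inv_mem hy⟩
  have h2 := hasFDerivWithinAt_tensorSpline P.knots₁ P.knots₂ c s
  rw [← P.inv_map hs] at h2
  have h3 := h2.comp (P.map s) h1 fun y hy => P.inv_mem hy
  rw [P.inv_map hs] at h3
  exact h3

theorem grad_eq (c : P.Coeff) {s : ℝ × ℝ} (hs : s ∈ closedSquare)
    {A : (ℝ × ℝ) ≃L[ℝ] Plane} (hA : (A : ℝ × ℝ →L[ℝ] Plane) = P.mapDeriv s) :
    P.grad c (P.map s) =
      (tensorDeriv P.knots₁ P.knots₂ c s).comp (A.symm : Plane →L[ℝ] ℝ × ℝ) :=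
  (P.hasFDerivWithinAt_val c hs hA).fderivWithin (P.uniqueDiffOn_closedDom _ (P.map_mem hs))

theorem hasFDerivWithinAt_val_grad (c : P.Coeff) {x : Plane} (hx : x ∈ P.closedDom) :
    HasFDerivWithinAt (P.val c) (P.grad c x) P.closedDom x := by
  obtain ⟨s, hs, rfl⟩ := hx
  obtain ⟨A, hA⟩ := P.exists_equiv hs
  rw [P.grad_eq c hs hA]
  exact P.hasFDerivWithinAt_val c hs hA

/-- The chain rule for a scalar spline. -/
theorem grad_mapDeriv (c : P.Coeff) {s : ℝ × ℝ} (hs : s ∈ closedSquare) (v : ℝ × ℝ) :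
    P.grad c (P.map s) (P.mapDeriv s v) = tensorDeriv P.knots₁ P.knots₂ c s v := by
  obtain ⟨A, hA⟩ := P.exists_equiv hs
  rw [P.grad_eq c hs hA, ← hA]
  simp

theorem hasFDerivAt_val (c : P.Coeff) {x : Plane} (hx : x ∈ P.dom) :
    HasFDerivAt (P.val c) (P.grad c x) x :=
  (P.hasFDerivWithinAt_val_grad c (P.dom_subset_closedDom hx)).hasFDerivAt (P.closedDom_mem_nhds hx)

/-- Free of a pointwise choice of equivalences, this form gives continuity of `grad`, as inversion
is continuous at invertible maps. -/
theorem grad_eq_inverse (c : P.Coeff) {x : Plane} (hx : x ∈ P.closedDom) :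
    P.grad c x = (tensorDeriv P.knots₁ P.knots₂ c (P.inv x)).comp
      (ContinuousLinearMap.inverse (P.mapDeriv (P.inv x))) := by
  obtain ⟨s, hs, rfl⟩ := hx
  obtain ⟨A, hA⟩ := P.exists_equiv hs
  rw [P.grad_eq c hs hA, P.inv_map hs, ← hA, ContinuousLinearMap.inverse_equiv]

theorem continuousOn_val (c : P.Coeff) : ContinuousOn (P.val c) P.closedDom := fun _ hx =>
  (P.hasFDerivWithinAt_val_grad c hx).continuousWithinAt

theorem continuousOn_grad (c : P.Coeff) : ContinuousOn (P.grad c) P.closedDom := by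
  refine ContinuousOn.congr ?_ fun x hx => P.grad_eq_inverse c hx
  have hinv : MapsTo P.inv P.closedDom closedSquare := fun x hx => P.inv_mem hx
  refine ((continuousOn_tensorDeriv _ _ c).comp P.continuousOn_inv hinv).clm_comp ?_
  intro x hx
  obtain ⟨A, hA⟩ := P.exists_equiv (P.inv_mem hx)
  have h1 : ContinuousAt ContinuousLinearMap.inverse (P.mapDeriv (P.inv x)) :=
    hA ▸ (contDiffAt_map_inverse (n := 1) A).continuousAt
  exact h1.comp_continuousWithinAt (f := fun x => P.mapDeriv (P.inv x))
    ((continuousOn_tensorDeriv P.knots₁ P.knots₂ P.control).comp P.continuousOn_inv hinv x hx)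

section Element

variable {e₁ e₂ : ℕ} (h1 : P.knots₁.IsSpan e₁) (h2 : P.knots₂.IsSpan e₂)
include h1 h2

theorem map_eventuallyEq {s : ℝ × ℝ} (hs : s ∈ openElement P.knots₁ P.knots₂ e₁ e₂) :
    P.map =ᶠ[nhds s] tensorPiece P.knots₁ P.knots₂ e₁ e₂ P.control := by
  filter_upwards [(isOpen_openElement _ _ _ _).mem_nhds hs] with y hy
  exact tensorSpline_eq_tensorPiece h1 h2 _ (openElement_subset_closedElement _ _ _ _ hy)

/-- Inside an element the geometric mapping is polynomial, and `inv` agrees near the image point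
with the local inverse from the inverse function theorem. -/
theorem contDiffAt_inv {s : ℝ × ℝ} (hs : s ∈ openElement P.knots₁ P.knots₂ e₁ e₂) :
    ContDiffAt ℝ 2 P.inv (P.map s) := by
  have hso := openElement_subset _ _ _ _ hs
  obtain ⟨A, hA⟩ := P.exists_equiv (openSquare_subset hso)
  have hd := P.hasStrictFDerivAt_map hso
  rw [← hA] at hd
  have hc : ContDiffAt ℝ 2 P.map s :=
    (contDiff_tensorPiece _ _ _ _ _).contDiffAt.congr_of_eventuallyEq (P.map_eventuallyEq h1 h2 hs)
  refine (hc.to_localInverse hd.hasFDerivAt two_ne_zero).congr_of_eventuallyEq ?_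
  refine HasStrictFDerivAt.localInverse_unique _ ?_
  filter_upwards [closedSquare_mem_nhds hso] with y hy using P.inv_map hy

theorem contDiffAt_val (c : P.Coeff) {s : ℝ × ℝ}
    (hs : s ∈ openElement P.knots₁ P.knots₂ e₁ e₂) : ContDiffAt ℝ 2 (P.val c) (P.map s) := by
  have hso := openSquare_subset (openElement_subset _ _ _ _ hs)
  have h3 : ContDiffAt ℝ 2 (tensorSpline P.knots₁ P.knots₂ c) (P.inv (P.map s)) := by
    rw [P.inv_map hso]
    refine (contDiff_tensorPiece _ _ e₁ e₂ c).contDiffAt.congr_of_eventuallyEq ?_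
    filter_upwards [(isOpen_openElement _ _ _ _).mem_nhds hs] with y hy
    exact tensorSpline_eq_tensorPiece h1 h2 _ (openElement_subset_closedElement _ _ _ _ hy)
  exact h3.comp _ (P.contDiffAt_inv h1 h2 hs)

/-- The second derivatives of a scalar spline are bounded on every element. -/
theorem exists_norm_fderiv_fderiv_le (c : P.Coeff) :
    ∃ C, ∀ s ∈ openElement P.knots₁ P.knots₂ e₁ e₂,
      ‖fderiv ℝ (fderiv ℝ (P.val c)) (P.map s)‖ ≤ C := by
  -- The gradient pulled back to the element is `G`, built from polynomials and C¹ at every point of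
  -- the closed element. The second derivative is `DG` composed with the inverse Jacobian, so
  -- compactness of the closed element bounds it.
  let W := tensorPiece P.knots₁ P.knots₂ e₁ e₂ c
  let Φ := tensorPiece P.knots₁ P.knots₂ e₁ e₂ P.control
  let I : ℝ × ℝ → Plane →L[ℝ] ℝ × ℝ := fun s => ContinuousLinearMap.inverse (fderiv ℝ Φ s)
  let G : ℝ × ℝ → Plane →L[ℝ] ℝ := fun s => (fderiv ℝ W s).comp (I s)
  have hI : ∀ s ∈ closedElement P.knots₁ P.knots₂ e₁ e₂, ContDiffAt ℝ 1 I s := by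
    intro s hs
    obtain ⟨A, hA⟩ := P.exists_equiv (closedElement_subset _ _ _ _ hs)
    have h3 : ContDiffAt ℝ 1 ContinuousLinearMap.inverse (fderiv ℝ Φ s) := by
      rw [fderiv_tensorPiece h1 h2 P.control hs]
      change ContDiffAt ℝ 1 ContinuousLinearMap.inverse (P.mapDeriv s)
      exact hA ▸ contDiffAt_map_inverse A
    exact h3.comp s ((contDiff_tensorPiece _ _ e₁ e₂ P.control (n := 2)).fderiv_right
      (by norm_num)).contDiffAt
  have hG : ∀ s ∈ closedElement P.knots₁ P.knots₂ e₁ e₂, ContDiffAt ℝ 1 G s := fun s hs =>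
    ((contDiff_tensorPiece _ _ e₁ e₂ c (n := 2)).fderiv_right
      (by norm_num)).contDiffAt.clm_comp (hI s hs)
  have hcont : ContinuousOn (fun s => (fderiv ℝ G s).comp (I s))
      (closedElement P.knots₁ P.knots₂ e₁ e₂) := fun s hs =>
    (((hG s hs).continuousAt_fderiv one_ne_zero).clm_comp
      (hI s hs).continuousAt).continuousWithinAt
  obtain ⟨C, hC⟩ := (isCompact_closedElement _ _ _ _).exists_bound_of_continuousOn
    (E := Plane →L[ℝ] Plane →L[ℝ] ℝ) hcont
  refine ⟨C, fun s hs => ?_⟩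
  have hsc := openElement_subset_closedElement _ _ _ _ hs
  have hso := openElement_subset _ _ _ _ hs
  refine le_trans (le_of_eq ?_) (hC s hsc)
  congr 1
  obtain ⟨A, hA⟩ := P.exists_equiv (openSquare_subset hso)
  have hIs : I s = A.symm := by
    simp only [I, Φ]
    rw [fderiv_tensorPiece h1 h2 P.control hsc]
    change ContinuousLinearMap.inverse (P.mapDeriv s) = _
    rw [← hA, ContinuousLinearMap.inverse_equiv]
  have heq : (fun s => fderiv ℝ (P.val c) (P.map s)) =ᶠ[nhds s] G := by
    filter_upwards [(isOpen_openElement _ _ _ _).mem_nhds hs] with y hy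
    have hyc := openElement_subset_closedElement _ _ _ _ hy
    have hyo := openElement_subset _ _ _ _ hy
    rw [(P.hasFDerivAt_val c (mem_image_of_mem _ hyo)).fderiv,
      P.grad_eq_inverse c (P.map_mem (openSquare_subset hyo)), P.inv_map (openSquare_subset hyo)]
    simp only [G, I, W, Φ, fderiv_tensorPiece h1 h2 _ hyc]
    rfl
  have hd : DifferentiableAt ℝ (fderiv ℝ (P.val c)) (P.map s) :=
    ((P.contDiffAt_val h1 h2 c hs).fderiv_right (m := 1) (by norm_num)).differentiableAt one_ne_zero
  have h3 := hd.hasFDerivAt.comp s (P.hasStrictFDerivAt_map hso).hasFDerivAt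
  have h4 := h3.congr_of_eventuallyEq heq.symm
  rw [h4.fderiv, hIs, ← hA]
  ext v w
  simp

end Element

end Patch

/-! ### Unique continuation for piecewise polynomial solutions of the pulled back Laplace equation -/

section LaplaceNumerator

variable {R : Type*} [CommRing R] (D₁ D₂ : Derivation ℤ R R)

/-- The numerator of the Laplacian in curvilinear coordinates: if `w = u ∘ (x, y)` for commuting
partial derivatives `D₁`, `D₂`, this is `d ^ 3` times the Laplacian of `u`, where `d` is the
Jacobian determinant of `(x, y)`. -/
def laplaceNumerator (w x y : R) : R :=
  let d := D₁ x * D₂ y - D₂ x * D₁ y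
  let P := D₁ w * D₂ y - D₂ w * D₁ y
  let Q := D₂ w * D₁ x - D₁ w * D₂ x
  (d * D₁ P - P * D₁ d) * D₂ y - (d * D₂ P - P * D₂ d) * D₁ y
    + (d * D₂ Q - Q * D₂ d) * D₁ x - (d * D₁ Q - Q * D₁ d) * D₂ x

/-- The exchange changes the signs of `d`, `P` and `Q`. It serves to reduce continuation in η to
continuation in ξ. -/
theorem laplaceNumerator_comm (w x y : R) :
    laplaceNumerator D₂ D₁ w x y = -laplaceNumerator D₁ D₂ w x y := by
  simp only [laplaceNumerator, map_sub, Derivation.leibniz, smul_eq_mul]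
  ring

theorem laplaceNumerator_map (σ : R ≃+* R) (h₁ : ∀ a, D₁ (σ a) = σ (D₂ a))
    (h₂ : ∀ a, D₂ (σ a) = σ (D₁ a)) (w x y : R) :
    laplaceNumerator D₁ D₂ (σ w) (σ x) (σ y) = -σ (laplaceNumerator D₁ D₂ w x y) := by
  rw [← map_neg, ← laplaceNumerator_comm]
  simp only [laplaceNumerator, h₁, h₂, ← map_mul, ← map_sub, ← map_add]

/-- The leading order of the Laplacian at a curve where `w` vanishes to order `m + 2`. -/
theorem laplaceNumerator_pow_mul {π : R} (h₁ : D₁ π = 1) (h₂ : D₂ π = 0) (m : ℕ) (v x y : R) :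
    ∃ r, laplaceNumerator D₁ D₂ (π ^ (m + 2) * v) x y =
      π ^ m * (((m + 2) * (m + 1) * (D₁ x * D₂ y - D₂ x * D₁ y) * (D₂ x ^ 2 + D₂ y ^ 2)) * v
        + π * r) := by
  have e1 : D₁ (π ^ (m + 2) * v) = π ^ (m + 1) * ((m + 2) * v + π * D₁ v) := by
    simp only [Derivation.leibniz, Derivation.leibniz_pow, h₁, smul_eq_mul, nsmul_eq_mul]
    rw [show m + 2 - 1 = m + 1 by omega]
    push_cast
    ring
  have e2 : D₂ (π ^ (m + 2) * v) = π ^ (m + 1) * (π * D₂ v) := by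
    simp only [Derivation.leibniz, Derivation.leibniz_pow, h₂, smul_eq_mul, nsmul_eq_mul]
    ring
  have e3 : ∀ a, D₁ (π ^ (m + 1) * a) = π ^ m * ((m + 1) * a + π * D₁ a) := fun a => by
    simp only [Derivation.leibniz, Derivation.leibniz_pow, h₁, smul_eq_mul, nsmul_eq_mul]
    rw [show m + 1 - 1 = m by omega]
    push_cast
    ring
  have e4 : ∀ a, D₂ (π ^ (m + 1) * a) = π ^ m * (π * D₂ a) := fun a => by
    simp only [Derivation.leibniz, Derivation.leibniz_pow, h₂, smul_eq_mul, nsmul_eq_mul]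
    ring
  unfold laplaceNumerator
  simp only [e1, e2]
  set d := D₁ x * D₂ y - D₂ x * D₁ y with hd
  set p := ((m + 2) * v + π * D₁ v) * D₂ y - π * D₂ v * D₁ y with hp
  set q := π * D₂ v * D₁ x - ((m + 2) * v + π * D₁ v) * D₂ x with hq
  have hP : π ^ (m + 1) * ((m + 2) * v + π * D₁ v) * D₂ y - π ^ (m + 1) * (π * D₂ v) * D₁ y =
      π ^ (m + 1) * p := by rw [hp]; ring
  have hQ : π ^ (m + 1) * (π * D₂ v) * D₁ x - π ^ (m + 1) * ((m + 2) * v + π * D₁ v) * D₂ x =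
      π ^ (m + 1) * q := by rw [hq]; ring
  rw [hP, hQ, e3, e3, e4, e4]
  refine ⟨(m + 1) * d * ((D₁ v * D₂ y - D₂ v * D₁ y) * D₂ y - (D₂ v * D₁ x - D₁ v * D₂ x) * D₂ x)
    + (d * D₁ p - p * D₁ d) * D₂ y - (d * D₂ p - p * D₂ d) * D₁ y
    + (d * D₂ q - q * D₂ d) * D₁ x - (d * D₁ q - q * D₁ d) * D₂ x, ?_⟩
  -- Only terms where `D₁` hits the power of `π` have order exactly `m`; together they are `(m + 1)
  -- * d * (p * D₂ y - q * D₂ x)`. Modulo `π`, `p` and `q` are `(m + 2) * v` times `D₂ y` and `-D₂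
  -- x`.
  have hpq : p * D₂ y - q * D₂ x = (m + 2) * v * (D₂ x ^ 2 + D₂ y ^ 2) +
      π * ((D₁ v * D₂ y - D₂ v * D₁ y) * D₂ y - (D₂ v * D₁ x - D₁ v * D₂ x) * D₂ x) := by
    rw [hp, hq]; ring
  linear_combination (π ^ m * (m + 1) * d) * hpq

end LaplaceNumerator

/-! ### Bivariate polynomials and the noncharacteristic Cauchy problem. -/

section Bivariate

open Polynomial Polynomial.Bivariate

/-- Differentiation of a bivariate polynomial with respect to the outer variable. -/
def outerDeriv : Derivation ℤ ℝ[X][Y] ℝ[X][Y] :=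
  (derivative' : Derivation ℝ[X] ℝ[X][Y] ℝ[X][Y]).restrictScalars ℤ

theorem outerDeriv_apply (p : ℝ[X][Y]) : outerDeriv p = derivative p := rfl

/-- Differentiation of a bivariate polynomial with respect to the inner variable. -/
def innerDeriv : Derivation ℤ ℝ[X][Y] ℝ[X][Y] :=
  Derivation.mk' (AddMonoidHom.toIntLinearMap
    { toFun := fun p => swap (outerDeriv (swap p))
      map_zero' := by simp
      map_add' := fun p q => by simp only [map_add] }) fun p q => by
    change swap (outerDeriv (swap (p * q))) =
      p * swap (outerDeriv (swap q)) + q * swap (outerDeriv (swap p))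
    simp only [map_mul, Derivation.leibniz, smul_eq_mul, map_add, swap_swap_apply]

theorem innerDeriv_apply (p : ℝ[X][Y]) : innerDeriv p = swap (outerDeriv (swap p)) := rfl

theorem outerDeriv_swap (p : ℝ[X][Y]) : outerDeriv (swap p) = swap (innerDeriv p) := by
  rw [innerDeriv_apply, swap_swap_apply]

theorem innerDeriv_swap (p : ℝ[X][Y]) : innerDeriv (swap p) = swap (outerDeriv p) := by
  rw [innerDeriv_apply, swap_swap_apply]

/-- Evaluation of a bivariate polynomial; the first coordinate is the outer variable. -/
def evalAt (s : ℝ × ℝ) (p : ℝ[X][Y]) : ℝ := p.evalEval s.2 s.1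

theorem evalAt_mul (s : ℝ × ℝ) (p q : ℝ[X][Y]) : evalAt s (p * q) = evalAt s p * evalAt s q :=
  evalEval_mul _ _ p q

theorem evalAt_add (s : ℝ × ℝ) (p q : ℝ[X][Y]) : evalAt s (p + q) = evalAt s p + evalAt s q :=
  evalEval_add _ _ p q

theorem evalAt_sub (s : ℝ × ℝ) (p q : ℝ[X][Y]) : evalAt s (p - q) = evalAt s p - evalAt s q :=
  evalEval_sub _ _ p q

/-- The link between the algebraic derivations and the partial derivatives of calculus. -/
theorem hasFDerivAt_evalAt (p : ℝ[X][Y]) (s : ℝ × ℝ) :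
    HasFDerivAt (fun s => evalAt s p) (evalAt s (outerDeriv p) • ContinuousLinearMap.fst ℝ ℝ ℝ
      + evalAt s (innerDeriv p) • ContinuousLinearMap.snd ℝ ℝ ℝ) s := by
  induction p using Polynomial.induction_on' with
  | add p q hp hq =>
    simp only [map_add, evalAt_add]
    refine (hp.add hq).congr_fderiv ?_
    ext <;> simp
  | monomial n f =>
    have h1 : innerDeriv (monomial n f) = monomial n (derivative f) := by
      rw [innerDeriv_apply, swap_monomial, outerDeriv_apply, derivative_mul, derivative_C,
        mul_zero, add_zero, derivative_map, map_mul, swap_map_C, swap_C, Polynomial.map_pow, map_X,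
        C_mul_X_pow_eq_monomial]
    have h2 : ∀ (s : ℝ × ℝ) (n : ℕ) (f : ℝ[X]), evalAt s (monomial n f) = f.eval s.2 * s.1 ^ n := by
      intro s n f
      simp [evalAt, evalEval, eval_monomial]
    rw [h1, outerDeriv_apply, derivative_monomial]
    simp only [h2]
    have h3 : HasFDerivAt (fun s : ℝ × ℝ => f.eval s.2)
        ((derivative f).eval s.2 • ContinuousLinearMap.snd ℝ ℝ ℝ) s :=
      (f.hasDerivAt s.2).comp_hasFDerivAt s hasFDerivAt_snd
    have h4 : HasFDerivAt (fun s : ℝ × ℝ => s.1 ^ n)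
        ((n * s.1 ^ (n - 1)) • ContinuousLinearMap.fst ℝ ℝ ℝ) s :=
      (hasDerivAt_pow n s.1).comp_hasFDerivAt s hasFDerivAt_fst
    refine (h3.mul h4).congr_fderiv ?_
    ext <;> simp <;> ring

theorem eq_zero_of_evalAt_eq_zero {p : ℝ[X][Y]} {a b c d : ℝ} (hab : a < b) (hcd : c < d)
    (h : ∀ s ∈ Ioo a b ×ˢ Ioo c d, evalAt s p = 0) : p = 0 := by
  refine Polynomial.eq_zero_of_infinite_isRoot p ?_
  refine ((Ioo_infinite hab).image (Polynomial.C_injective.injOn)).mono ?_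
  rintro _ ⟨x, hx, rfl⟩
  exact Polynomial.eq_zero_of_infinite_isRoot _
    ((Ioo_infinite hcd).mono fun y hy => h (x, y) ⟨hx, hy⟩)

/-- A polynomial solution of the pulled back Laplace equation with vanishing Cauchy data on a
segment vanishes. -/
theorem eq_zero_of_laplaceNumerator {w x y : ℝ[X][Y]}
    (hL : laplaceNumerator outerDeriv innerDeriv w x y = 0) {t a b : ℝ} (hab : a < b)
    (h0 : ∀ η ∈ Icc a b, evalAt (t, η) w = 0)
    (h1 : ∀ η ∈ Icc a b, evalAt (t, η) (outerDeriv w) = 0)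
    (hd : evalAt (t, a) (outerDeriv x * innerDeriv y - innerDeriv x * outerDeriv y) ≠ 0) :
    w = 0 := by
  set π : ℝ[X][Y] := X - C (C t) with hπ
  have hroot : ∀ p : ℝ[X][Y], (∀ η ∈ Icc a b, evalAt (t, η) p = 0) → π ∣ p := fun p hp =>
    dvd_iff_isRoot.mpr (Polynomial.eq_zero_of_eval_eq_zero_Icc hab hp)
  have hπ1 : outerDeriv π = 1 := by simp [outerDeriv_apply, hπ]
  have hπ2 : innerDeriv π = 0 := by
    rw [innerDeriv_apply, hπ, map_sub, swap_Y, swap_C_C, ← C_sub, outerDeriv_apply, derivative_C,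
      map_zero]
  have hπ0 : π ≠ 0 := X_sub_C_ne_zero _
  -- The vanishing value gives one factor `π` and the vanishing transversal derivative a second;
  -- every further factor is forced by the leading term of the Laplacian.
  have key : ∀ m, π ^ (m + 2) ∣ w := by
    intro m
    induction m with
    | zero =>
      obtain ⟨w₁, hw₁⟩ := hroot w h0
      have h2 : π ∣ outerDeriv w := hroot _ h1
      rw [hw₁, Derivation.leibniz, hπ1, smul_eq_mul, smul_eq_mul, mul_one,
        dvd_add_right (Dvd.intro _ rfl)] at h2
      rw [hw₁, zero_add, pow_two]
      exact mul_dvd_mul_left π h2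
    | succ m ih =>
      obtain ⟨v, hv⟩ := ih
      obtain ⟨r, hr⟩ := laplaceNumerator_pow_mul outerDeriv innerDeriv hπ1 hπ2 m v x y
      rw [← hv, hL] at hr
      have h2 := (mul_eq_zero.mp hr.symm).resolve_left (pow_ne_zero m hπ0)
      have h3 : π ∣ ((m + 2) * (m + 1) * (outerDeriv x * innerDeriv y - innerDeriv x * outerDeriv y)
          * (innerDeriv x ^ 2 + innerDeriv y ^ 2)) * v :=
        ⟨-r, by linear_combination h2⟩
      have h4 : π ∣ v := by
        -- `π` is prime and does not divide the coefficient of `v`: at `(t, a)` the Jacobian is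
        -- nonzero, and over the reals a vanishing sum of squares would make both derivatives along
        -- the line zero, hence the Jacobian too.
        refine ((prime_X_sub_C (C t)).dvd_or_dvd h3).resolve_left fun h5 => ?_
        have h6 : evalAt (t, a) π = 0 := by simp [evalAt, hπ]
        obtain ⟨k, hk⟩ := h5
        have h7 := congrArg (evalAt (t, a)) hk
        rw [evalAt_mul _ (X - C (C t)), ← hπ, h6, zero_mul, evalAt_mul, evalAt_mul] at h7
        have h8 : evalAt (t, a) ((m + 2) * (m + 1) : ℝ[X][Y]) = (m + 2) * (m + 1) := by
          have := evalEval_natCast (R := ℝ) a t ((m + 2) * (m + 1))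
          push_cast at this
          exact this
        have h9 : evalAt (t, a) (innerDeriv x ^ 2 + innerDeriv y ^ 2) =
            evalAt (t, a) (innerDeriv x) ^ 2 + evalAt (t, a) (innerDeriv y) ^ 2 := by
          simp [evalAt]
        rw [h8, h9] at h7
        have h10 : ((m : ℝ) + 2) * (m + 1) ≠ 0 := by positivity
        have h11 := (mul_eq_zero.mp h7).resolve_left (mul_ne_zero h10 hd)
        apply hd
        obtain ⟨h12, h13⟩ := (add_eq_zero_iff_of_nonneg (sq_nonneg _) (sq_nonneg _)).mp h11
        rw [sq_eq_zero_iff] at h12 h13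
        rw [evalAt_sub, evalAt_mul, evalAt_mul, h12, h13]
        ring
      rw [hv, show m + 1 + 2 = (m + 2) + 1 by ring, pow_succ]
      exact mul_dvd_mul_left _ h4
  by_contra hw
  -- A nonzero `w` cannot be divisible by the power of `π` with exponent `w.natDegree + 2`.
  have h2 := natDegree_le_of_dvd (key w.natDegree) hw
  rw [hπ, natDegree_pow, natDegree_X_sub_C] at h2
  omega

variable (κ₁ κ₂ : KnotVector)

/-- A tensor-product spline on one element, as a bivariate polynomial. -/
def polyPiece (e₁ e₂ : ℕ) (c : Fin κ₁.size → Fin κ₂.size → ℝ) : ℝ[X][Y] :=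
  ∑ i : Fin κ₁.size, ∑ j : Fin κ₂.size, C (C (c i j)) *
    ((bpiece κ₁.knot e₁ κ₁.degree i).map C * C (bpiece κ₂.knot e₂ κ₂.degree j))

theorem evalAt_polyPiece (e₁ e₂ : ℕ) (c : Fin κ₁.size → Fin κ₂.size → ℝ) (s : ℝ × ℝ) :
    evalAt s (polyPiece κ₁ κ₂ e₁ e₂ c) = tensorPiece κ₁ κ₂ e₁ e₂ c s := by
  simp only [evalAt, polyPiece, tensorPiece, evalEval_finsetSum, evalEval_mul, evalEval_C,
    evalEval_map_C, eval_C, smul_eq_mul]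
  exact Finset.sum_congr rfl fun i _ => Finset.sum_congr rfl fun j _ => by ring

theorem swap_polyPiece (e₁ e₂ : ℕ) (c : Fin κ₁.size → Fin κ₂.size → ℝ) :
    swap (polyPiece κ₁ κ₂ e₁ e₂ c) = polyPiece κ₂ κ₁ e₂ e₁ fun j i => c i j := by
  simp only [polyPiece, map_sum, map_mul, swap_map_C, swap_C, Polynomial.map_C]
  rw [Finset.sum_comm]
  exact Finset.sum_congr rfl fun i _ => Finset.sum_congr rfl fun j _ => by ring

theorem tensorSpline_swap {E : Type*} [AddCommGroup E] [Module ℝ E]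
    (c : Fin κ₁.size → Fin κ₂.size → E) (s : ℝ × ℝ) :
    tensorSpline κ₂ κ₁ (fun j i => c i j) s = tensorSpline κ₁ κ₂ c (s.2, s.1) := by
  simp only [tensorSpline]
  rw [Finset.sum_comm]
  exact Finset.sum_congr rfl fun i _ => Finset.sum_congr rfl fun j _ => by rw [mul_comm]

theorem tensorDeriv_swap {E : Type*} [NormedAddCommGroup E] [NormedSpace ℝ E]
    (c : Fin κ₁.size → Fin κ₂.size → E) (s v : ℝ × ℝ) :
    tensorDeriv κ₂ κ₁ (fun j i => c i j) s v = tensorDeriv κ₁ κ₂ c (s.2, s.1) (v.2, v.1) := by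
  simp only [tensorDeriv, sum_apply]
  rw [Finset.sum_comm]
  refine Finset.sum_congr rfl fun i _ => Finset.sum_congr rfl fun j _ => ?_
  simp only [ContinuousLinearMap.smulRight_apply, add_apply,
    smul_apply, ContinuousLinearMap.coe_fst', ContinuousLinearMap.coe_snd',
    smul_eq_mul]
  congr 1
  ring

/-- The Jacobian determinant of the planar map with the given coordinate functions. -/
def tensorJacobian (x y : Fin κ₁.size → Fin κ₂.size → ℝ) (s : ℝ × ℝ) : ℝ :=
  tensorDeriv κ₁ κ₂ x s (1, 0) * tensorDeriv κ₁ κ₂ y s (0, 1)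
    - tensorDeriv κ₁ κ₂ x s (0, 1) * tensorDeriv κ₁ κ₂ y s (1, 0)

variable {κ₁ κ₂}

theorem evalAt_deriv_polyPiece {e₁ e₂ : ℕ} (h1 : κ₁.IsSpan e₁) (h2 : κ₂.IsSpan e₂)
    (c : Fin κ₁.size → Fin κ₂.size → ℝ) {s : ℝ × ℝ} (hs : s ∈ closedElement κ₁ κ₂ e₁ e₂) :
    evalAt s (outerDeriv (polyPiece κ₁ κ₂ e₁ e₂ c)) = tensorDeriv κ₁ κ₂ c s (1, 0) ∧
    evalAt s (innerDeriv (polyPiece κ₁ κ₂ e₁ e₂ c)) = tensorDeriv κ₁ κ₂ c s (0, 1) := by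
  have h3 := (hasFDerivAt_evalAt (polyPiece κ₁ κ₂ e₁ e₂ c) s).fderiv
  simp only [evalAt_polyPiece] at h3
  rw [show (fun s => tensorPiece κ₁ κ₂ e₁ e₂ c s) = tensorPiece κ₁ κ₂ e₁ e₂ c from rfl,
    fderiv_tensorPiece h1 h2 c hs] at h3
  rw [h3]
  simp

theorem eq_zero_of_tensorSpline_eq_zero {c : Fin κ₁.size → Fin κ₂.size → ℝ}
    (h : ∀ s ∈ closedSquare, tensorSpline κ₁ κ₂ c s = 0) : c = 0 := by
  have h1 : ∀ η ∈ Icc (0 : ℝ) 1, (fun i => ∑ j, c i j * κ₂.basis j η) = 0 := by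
    intro η hη
    refine κ₁.eq_zero_of_sum_basis fun ξ hξ => ?_
    rw [← h (ξ, η) ⟨hξ, hη⟩]
    simp only [tensorSpline, Finset.sum_mul, smul_eq_mul]
    exact Finset.sum_congr rfl fun i _ => Finset.sum_congr rfl fun j _ => by ring
  ext i j
  exact congrFun (κ₂.eq_zero_of_sum_basis (c := c i) fun η hη => congrFun (h1 η hη) i) j

/-! ### Continuation from element to element. -/

section Continuation

variable {c x y : Fin κ₁.size → Fin κ₂.size → ℝ}
  (hL : ∀ e₁ e₂, κ₁.IsSpan e₁ → κ₂.IsSpan e₂ → laplaceNumerator outerDeriv innerDeriv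
    (polyPiece κ₁ κ₂ e₁ e₂ c) (polyPiece κ₁ κ₂ e₁ e₂ x) (polyPiece κ₁ κ₂ e₁ e₂ y) = 0)
  (hJ : ∀ s ∈ closedSquare, tensorJacobian κ₁ κ₂ x y s ≠ 0)
include hL hJ

theorem polyPiece_eq_zero_of_line {e₁ e₂ : ℕ} (h1 : κ₁.IsSpan e₁) (h2 : κ₂.IsSpan e₂) {t : ℝ}
    (ht : t ∈ κ₁.span e₁) (h0 : ∀ η ∈ κ₂.span e₂, tensorSpline κ₁ κ₂ c (t, η) = 0 ∧
      tensorDeriv κ₁ κ₂ c (t, η) (1, 0) = 0) : polyPiece κ₁ κ₂ e₁ e₂ c = 0 := by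
  have hmem : ∀ η ∈ κ₂.span e₂, (t, η) ∈ closedElement κ₁ κ₂ e₁ e₂ := fun η hη => ⟨ht, hη⟩
  refine eq_zero_of_laplaceNumerator (hL e₁ e₂ h1 h2) h2.2.2 (t := t) (fun η hη => ?_)
    (fun η hη => ?_) ?_
  · rw [evalAt_polyPiece, ← tensorSpline_eq_tensorPiece h1 h2 c (hmem η hη), (h0 η hη).1]
  · rw [(evalAt_deriv_polyPiece h1 h2 c (hmem η hη)).1, (h0 η hη).2]
  · have hm := hmem _ (left_mem_Icc.mpr h2.2.2.le)
    have h3 := evalAt_deriv_polyPiece h1 h2 x hm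
    have h4 := evalAt_deriv_polyPiece h1 h2 y hm
    rw [evalAt_sub, evalAt_mul, evalAt_mul, h3.1, h3.2, h4.1, h4.2]
    exact hJ _ (closedElement_subset _ _ _ _ hm)

omit hL hJ in
-- `tensorSpline` and `tensorDeriv` are shared by adjacent elements, so zero data on the closed
-- element become Cauchy data for its neighbours.
theorem cauchyData_of_polyPiece_eq_zero {e₁ e₂ : ℕ} (h1 : κ₁.IsSpan e₁) (h2 : κ₂.IsSpan e₂)
    (h : polyPiece κ₁ κ₂ e₁ e₂ c = 0) {s : ℝ × ℝ} (hs : s ∈ closedElement κ₁ κ₂ e₁ e₂) :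
    tensorSpline κ₁ κ₂ c s = 0 ∧ tensorDeriv κ₁ κ₂ c s (1, 0) = 0 ∧
      tensorDeriv κ₁ κ₂ c s (0, 1) = 0 := by
  have h3 := evalAt_deriv_polyPiece h1 h2 c hs
  rw [← h3.1, ← h3.2, tensorSpline_eq_tensorPiece h1 h2 c hs, ← evalAt_polyPiece, h]
  simp [evalAt]

/-- Continuation across the elements of one row. -/
theorem polyPiece_row_eq_zero {e₂ : ℕ} (h2 : κ₂.IsSpan e₂) {k : ℕ}
    (h0 : ∀ η ∈ κ₂.span e₂, tensorSpline κ₁ κ₂ c (κ₁.knot k, η) = 0 ∧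
      tensorDeriv κ₁ κ₂ c (κ₁.knot k, η) (1, 0) = 0) {e₁ : ℕ} (h1 : κ₁.IsSpan e₁) :
    polyPiece κ₁ κ₂ e₁ e₂ c = 0 := by
  -- `T` passes in both directions across a nonempty span, because the piece there vanishes; across
  -- a repeated knot it is the same statement.
  let T : ℕ → Prop := fun k => ∀ η ∈ κ₂.span e₂, tensorSpline κ₁ κ₂ c (κ₁.knot k, η) = 0 ∧
      tensorDeriv κ₁ κ₂ c (κ₁.knot k, η) (1, 0) = 0
  have hstep : ∀ k, T k ↔ T (k + 1) := by
    intro k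
    rcases (κ₁.monotone k.le_succ).lt_or_eq with hlt | heq
    · have hk := κ₁.isSpan_of_lt hlt
      have hl : κ₁.knot k ∈ κ₁.span k := left_mem_Icc.mpr hlt.le
      have hr : κ₁.knot (k + 1) ∈ κ₁.span k := right_mem_Icc.mpr hlt.le
      constructor
      · intro hT η hη
        have h3 := cauchyData_of_polyPiece_eq_zero hk h2
          (polyPiece_eq_zero_of_line hL hJ hk h2 hl hT) (s := (κ₁.knot (k + 1), η)) ⟨hr, hη⟩
        exact ⟨h3.1, h3.2.1⟩
      · intro hT η hη
        have h3 := cauchyData_of_polyPiece_eq_zero hk h2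
          (polyPiece_eq_zero_of_line hL hJ hk h2 hr hT) (s := (κ₁.knot k, η)) ⟨hl, hη⟩
        exact ⟨h3.1, h3.2.1⟩
    · simp only [T, Nat.succ_eq_add_one] at heq ⊢
      rw [heq]
  have hall : ∀ k, T k ↔ T 0 := by
    intro k
    induction k with
    | zero => rfl
    | succ k ih => rw [← hstep, ih]
  exact polyPiece_eq_zero_of_line hL hJ h1 h2 (left_mem_Icc.mpr h1.2.2.le)
    ((hall e₁).mpr ((hall k).mp h0))

omit hL hJ in
theorem laplaceNumerator_polyPiece_swap {e₁ e₂ : ℕ} (h : laplaceNumerator outerDeriv innerDeriv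
      (polyPiece κ₁ κ₂ e₁ e₂ c) (polyPiece κ₁ κ₂ e₁ e₂ x) (polyPiece κ₁ κ₂ e₁ e₂ y) = 0) :
    laplaceNumerator outerDeriv innerDeriv (polyPiece κ₂ κ₁ e₂ e₁ fun j i => c i j)
      (polyPiece κ₂ κ₁ e₂ e₁ fun j i => x i j) (polyPiece κ₂ κ₁ e₂ e₁ fun j i => y i j) = 0 := by
  simp only [← swap_polyPiece]
  have := laplaceNumerator_map outerDeriv innerDeriv (swap (R := ℝ)).toRingEquiv outerDeriv_swap
    innerDeriv_swap (polyPiece κ₁ κ₂ e₁ e₂ c) (polyPiece κ₁ κ₂ e₁ e₂ x) (polyPiece κ₁ κ₂ e₁ e₂ y)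
  rw [h, map_zero, neg_zero] at this
  exact this

omit hL in
theorem tensorJacobian_swap_ne_zero : ∀ s ∈ closedSquare,
    tensorJacobian κ₂ κ₁ (fun j i => x i j) (fun j i => y i j) s ≠ 0 := by
  intro s hs h
  refine hJ (s.2, s.1) ⟨hs.2, hs.1⟩ ?_
  rw [tensorJacobian]
  rw [tensorJacobian] at h
  simp only [tensorDeriv_swap] at h
  linarith

/-- A spline on a patch with vanishing Laplacian is zero if it vanishes on one element. -/
theorem eq_zero_of_polyPiece_eq_zero {e₁ e₂ : ℕ} (h1 : κ₁.IsSpan e₁) (h2 : κ₂.IsSpan e₂)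
    (h : polyPiece κ₁ κ₂ e₁ e₂ c = 0) : c = 0 := by
  -- Continuation runs along the row of the given element and then, with exchanged coordinates,
  -- along every column that crosses this row.
  have hrow : ∀ e, κ₁.IsSpan e → polyPiece κ₁ κ₂ e e₂ c = 0 := fun e he =>
    polyPiece_row_eq_zero hL hJ h2 (k := e₁) (fun η hη =>
      have h3 := cauchyData_of_polyPiece_eq_zero h1 h2 h (s := (κ₁.knot e₁, η))
        ⟨left_mem_Icc.mpr h1.2.2.le, hη⟩
      ⟨h3.1, h3.2.1⟩) he
  refine eq_zero_of_tensorSpline_eq_zero fun s hs => ?_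
  obtain ⟨f₁, f₂, hf₁, hf₂, hsf⟩ := exists_mem_closedElement κ₁ κ₂ hs
  refine (cauchyData_of_polyPiece_eq_zero hf₁ hf₂ ?_ hsf).1
  have h4 : polyPiece κ₂ κ₁ f₂ f₁ (fun j i => c i j) = 0 := by
    refine polyPiece_row_eq_zero (fun a b ha hb => laplaceNumerator_polyPiece_swap (hL b a hb ha))
      (tensorJacobian_swap_ne_zero hJ) hf₁ (k := e₂) (fun η hη => ?_) hf₂
    have h3 := cauchyData_of_polyPiece_eq_zero hf₁ h2 (hrow f₁ hf₁) (s := (η, κ₂.knot e₂))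
      ⟨hη, left_mem_Icc.mpr h2.2.2.le⟩
    rw [tensorSpline_swap, tensorDeriv_swap]
    exact ⟨h3.1, h3.2.2⟩
  rw [← swap_polyPiece] at h4
  exact (EmbeddingLike.map_eq_zero_iff).mp h4

/-- A spline on a patch with vanishing Laplacian and vanishing Cauchy data on one edge is zero. -/
theorem eq_zero_of_cauchyData_side (e : Side)
    (h : ∀ r ∈ Icc (0 : ℝ) 1, tensorSpline κ₁ κ₂ c (e.point r) = 0 ∧
      tensorDeriv κ₁ κ₂ c (e.point r) = 0) : c = 0 := by
  have hd₁ := κ₁.isSpan_degree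
  have hd₂ := κ₂.isSpan_degree
  have key₁ : ∀ k, (∀ η ∈ κ₂.span κ₂.degree, tensorSpline κ₁ κ₂ c (κ₁.knot k, η) = 0 ∧
      tensorDeriv κ₁ κ₂ c (κ₁.knot k, η) = 0) → c = 0 := fun k hk =>
    eq_zero_of_polyPiece_eq_zero hL hJ hd₁ hd₂ (polyPiece_row_eq_zero hL hJ hd₂ (k := k)
      (fun η hη => ⟨(hk η hη).1, by rw [(hk η hη).2]; rfl⟩) hd₁)
  have key₂ : ∀ k, (∀ η ∈ κ₁.span κ₁.degree, tensorSpline κ₁ κ₂ c (η, κ₂.knot k) = 0 ∧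
      tensorDeriv κ₁ κ₂ c (η, κ₂.knot k) = 0) → c = 0 := by
    intro k hk
    have h4 : polyPiece κ₂ κ₁ κ₂.degree κ₁.degree (fun j i => c i j) = 0 := by
      refine polyPiece_row_eq_zero (fun a b ha hb => laplaceNumerator_polyPiece_swap (hL b a hb ha))
        (tensorJacobian_swap_ne_zero hJ) hd₁ (k := k) (fun η hη => ?_) hd₂
      rw [tensorSpline_swap, tensorDeriv_swap, (hk η hη).2]
      exact ⟨(hk η hη).1, rfl⟩
    rw [← swap_polyPiece] at h4
    exact eq_zero_of_polyPiece_eq_zero hL hJ hd₁ hd₂ ((EmbeddingLike.map_eq_zero_iff).mp h4)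
  cases e with
  | xi0 =>
    refine key₁ 0 fun η hη => ?_
    rw [κ₁.knot_left 0 (Nat.zero_le _)]
    exact h η (κ₂.span_subset _ hη)
  | xi1 =>
    refine key₁ κ₁.size fun η hη => ?_
    rw [κ₁.knot_right _ le_rfl]
    exact h η (κ₂.span_subset _ hη)
  | eta0 =>
    refine key₂ 0 fun η hη => ?_
    rw [κ₂.knot_left 0 (Nat.zero_le _)]
    exact h η (κ₁.span_subset _ hη)
  | eta1 =>
    refine key₂ κ₂.size fun η hη => ?_
    rw [κ₂.knot_right _ le_rfl]
    exact h η (κ₁.span_subset _ hη)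

end Continuation

end Bivariate

/-! ### The energy of a scalar spline on one patch -/

section TensorLinear

variable {E F : Type*} [NormedAddCommGroup E] [NormedSpace ℝ E] [NormedAddCommGroup F]
  [NormedSpace ℝ F] (κ₁ κ₂ : KnotVector)

theorem tensorSpline_comp (L : E →L[ℝ] F) (c : Fin κ₁.size → Fin κ₂.size → E) (s : ℝ × ℝ) :
    tensorSpline κ₁ κ₂ (fun i j => L (c i j)) s = L (tensorSpline κ₁ κ₂ c s) := by
  simp [tensorSpline, map_sum]

theorem tensorDeriv_comp (L : E →L[ℝ] F) (c : Fin κ₁.size → Fin κ₂.size → E) (s v : ℝ × ℝ) :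
    tensorDeriv κ₁ κ₂ (fun i j => L (c i j)) s v = L (tensorDeriv κ₁ κ₂ c s v) := by
  simp [tensorDeriv, map_sum]

theorem tensorSpline_add (c d : Fin κ₁.size → Fin κ₂.size → E) (s : ℝ × ℝ) :
    tensorSpline κ₁ κ₂ (c + d) s = tensorSpline κ₁ κ₂ c s + tensorSpline κ₁ κ₂ d s := by
  simp [tensorSpline, Finset.sum_add_distrib]

theorem tensorSpline_smul (a : ℝ) (c : Fin κ₁.size → Fin κ₂.size → E) (s : ℝ × ℝ) :
    tensorSpline κ₁ κ₂ (a • c) s = a • tensorSpline κ₁ κ₂ c s := by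
  simp only [tensorSpline, Pi.smul_apply, Finset.smul_sum]
  exact Finset.sum_congr rfl fun i _ => Finset.sum_congr rfl fun j _ => smul_comm ..

theorem tensorSpline_const (a : E) {s : ℝ × ℝ} (hs : s ∈ closedSquare) :
    tensorSpline κ₁ κ₂ (fun _ _ => a) s = a := by
  simp only [tensorSpline, ← Finset.sum_smul, ← Finset.mul_sum]
  rw [κ₂.sum_basis hs.2]
  simp only [mul_one]
  rw [κ₁.sum_basis hs.1, one_smul]

end TensorLinear

/-- A continuous linear equivalence maps null sets to null sets. -/
theorem volume_image_continuousLinearEquiv {E F : Type*} [NormedAddCommGroup E] [NormedSpace ℝ E]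
    [MeasureSpace E] [BorelSpace E] [FiniteDimensional ℝ E]
    [(volume : Measure E).IsAddHaarMeasure] [NormedAddCommGroup F] [NormedSpace ℝ F]
    [MeasureSpace F] [BorelSpace F] [FiniteDimensional ℝ F]
    [(volume : Measure F).IsAddHaarMeasure] (A : E ≃L[ℝ] F) {s : Set E} (hs : volume s = 0) :
    volume (A '' s) = 0 := by
  have h1 : ((volume : Measure E).map A).IsAddHaarMeasure := A.isAddHaarMeasure_map volume
  have h2 : (volume : Measure E).map A (A '' s) = 0 := by
    have h3 := A.toHomeomorph.toMeasurableEquiv.map_apply (μ := (volume : Measure E)) (A '' s)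
    have h4 : A.toHomeomorph.toMeasurableEquiv ⁻¹' (A '' s) = s := A.injective.preimage_image s
    rw [h4, hs] at h3
    exact h3
  exact Measure.absolutelyContinuous_isAddHaarMeasure _ _ h2

theorem volume_vertical (t : ℝ) : volume {s : ℝ × ℝ | s.1 = t} = 0 := by
  have : {s : ℝ × ℝ | s.1 = t} = {t} ×ˢ univ := by ext; simp
  rw [this, Measure.volume_eq_prod, Measure.prod_prod]
  simp

theorem volume_horizontal (t : ℝ) : volume {s : ℝ × ℝ | s.2 = t} = 0 := by
  have : {s : ℝ × ℝ | s.2 = t} = univ ×ˢ {t} := by ext; simp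
  rw [this, Measure.volume_eq_prod, Measure.prod_prod]
  simp

namespace Patch

variable (P : Patch)

theorem val_add (c d : P.Coeff) : P.val (c + d) = P.val c + P.val d :=
  funext fun _ => tensorSpline_add _ _ _ _ _

theorem val_smul (a : ℝ) (c : P.Coeff) : P.val (a • c) = a • P.val c :=
  funext fun _ => tensorSpline_smul _ _ _ _ _

/-- The union of the open elements in the physical plane. -/
def regularSet : Set Plane := ⋃ (e₁ : ℕ) (e₂ : ℕ) (_ : P.knots₁.IsSpan e₁ ∧ P.knots₂.IsSpan e₂),
  P.map '' openElement P.knots₁ P.knots₂ e₁ e₂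

theorem mem_regularSet {x : Plane} : x ∈ P.regularSet ↔ ∃ e₁ e₂, P.knots₁.IsSpan e₁ ∧
    P.knots₂.IsSpan e₂ ∧ ∃ s ∈ openElement P.knots₁ P.knots₂ e₁ e₂, P.map s = x := by
  simp [regularSet]

theorem isOpen_regularSet : IsOpen P.regularSet :=
  isOpen_iUnion fun _ => isOpen_iUnion fun _ => isOpen_iUnion fun _ =>
    P.isOpen_map_image (isOpen_openElement _ _ _ _) (openElement_subset _ _ _ _)

theorem regularSet_subset : P.regularSet ⊆ P.dom := by
  intro x hx
  obtain ⟨e₁, e₂, -, -, s, hs, rfl⟩ := P.mem_regularSet.mp hx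
  exact mem_image_of_mem _ (openElement_subset _ _ _ _ hs)

theorem volume_map_image {N : Set (ℝ × ℝ)} (hN : N ⊆ openSquare) (h0 : volume N = 0) :
    volume (P.map '' N) = 0 := by
  -- A linear equivalence with the plane turns the geometric mapping into a self-map of `ℝ × ℝ`; a
  -- differentiable one preserves null sets.
  obtain ⟨A, -⟩ := P.exists_equiv (s := (0, 0)) ⟨by simp, by simp⟩
  have h1 : DifferentiableOn ℝ (A.symm ∘ P.map) N := fun s hs =>
    (A.symm.differentiableAt.comp s
      (P.hasStrictFDerivAt_map (hN hs)).hasFDerivAt.differentiableAt).differentiableWithinAt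
  have h2 := volume_image_continuousLinearEquiv A
    (addHaar_image_eq_zero_of_differentiableOn_of_addHaar_eq_zero volume h1 h0)
  rw [image_image] at h2
  simpa using h2

/-- What the open elements miss is the image of a subset of countably many knot lines. -/
theorem volume_dom_diff_regularSet : volume (P.dom \ P.regularSet) = 0 := by
  let N : Set (ℝ × ℝ) := openSquare ∩
    ((⋃ k : ℕ, {s | s.1 = P.knots₁.knot k}) ∪ ⋃ k : ℕ, {s | s.2 = P.knots₂.knot k})
  refine measure_mono_null ?_ (P.volume_map_image (N := N) inter_subset_left ?_)
  · rintro _ ⟨⟨s, hs, rfl⟩, hx⟩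
    refine mem_image_of_mem _ ⟨hs, ?_⟩
    by_contra hN
    simp only [mem_union, mem_iUnion, mem_ofPred_eq, not_or, not_exists] at hN
    obtain ⟨e₁, e₂, h1, h2, hse⟩ := exists_mem_closedElement P.knots₁ P.knots₂
      (openSquare_subset hs)
    exact hx (P.mem_regularSet.mpr ⟨e₁, e₂, h1, h2, s,
      ⟨⟨hse.1.1.lt_of_ne' (hN.1 _), hse.1.2.lt_of_ne (hN.1 _)⟩,
        ⟨hse.2.1.lt_of_ne' (hN.2 _), hse.2.2.lt_of_ne (hN.2 _)⟩⟩, rfl⟩)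
  · refine measure_mono_null inter_subset_right (measure_union_null ?_ ?_)
    · exact measure_iUnion_null fun k => volume_vertical _
    · exact measure_iUnion_null fun k => volume_horizontal _

theorem ae_mem_regularSet : ∀ᵐ x ∂volume.restrict P.dom, x ∈ P.regularSet := by
  rw [ae_restrict_iff' P.isOpen_dom.measurableSet, ae_iff]
  convert! P.volume_dom_diff_regularSet using 2
  ext x
  simp

theorem contDiffAt_val_of_mem_regularSet (c : P.Coeff) {x : Plane} (hx : x ∈ P.regularSet) :
    ContDiffAt ℝ 2 (P.val c) x := by
  obtain ⟨e₁, e₂, h1, h2, s, hs, rfl⟩ := P.mem_regularSet.mp hx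
  exact P.contDiffAt_val h1 h2 c hs

theorem differentiableAt_fderiv_val (c : P.Coeff) {x : Plane} (hx : x ∈ P.regularSet) :
    DifferentiableAt ℝ (fderiv ℝ (P.val c)) x :=
  ((P.contDiffAt_val_of_mem_regularSet c hx).fderiv_right (m := 1) (by norm_num)
    ).differentiableAt one_ne_zero

theorem pderiv_val_add (c d : P.Coeff) (i : Fin 2) {x : Plane} (hx : x ∈ P.dom) :
    pderiv (P.val (c + d)) i x = pderiv (P.val c) i x + pderiv (P.val d) i x := by
  rw [pderiv, val_add, fderiv_add (P.hasFDerivAt_val c hx).differentiableAt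
    (P.hasFDerivAt_val d hx).differentiableAt]
  rfl

theorem pderiv_val_smul (a : ℝ) (c : P.Coeff) (i : Fin 2) {x : Plane} (hx : x ∈ P.dom) :
    pderiv (P.val (a • c)) i x = a * pderiv (P.val c) i x := by
  rw [pderiv, val_smul, fderiv_const_smul (P.hasFDerivAt_val c hx).differentiableAt]
  rfl

theorem fderiv_fderiv_val_add (c d : P.Coeff) {x : Plane} (hx : x ∈ P.regularSet) :
    fderiv ℝ (fderiv ℝ (P.val (c + d))) x =
      fderiv ℝ (fderiv ℝ (P.val c)) x + fderiv ℝ (fderiv ℝ (P.val d)) x := by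
  have h : fderiv ℝ (P.val (c + d)) =ᶠ[nhds x] fderiv ℝ (P.val c) + fderiv ℝ (P.val d) := by
    filter_upwards [P.isOpen_regularSet.mem_nhds hx] with y hy
    have hy' := P.regularSet_subset hy
    rw [val_add, fderiv_add (P.hasFDerivAt_val c hy').differentiableAt
      (P.hasFDerivAt_val d hy').differentiableAt]
    rfl
  rw [h.fderiv_eq, fderiv_add (P.differentiableAt_fderiv_val c hx)
    (P.differentiableAt_fderiv_val d hx)]

theorem fderiv_fderiv_val_smul (a : ℝ) (c : P.Coeff) {x : Plane} (hx : x ∈ P.regularSet) :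
    fderiv ℝ (fderiv ℝ (P.val (a • c))) x = a • fderiv ℝ (fderiv ℝ (P.val c)) x := by
  have h : fderiv ℝ (P.val (a • c)) =ᶠ[nhds x] a • fderiv ℝ (P.val c) := by
    filter_upwards [P.isOpen_regularSet.mem_nhds hx] with y hy
    rw [val_smul, fderiv_const_smul
      (P.hasFDerivAt_val c (P.regularSet_subset hy)).differentiableAt]
    rfl
  rw [h.fderiv_eq, fderiv_const_smul (P.differentiableAt_fderiv_val c hx)]

theorem density_add_left (a : EnergyForm) (c d e : P.Coeff) {x : Plane} (hx : x ∈ P.regularSet) :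
    a.density (P.val (c + d)) (P.val e) x =
      a.density (P.val c) (P.val e) x + a.density (P.val d) (P.val e) x := by
  cases a <;>
    simp only [EnergyForm.density, pderiv₂, P.fderiv_fderiv_val_add c d hx,
      P.pderiv_val_add c d _ (P.regularSet_subset hx), Fin.sum_univ_two, add_apply] <;> ring

theorem density_smul_left (a : EnergyForm) (t : ℝ) (c e : P.Coeff) {x : Plane}
    (hx : x ∈ P.regularSet) :
    a.density (P.val (t • c)) (P.val e) x = t * a.density (P.val c) (P.val e) x := by
  cases a <;>
    simp only [EnergyForm.density, pderiv₂, P.fderiv_fderiv_val_smul t c hx,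
      P.pderiv_val_smul t c _ (P.regularSet_subset hx), Fin.sum_univ_two, smul_apply,
      smul_eq_mul] <;> ring

/-- Measurable functions that are bounded on the open elements. -/
def IsBoundedMeasurable (g : Plane → ℝ) : Prop :=
  Measurable g ∧ ∃ C, ∀ x ∈ P.regularSet, |g x| ≤ C

variable {P} in
theorem IsBoundedMeasurable.add {g h : Plane → ℝ} (hg : P.IsBoundedMeasurable g)
    (hh : P.IsBoundedMeasurable h) : P.IsBoundedMeasurable fun x => g x + h x := by
  obtain ⟨hg, C, hC⟩ := hg
  obtain ⟨hh, D, hD⟩ := hh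
  exact ⟨hg.add hh, C + D, fun x hx => (abs_add_le _ _).trans (add_le_add (hC x hx) (hD x hx))⟩

variable {P} in
theorem IsBoundedMeasurable.mul {g h : Plane → ℝ} (hg : P.IsBoundedMeasurable g)
    (hh : P.IsBoundedMeasurable h) : P.IsBoundedMeasurable fun x => g x * h x := by
  obtain ⟨hg, C, hC⟩ := hg
  obtain ⟨hh, D, hD⟩ := hh
  refine ⟨hg.mul hh, C * D, fun x hx => ?_⟩
  rw [abs_mul]
  exact mul_le_mul (hC x hx) (hD x hx) (abs_nonneg _) ((abs_nonneg _).trans (hC x hx))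

theorem volume_dom_lt_top : volume P.dom < ⊤ :=
  (measure_mono P.dom_subset_closedDom).trans_lt P.isCompact_closedDom.measure_lt_top

variable {P} in
theorem IsBoundedMeasurable.integrableOn {g : Plane → ℝ} (hg : P.IsBoundedMeasurable g) :
    IntegrableOn g P.dom := by
  obtain ⟨hg, C, hC⟩ := hg
  exact Measure.integrableOn_of_bounded P.volume_dom_lt_top.ne hg.aestronglyMeasurable
    (P.ae_mem_regularSet.mono hC)

theorem norm_unitVec (i : Fin 2) : ‖unitVec i‖ = 1 := by
  simp [unitVec]

theorem isBoundedMeasurable_pderiv (c : P.Coeff) (i : Fin 2) :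
    P.IsBoundedMeasurable (pderiv (P.val c) i) := by
  -- Measurability of the derivative needs no regularity of the function, so the values of `val` off
  -- the patch do not matter.
  refine ⟨measurable_fderiv_apply_const ℝ _ _, ?_⟩
  obtain ⟨C, hC⟩ := P.isCompact_closedDom.exists_bound_of_continuousOn
    (E := Plane →L[ℝ] ℝ) (P.continuousOn_grad c)
  refine ⟨C, fun x hx => ?_⟩
  have hx' := P.regularSet_subset hx
  rw [pderiv, (P.hasFDerivAt_val c hx').fderiv, ← Real.norm_eq_abs]
  refine ((P.grad c x).le_opNorm _).trans ?_
  rw [norm_unitVec, mul_one]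
  exact hC x (P.dom_subset_closedDom hx')

theorem isBoundedMeasurable_pderiv₂ (c : P.Coeff) (i j : Fin 2) :
    P.IsBoundedMeasurable (pderiv₂ (P.val c) i j) := by
  refine ⟨?_, ?_⟩
  · exact (ContinuousLinearMap.measurable_apply (unitVec j)).comp
      (measurable_fderiv_apply_const ℝ (fderiv ℝ (P.val c)) (unitVec i))
  · choose C hC using fun e : {e : Fin P.knots₁.size × Fin P.knots₂.size //
      P.knots₁.IsSpan e.1 ∧ P.knots₂.IsSpan e.2} =>
        P.exists_norm_fderiv_fderiv_le e.2.1 e.2.2 c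
    obtain ⟨M, hM⟩ := (finite_range C).bddAbove
    refine ⟨M, fun x hx => ?_⟩
    obtain ⟨e₁, e₂, h1, h2, s, hs, rfl⟩ := P.mem_regularSet.mp hx
    have h3 := (hC ⟨(⟨e₁, h1.2.1⟩, ⟨e₂, h2.2.1⟩), h1, h2⟩ s hs).trans (hM (mem_range_self _))
    rw [pderiv₂, ← Real.norm_eq_abs]
    refine (ContinuousLinearMap.le_opNorm _ _).trans ?_
    rw [norm_unitVec, mul_one]
    refine (ContinuousLinearMap.le_opNorm _ _).trans ?_
    rw [norm_unitVec, mul_one]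
    exact h3

theorem isBoundedMeasurable_density (a : EnergyForm) (c d : P.Coeff) :
    P.IsBoundedMeasurable (a.density (P.val c) (P.val d)) := by
  have h1 := P.isBoundedMeasurable_pderiv
  have h2 := P.isBoundedMeasurable_pderiv₂
  cases a with
  | hessian =>
    have h := (((h2 c 0 0).mul (h2 d 0 0)).add ((h2 c 0 1).mul (h2 d 0 1))).add
      (((h2 c 1 0).mul (h2 d 1 0)).add ((h2 c 1 1).mul (h2 d 1 1)))
    convert! h using 2
    simp [EnergyForm.density, Fin.sum_univ_two]
  | laplacian =>
    have h := ((h2 c 0 0).add (h2 c 1 1)).mul ((h2 d 0 0).add (h2 d 1 1))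
    convert! h using 2
    simp [EnergyForm.density, Fin.sum_univ_two]
  | gradient =>
    have h := ((h1 c 0).mul (h1 d 0)).add ((h1 c 1).mul (h1 d 1))
    convert! h using 2
    simp [EnergyForm.density, Fin.sum_univ_two]

theorem continuousOn_pderiv (c : P.Coeff) (i : Fin 2) :
    ContinuousOn (pderiv (P.val c) i) P.regularSet := fun _ hx =>
  (((P.contDiffAt_val_of_mem_regularSet c hx).continuousAt_fderiv two_ne_zero).clm_apply
    continuousAt_const).continuousWithinAt

theorem continuousOn_pderiv₂ (c : P.Coeff) (i j : Fin 2) :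
    ContinuousOn (pderiv₂ (P.val c) i j) P.regularSet := fun x hx => by
  have h1 := ((P.contDiffAt_val_of_mem_regularSet c hx).fderiv_right (m := 1) (by norm_num)
    ).continuousAt_fderiv one_ne_zero
  exact ((h1.clm_apply continuousAt_const).clm_apply continuousAt_const).continuousWithinAt

theorem continuousOn_density (a : EnergyForm) (c d : P.Coeff) :
    ContinuousOn (a.density (P.val c) (P.val d)) P.regularSet := by
  have h1 := P.continuousOn_pderiv
  have h2 := P.continuousOn_pderiv₂
  cases a
  · exact continuousOn_finsetSum _ fun i _ => continuousOn_finsetSum _ fun j _ =>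
      (h2 c i j).mul (h2 d i j)
  · exact (continuousOn_finsetSum _ fun i _ => h2 c i i).mul
      (continuousOn_finsetSum _ fun i _ => h2 d i i)
  · exact continuousOn_finsetSum _ fun i _ => (h1 c i).mul (h1 d i)

theorem density_self_nonneg (a : EnergyForm) (u : Plane → ℝ) (x : Plane) :
    0 ≤ a.density u u x := by
  cases a
  · exact Finset.sum_nonneg fun i _ => Finset.sum_nonneg fun j _ => mul_self_nonneg _
  · exact mul_self_nonneg _
  · exact Finset.sum_nonneg fun i _ => mul_self_nonneg _

/-- Nonnegativity gives vanishing almost everywhere, and continuity on the open set `regularSet`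
upgrades this to every point. -/
theorem density_eq_zero_of_integral_eq_zero (a : EnergyForm) (c : P.Coeff)
    (h : ∫ x in P.dom, a.density (P.val c) (P.val c) x = 0) :
    ∀ x ∈ P.regularSet, a.density (P.val c) (P.val c) x = 0 := by
  rw [integral_eq_zero_iff_of_nonneg (fun _ => density_self_nonneg a _ _)
    (P.isBoundedMeasurable_density a c c).integrableOn] at h
  have h1 := ae_restrict_of_ae_restrict_of_subset P.regularSet_subset h
  exact Measure.eqOn_open_of_ae_eq h1 P.isOpen_regularSet (P.continuousOn_density a c c)
    continuousOn_const

/-! ### Splines with vanishing second derivatives -/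

/-- The coordinate functions of the geometric mapping. -/
def coordinate (k : Fin 2) : P.Coeff := fun i j => P.control i j k

theorem tensorDeriv_coordinate (k : Fin 2) (s v : ℝ × ℝ) :
    tensorDeriv P.knots₁ P.knots₂ (P.coordinate k) s v = P.mapDeriv s v k :=
  tensorDeriv_comp P.knots₁ P.knots₂ (EuclideanSpace.proj k : Plane →L[ℝ] ℝ) P.control s v

theorem tensorJacobian_ne_zero {s : ℝ × ℝ} (hs : s ∈ closedSquare) :
    tensorJacobian P.knots₁ P.knots₂ (P.coordinate 0) (P.coordinate 1) s ≠ 0 := by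
  intro h
  simp only [tensorJacobian, tensorDeriv_coordinate] at h
  obtain ⟨A, hA⟩ := P.exists_equiv hs
  have hinj : ∀ v, P.mapDeriv s v = 0 → v = 0 := fun v hv => by
    rw [← hA] at hv
    exact A.map_eq_zero_iff.mp hv
  have hlin : ∀ a b : ℝ, P.mapDeriv s (a, b) =
      a • P.mapDeriv s (1, 0) + b • P.mapDeriv s (0, 1) := fun a b => by
    rw [← map_smul, ← map_smul, ← map_add]
    simp
  -- With zero determinant, the vector of the η- and the negative ξ-derivative of the `k`-th
  -- coordinate lies in the kernel of the Jacobian.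
  have h1 : ∀ k : Fin 2, P.mapDeriv s (1, 0) k = 0 := by
    intro k
    have h2 := hinj (P.mapDeriv s (0, 1) k, -P.mapDeriv s (1, 0) k) (by
      rw [hlin]
      ext l
      fin_cases k <;> fin_cases l <;> simp <;> linarith)
    simpa using (Prod.ext_iff.mp h2).2
  have h2 := hinj (1, 0) (by ext k; exact h1 k)
  simpa using (Prod.ext_iff.mp h2).1

theorem eq_smul_unitVec (v : Plane) : v = v 0 • unitVec 0 + v 1 • unitVec 1 := by
  ext k
  fin_cases k <;> simp [unitVec]

/-- The pulled back Laplacian on an element. -/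
theorem laplaceNumerator_eq_zero (c : P.Coeff)
    (hc : ∀ x ∈ P.regularSet, pderiv₂ (P.val c) 0 0 x + pderiv₂ (P.val c) 1 1 x = 0)
    {e₁ e₂ : ℕ} (h1 : P.knots₁.IsSpan e₁) (h2 : P.knots₂.IsSpan e₂) :
    laplaceNumerator outerDeriv innerDeriv (polyPiece P.knots₁ P.knots₂ e₁ e₂ c)
      (polyPiece P.knots₁ P.knots₂ e₁ e₂ (P.coordinate 0))
      (polyPiece P.knots₁ P.knots₂ e₁ e₂ (P.coordinate 1)) = 0 := by
  refine eq_zero_of_evalAt_eq_zero h1.2.2 h2.2.2 fun s hs => ?_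
  change s ∈ openElement P.knots₁ P.knots₂ e₁ e₂ at hs
  set w := polyPiece P.knots₁ P.knots₂ e₁ e₂ c
  set x := polyPiece P.knots₁ P.knots₂ e₁ e₂ (P.coordinate 0)
  set y := polyPiece P.knots₁ P.knots₂ e₁ e₂ (P.coordinate 1)
  have hlap := hc _ (P.mem_regularSet.mpr ⟨e₁, e₂, h1, h2, s, hs, rfl⟩)
  have hso := openElement_subset _ _ _ _ hs
  let H := fderiv ℝ (fderiv ℝ (P.val c)) (P.map s)
  -- By the chain rule and Cramer's rule, the first-order numerators `P` and `Q` in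
  -- `laplaceNumerator` are `d` times the pulled back partial derivatives `g 0` and `g 1`.
  let g : Fin 2 → ℝ × ℝ → ℝ := fun k s => P.grad c (P.map s) (unitVec k)
  have hg : ∀ k, HasFDerivAt (g k)
      ((ContinuousLinearMap.apply ℝ ℝ (unitVec k)).comp (H.comp (P.mapDeriv s))) s := by
    intro k
    have h3 := (P.differentiableAt_fderiv_val c (P.mem_regularSet.mpr
      ⟨e₁, e₂, h1, h2, s, hs, rfl⟩)).hasFDerivAt.comp s (P.hasStrictFDerivAt_map hso).hasFDerivAt
    have h4 := (ContinuousLinearMap.apply ℝ ℝ (unitVec k)).hasFDerivAt.comp s h3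
    refine h4.congr_of_eventuallyEq ?_
    filter_upwards [isOpen_openSquare.mem_nhds hso] with y hy
    simp [g, (P.hasFDerivAt_val c (mem_image_of_mem _ hy)).fderiv]
  have hpart : ∀ s ∈ openElement P.knots₁ P.knots₂ e₁ e₂,
      evalAt s (outerDeriv w) = evalAt s (outerDeriv x) * g 0 s + evalAt s (outerDeriv y) * g 1 s ∧
      evalAt s (innerDeriv w) =
        evalAt s (innerDeriv x) * g 0 s + evalAt s (innerDeriv y) * g 1 s := by
    intro s hs
    have hsc := openElement_subset_closedElement _ _ _ _ hs
    have hsq := closedElement_subset _ _ _ _ hsc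
    have e1 := evalAt_deriv_polyPiece h1 h2 c hsc
    have e2 := evalAt_deriv_polyPiece h1 h2 (P.coordinate 0) hsc
    have e3 := evalAt_deriv_polyPiece h1 h2 (P.coordinate 1) hsc
    rw [e1.1, e1.2, e2.1, e2.2, e3.1, e3.2, ← P.grad_mapDeriv c hsq, ← P.grad_mapDeriv c hsq]
    simp only [tensorDeriv_coordinate]
    constructor
    · nth_rewrite 1 [eq_smul_unitVec (P.mapDeriv s (1, 0))]
      rw [map_add, map_smul, map_smul]
      rfl
    · nth_rewrite 1 [eq_smul_unitVec (P.mapDeriv s (0, 1))]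
      rw [map_add, map_smul, map_smul]
      rfl
  have hH : ∀ (v : ℝ × ℝ) (k : Fin 2), H (P.mapDeriv s v) (unitVec k) =
      P.mapDeriv s v 0 * H (unitVec 0) (unitVec k) + P.mapDeriv s v 1 * H (unitVec 1) (unitVec k) := by
    intro v k
    nth_rewrite 1 [eq_smul_unitVec (P.mapDeriv s v)]
    simp
  set d := outerDeriv x * innerDeriv y - innerDeriv x * outerDeriv y with hd
  have hprod : ∀ (k : Fin 2) (q : Polynomial (Polynomial ℝ)),
      (∀ s ∈ openElement P.knots₁ P.knots₂ e₁ e₂, evalAt s q = evalAt s d * g k s) →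
      evalAt s (outerDeriv q) = evalAt s d * H (P.mapDeriv s (1, 0)) (unitVec k) +
        g k s * evalAt s (outerDeriv d) ∧
      evalAt s (innerDeriv q) = evalAt s d * H (P.mapDeriv s (0, 1)) (unitVec k) +
        g k s * evalAt s (innerDeriv d) := by
    intro k q hq
    have h3 := (hasFDerivAt_evalAt d s).mul (hg k)
    have h4 : (fun s => evalAt s q) =ᶠ[nhds s] fun s => evalAt s d * g k s := by
      filter_upwards [(isOpen_openElement _ _ _ _).mem_nhds hs] with y hy using hq y hy
    have h5 := (hasFDerivAt_evalAt q s).unique (h3.congr_of_eventuallyEq h4)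
    constructor
    · simpa using congrArg (fun L => L (1, 0)) h5
    · simpa using congrArg (fun L => L (0, 1)) h5
  have hP := hprod 0 (outerDeriv w * innerDeriv y - innerDeriv w * outerDeriv y) fun s hs => by
    simp only [hd, evalAt_sub, evalAt_mul, (hpart s hs).1, (hpart s hs).2]
    ring
  have hQ := hprod 1 (innerDeriv w * outerDeriv x - outerDeriv w * innerDeriv x) fun s hs => by
    simp only [hd, evalAt_sub, evalAt_mul, (hpart s hs).1, (hpart s hs).2]
    ring
  have hPe : evalAt s (outerDeriv w * innerDeriv y - innerDeriv w * outerDeriv y) =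
      evalAt s d * g 0 s := by
    simp only [hd, evalAt_sub, evalAt_mul, (hpart s hs).1, (hpart s hs).2]
    ring
  have hQe : evalAt s (innerDeriv w * outerDeriv x - outerDeriv w * innerDeriv x) =
      evalAt s d * g 1 s := by
    simp only [hd, evalAt_sub, evalAt_mul, (hpart s hs).1, (hpart s hs).2]
    ring
  have hsc := openElement_subset_closedElement _ _ _ _ hs
  have e2 := evalAt_deriv_polyPiece h1 h2 (P.coordinate 0) hsc
  have e3 := evalAt_deriv_polyPiece h1 h2 (P.coordinate 1) hsc
  simp only [tensorDeriv_coordinate] at e2 e3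
  have hde : evalAt s d = P.mapDeriv s (1, 0) 0 * P.mapDeriv s (0, 1) 1 -
      P.mapDeriv s (0, 1) 0 * P.mapDeriv s (1, 0) 1 := by
    rw [hd, evalAt_sub, evalAt_mul, evalAt_mul, e2.1, e2.2, e3.1, e3.2]
  set p := outerDeriv w * innerDeriv y - innerDeriv w * outerDeriv y with hp
  set q := innerDeriv w * outerDeriv x - outerDeriv w * innerDeriv x with hq
  have hexp : laplaceNumerator outerDeriv innerDeriv w x y =
      (d * outerDeriv p - p * outerDeriv d) * innerDeriv y
        - (d * innerDeriv p - p * innerDeriv d) * outerDeriv y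
        + (d * innerDeriv q - q * innerDeriv d) * outerDeriv x
        - (d * outerDeriv q - q * outerDeriv d) * innerDeriv x := rfl
  rw [hexp]
  clear_value p q d
  simp only [evalAt_sub, evalAt_add, evalAt_mul]
  rw [hP.1, hP.2, hQ.1, hQ.2, hPe, hQe, e2.1, e2.2, e3.1, e3.2, hH, hH, hH, hH, hde]
  have hlap' : H (unitVec 0) (unitVec 0) + H (unitVec 1) (unitVec 1) = 0 := hlap
  -- The quotient rule terms with derivatives of `d` have cancelled, and the numerator is `d ^ 3`
  -- times the Laplacian.
  linear_combination (P.mapDeriv s (1, 0) 0 * P.mapDeriv s (0, 1) 1 -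
      P.mapDeriv s (0, 1) 0 * P.mapDeriv s (1, 0) 1) ^ 3 * hlap'

end Patch

theorem EnergyForm.density_comm (a : EnergyForm) (u v : Plane → ℝ) (x : Plane) :
    a.density u v x = a.density v u x := by
  cases a <;> simp only [EnergyForm.density, mul_comm]

theorem eq_zero_of_unitVec {E : Type*} [NormedAddCommGroup E] [NormedSpace ℝ E]
    {L : Plane →L[ℝ] E} (h : ∀ i, L (unitVec i) = 0) : L = 0 := by
  ext v
  rw [Patch.eq_smul_unitVec v]
  simp [h]

/-- The direction of the parametrization of an edge of the parametric square. -/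
def Side.tangent : Side → ℝ × ℝ
  | xi0 => (0, 1)
  | xi1 => (0, 1)
  | eta0 => (1, 0)
  | eta1 => (1, 0)

theorem Side.hasDerivAt_point (e : Side) (r : ℝ) : HasDerivAt e.point e.tangent r := by
  cases e
  exacts [(hasDerivAt_const r 0).prodMk (hasDerivAt_id r),
    (hasDerivAt_const r 1).prodMk (hasDerivAt_id r),
    (hasDerivAt_id r).prodMk (hasDerivAt_const r 0), (hasDerivAt_id r).prodMk (hasDerivAt_const r 1)]

theorem Side.tangent_ne_zero (e : Side) : e.tangent ≠ 0 := by
  cases e <;> simp [tangent]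

theorem Side.eq_zero_of_tangent_transversal {E : Type*} [NormedAddCommGroup E] [NormedSpace ℝ E]
    (e : Side) {L : ℝ × ℝ →L[ℝ] E} (h1 : L e.tangent = 0) (h2 : L e.transversal = 0) : L = 0 := by
  ext <;> cases e <;> simp_all [tangent, transversal]

/-! ### Kernels of the Hessian and gradient energies on one patch. -/

namespace Patch

variable (P : Patch)

theorem fderiv_val_eq_zero_of_gradient (c : P.Coeff)
    (h : ∀ x ∈ P.regularSet, EnergyForm.gradient.density (P.val c) (P.val c) x = 0) :
    ∀ x ∈ P.regularSet, fderiv ℝ (P.val c) x = 0 := by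
  intro x hx
  have h1 := h x hx
  simp only [EnergyForm.density] at h1
  rw [Finset.sum_eq_zero_iff_of_nonneg fun i _ => mul_self_nonneg _] at h1
  exact eq_zero_of_unitVec fun i => mul_self_eq_zero.mp (h1 i (Finset.mem_univ i))

theorem fderiv_fderiv_val_eq_zero_of_gradient (c : P.Coeff)
    (h : ∀ x ∈ P.regularSet, EnergyForm.gradient.density (P.val c) (P.val c) x = 0) :
    ∀ x ∈ P.regularSet, fderiv ℝ (fderiv ℝ (P.val c)) x = 0 := by
  intro x hx
  have h1 : fderiv ℝ (P.val c) =ᶠ[nhds x] fun _ => 0 := by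
    filter_upwards [P.isOpen_regularSet.mem_nhds hx] with y hy
      using P.fderiv_val_eq_zero_of_gradient c h y hy
  rw [h1.fderiv_eq]
  simp

theorem fderiv_fderiv_val_eq_zero_of_hessian (c : P.Coeff)
    (h : ∀ x ∈ P.regularSet, EnergyForm.hessian.density (P.val c) (P.val c) x = 0) :
    ∀ x ∈ P.regularSet, fderiv ℝ (fderiv ℝ (P.val c)) x = 0 := by
  intro x hx
  have h1 := h x hx
  simp only [EnergyForm.density] at h1
  rw [Finset.sum_eq_zero_iff_of_nonneg fun i _ => Finset.sum_nonneg fun j _ => mul_self_nonneg _]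
    at h1
  refine eq_zero_of_unitVec fun i => eq_zero_of_unitVec fun j => ?_
  have h2 := h1 i (Finset.mem_univ i)
  rw [Finset.sum_eq_zero_iff_of_nonneg fun j _ => mul_self_nonneg _] at h2
  exact mul_self_eq_zero.mp (h2 j (Finset.mem_univ j))

/-- The control values of an affine function. -/
def affine (L : Plane →L[ℝ] ℝ) (a : ℝ) : P.Coeff := fun i j => L (P.control i j) + a

theorem affine_eq (L : Plane →L[ℝ] ℝ) (a : ℝ) :
    P.affine L a = (fun i j => L (P.control i j)) + fun _ _ => a := rfl

/-- The isoparametric principle: scalar splines share the spline space of the coordinates of the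
geometric mapping, and constants belong to it by the partition of unity. -/
theorem val_affine (L : Plane →L[ℝ] ℝ) (a : ℝ) {x : Plane} (hx : x ∈ P.closedDom) :
    P.val (P.affine L a) x = L x + a := by
  obtain ⟨s, hs, rfl⟩ := hx
  rw [P.val_map _ hs, affine_eq, tensorSpline_add, tensorSpline_comp, tensorSpline_const _ _ _ hs]
  rfl

theorem grad_affine (L : Plane →L[ℝ] ℝ) (a : ℝ) {x : Plane} (hx : x ∈ P.closedDom) :
    P.grad (P.affine L a) x = L :=
  ((L.hasFDerivWithinAt.add_const a).congr (fun _ hy => P.val_affine L a hy)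
    (P.val_affine L a hx)).fderivWithin (P.uniqueDiffOn_closedDom x hx)

theorem fderiv_val_affine (L : Plane →L[ℝ] ℝ) (a : ℝ) {x : Plane} (hx : x ∈ P.dom) :
    fderiv ℝ (P.val (P.affine L a)) x = L := by
  rw [(P.hasFDerivAt_val _ hx).fderiv, P.grad_affine L a (P.dom_subset_closedDom hx)]

theorem fderiv_fderiv_val_affine (L : Plane →L[ℝ] ℝ) (a : ℝ) {x : Plane}
    (hx : x ∈ P.regularSet) : fderiv ℝ (fderiv ℝ (P.val (P.affine L a))) x = 0 := by
  have h1 : fderiv ℝ (P.val (P.affine L a)) =ᶠ[nhds x] fun _ => L := by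
    filter_upwards [P.isOpen_regularSet.mem_nhds hx] with y hy
      using P.fderiv_val_affine L a (P.regularSet_subset hy)
  rw [h1.fderiv_eq]
  simp

/-- Splines with vanishing second derivatives are affine. -/
theorem exists_eq_affine (c : P.Coeff)
    (h : ∀ x ∈ P.regularSet, fderiv ℝ (fderiv ℝ (P.val c)) x = 0) :
    ∃ L a, c = P.affine L a := by
  have hd₁ := P.knots₁.isSpan_degree
  have hd₂ := P.knots₂.isSpan_degree
  -- On this one connected element the derivative is a constant `L` and the function minus `L` a
  -- constant `a`. The difference to the affine spline is harmonic on all open elements, so unique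
  -- continuation extends the identity to the patch.
  set U := openElement P.knots₁ P.knots₂ P.knots₁.degree P.knots₂.degree with hU
  have hUs : U ⊆ openSquare := openElement_subset _ _ _ _
  have hUo : IsOpen (P.map '' U) := P.isOpen_map_image (isOpen_openElement _ _ _ _) hUs
  have hUr : P.map '' U ⊆ P.regularSet := by
    rintro _ ⟨s, hs, rfl⟩
    exact P.mem_regularSet.mpr ⟨_, _, hd₁, hd₂, s, hs, rfl⟩
  have hUc : IsPreconnected (P.map '' U) :=
    (((convex_Ioo _ _).prod (convex_Ioo _ _)).isPreconnected).image _
      (P.continuousOn_map.mono (hUs.trans openSquare_subset))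
  obtain ⟨L, hL⟩ := hUo.exists_is_const_of_fderiv_eq_zero (𝕜 := ℝ) hUc
    (fun x hx => (P.differentiableAt_fderiv_val c (hUr hx)).differentiableWithinAt)
    (fun x hx => h x (hUr hx))
  obtain ⟨a, ha⟩ := hUo.exists_is_const_of_fderiv_eq_zero (𝕜 := ℝ) (f := fun x => P.val c x - L x)
    hUc
    (fun x hx => ((P.hasFDerivAt_val c (P.regularSet_subset (hUr hx))).sub
      L.hasFDerivAt).differentiableAt.differentiableWithinAt)
    (fun x hx => by
      have hx' := P.hasFDerivAt_val c (P.regularSet_subset (hUr hx))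
      have h1 := (hx'.sub L.hasFDerivAt).fderiv
      rw [← hx'.fderiv, hL x hx, sub_self] at h1
      exact h1)
  refine ⟨L, a, ?_⟩
  rw [← sub_eq_zero]
  have hsub : c - P.affine L a = c + (-1 : ℝ) • P.affine L a := by
    rw [neg_one_smul, sub_eq_add_neg]
  refine eq_zero_of_polyPiece_eq_zero (x := P.coordinate 0) (y := P.coordinate 1)
    (fun e₁ e₂ h1 h2 => P.laplaceNumerator_eq_zero _ (fun x hx => ?_) h1 h2)
    (fun s hs => P.tensorJacobian_ne_zero hs) hd₁ hd₂ ?_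
  · simp only [pderiv₂, hsub]
    rw [P.fderiv_fderiv_val_add _ _ hx, P.fderiv_fderiv_val_smul _ _ hx, h x hx,
      P.fderiv_fderiv_val_affine L a hx]
    simp
  · refine eq_zero_of_evalAt_eq_zero hd₁.2.2 hd₂.2.2 fun s hs => ?_
    have hsq := openSquare_subset (hUs hs)
    rw [evalAt_polyPiece, ← tensorSpline_eq_tensorPiece hd₁ hd₂ _
      (openElement_subset_closedElement _ _ _ _ hs), hsub, ← P.val_map _ hsq, val_add, val_smul]
    have h1 := ha (P.map s) (mem_image_of_mem _ hs)
    simp only [Pi.add_apply, Pi.smul_apply, P.val_affine L a (P.map_mem hsq), smul_eq_mul]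
    linarith

theorem regularSet_nonempty : P.regularSet.Nonempty := by
  have hd₁ := P.knots₁.isSpan_degree
  have hd₂ := P.knots₂.isSpan_degree
  obtain ⟨s, hs⟩ := nonempty_Ioo.mpr hd₁.2.2
  obtain ⟨t, ht⟩ := nonempty_Ioo.mpr hd₂.2.2
  exact ⟨_, P.mem_regularSet.mpr ⟨_, _, hd₁, hd₂, (s, t), ⟨hs, ht⟩, rfl⟩⟩

/-- Splines with vanishing gradient are constant. -/
theorem exists_eq_affine_zero (c : P.Coeff)
    (h : ∀ x ∈ P.regularSet, EnergyForm.gradient.density (P.val c) (P.val c) x = 0) :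
    ∃ a, c = P.affine 0 a := by
  obtain ⟨L, a, rfl⟩ := P.exists_eq_affine c (P.fderiv_fderiv_val_eq_zero_of_gradient c h)
  obtain ⟨x, hx⟩ := P.regularSet_nonempty
  have h1 := P.fderiv_val_eq_zero_of_gradient _ h x hx
  rw [P.fderiv_val_affine L a (P.regularSet_subset hx)] at h1
  exact ⟨a, by rw [h1]⟩

/-! ### Edges -/

theorem curve_mem (e : Side) {r : ℝ} (hr : r ∈ Icc (0 : ℝ) 1) : P.curve e r ∈ P.closedDom :=
  P.map_mem (e.point_mem hr)

theorem hasDerivWithinAt_curve (e : Side) {r : ℝ} (_ : r ∈ Icc (0 : ℝ) 1) :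
    HasDerivWithinAt (P.curve e) (P.mapDeriv (e.point r) e.tangent) (Icc 0 1) r :=
  (P.hasFDerivWithinAt_map (e.point r)).comp_hasDerivWithinAt r
    (e.hasDerivAt_point r).hasDerivWithinAt fun _ ht => e.point_mem ht

theorem curveDeriv_eq (e : Side) {r : ℝ} (hr : r ∈ Icc (0 : ℝ) 1) :
    P.curveDeriv e r = P.mapDeriv (e.point r) e.tangent :=
  (P.hasDerivWithinAt_curve e hr).derivWithin (uniqueDiffOn_Icc one_pos r hr)

theorem transversalDeriv_eq (e : Side) {r : ℝ} (hr : r ∈ Icc (0 : ℝ) 1) :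
    P.transversalDeriv e r = P.mapDeriv (e.point r) e.transversal := by
  rw [transversalDeriv, (P.hasFDerivWithinAt_map _).fderivWithin
    (uniqueDiffOn_closedSquare _ (e.point_mem hr))]

theorem mapDeriv_ne_zero {s v : ℝ × ℝ} (hs : s ∈ closedSquare) (hv : v ≠ 0) :
    P.mapDeriv s v ≠ 0 := by
  obtain ⟨A, hA⟩ := P.exists_equiv hs
  rw [← hA]
  exact fun h => hv (A.map_eq_zero_iff.mp h)

theorem curveDeriv_ne_zero (e : Side) {r : ℝ} (hr : r ∈ Icc (0 : ℝ) 1) : P.curveDeriv e r ≠ 0 := by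
  rw [P.curveDeriv_eq e hr]
  exact P.mapDeriv_ne_zero (e.point_mem hr) e.tangent_ne_zero

theorem continuous_point (e : Side) : Continuous e.point :=
  continuous_iff_continuousAt.mpr fun r => (e.hasDerivAt_point r).continuousAt

theorem continuousOn_mapDeriv_point (e : Side) :
    ContinuousOn (fun r => P.mapDeriv (e.point r)) (Icc 0 1) :=
  (continuousOn_tensorDeriv _ _ P.control).comp (continuous_point e).continuousOn
    fun _ hr => e.point_mem hr

theorem continuousOn_curve (e : Side) : ContinuousOn (P.curve e) (Icc 0 1) := fun _ hr =>
  (P.hasDerivWithinAt_curve e hr).continuousWithinAt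

theorem continuousOn_curveDeriv (e : Side) : ContinuousOn (P.curveDeriv e) (Icc 0 1) :=
  ((P.continuousOn_mapDeriv_point e).clm_apply continuousOn_const).congr
    fun _ hr => P.curveDeriv_eq e hr

theorem continuousOn_transversalDeriv (e : Side) : ContinuousOn (P.transversalDeriv e) (Icc 0 1) :=
  ((P.continuousOn_mapDeriv_point e).clm_apply continuousOn_const).congr
    fun _ hr => P.transversalDeriv_eq e hr

/-- A linear functional vanishes if it does so on the tangent and the normals of an edge. -/
theorem clm_eq_zero_of_normal {L : Plane →L[ℝ] ℝ} {t : Plane} (ht : t ≠ 0) (h1 : L t = 0)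
    (h2 : ∀ n : Plane, inner ℝ n t = 0 → L n = 0) : L = 0 := by
  ext v
  have h3 := h2 (v - (inner ℝ v t / ‖t‖ ^ 2) • t) (by
    rw [inner_sub_left, inner_smul_left, real_inner_self_eq_norm_sq]
    have : ‖t‖ ^ 2 ≠ 0 := by positivity
    simp [this])
  rw [map_sub, map_smul, h1] at h3
  simpa using h3

/-- The trace vanishes along the edge, hence so does the tangential derivative; together with the
normal derivative this is full Cauchy data, and unique continuation applies. -/
theorem eq_zero_of_boundary (c : P.Coeff)
    (hc : ∀ x ∈ P.regularSet, pderiv₂ (P.val c) 0 0 x + pderiv₂ (P.val c) 1 1 x = 0) (e : Side)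
    (h : ∀ r ∈ Icc (0 : ℝ) 1, P.val c (P.curve e r) = 0 ∧
      ∀ n : Plane, inner ℝ n (P.curveDeriv e r) = 0 → P.grad c (P.curve e r) n = 0) : c = 0 := by
  have h0 : ∀ r ∈ Icc (0 : ℝ) 1, tensorSpline P.knots₁ P.knots₂ c (e.point r) = 0 := fun r hr => by
    rw [← P.val_map c (e.point_mem hr)]
    exact (h r hr).1
  refine eq_zero_of_cauchyData_side (x := P.coordinate 0) (y := P.coordinate 1)
    (fun e₁ e₂ h1 h2 => P.laplaceNumerator_eq_zero c hc h1 h2)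
    (fun s hs => P.tensorJacobian_ne_zero hs) e fun r hr => ⟨h0 r hr, ?_⟩
  have htan : tensorDeriv P.knots₁ P.knots₂ c (e.point r) e.tangent = 0 := by
    have h1 : HasDerivWithinAt (fun r => tensorSpline P.knots₁ P.knots₂ c (e.point r))
        (tensorDeriv P.knots₁ P.knots₂ c (e.point r) e.tangent) (Icc 0 1) r :=
      (hasFDerivWithinAt_tensorSpline P.knots₁ P.knots₂ c (e.point r)).comp_hasDerivWithinAt r
        (e.hasDerivAt_point r).hasDerivWithinAt fun _ ht => e.point_mem ht
    have h2 := ((hasDerivWithinAt_const r (Icc (0 : ℝ) 1) (0 : ℝ)).congr h0 (h0 r hr))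
    exact (uniqueDiffOn_Icc one_pos r hr).eq_deriv _ h1 h2
  have hg : P.grad c (P.map (e.point r)) = 0 := by
    refine clm_eq_zero_of_normal (P.curveDeriv_ne_zero e hr) ?_ (h r hr).2
    rw [P.curveDeriv_eq e hr, P.grad_mapDeriv c (e.point_mem hr), htan]
  ext
  · rw [ContinuousLinearMap.comp_apply, ← P.grad_mapDeriv c (e.point_mem hr), hg]
    rfl
  · rw [ContinuousLinearMap.comp_apply, ← P.grad_mapDeriv c (e.point_mem hr), hg]
    rfl

/-- Traces on an edge are splines for the knots of the edge. -/
theorem exists_trace (e : Side) (c : P.Coeff) : ∃ b : Fin (P.edgeKnots e).size → ℝ, ∀ r,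
    tensorSpline P.knots₁ P.knots₂ c (e.point r) = ∑ j, b j * (P.edgeKnots e).basis j r := by
  cases e
  · refine ⟨fun j => ∑ i : Fin P.knots₁.size, P.knots₁.basis i 0 * c i j, fun r => ?_⟩
    simp only [tensorSpline, Side.point, edgeKnots, smul_eq_mul, Finset.sum_mul]
    rw [Finset.sum_comm]
    exact Finset.sum_congr rfl fun j _ => Finset.sum_congr rfl fun i _ => by ring
  · refine ⟨fun j => ∑ i : Fin P.knots₁.size, P.knots₁.basis i 1 * c i j, fun r => ?_⟩
    simp only [tensorSpline, Side.point, edgeKnots, smul_eq_mul, Finset.sum_mul]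
    rw [Finset.sum_comm]
    exact Finset.sum_congr rfl fun j _ => Finset.sum_congr rfl fun i _ => by ring
  · refine ⟨fun i => ∑ j : Fin P.knots₂.size, P.knots₂.basis j 0 * c i j, fun r => ?_⟩
    simp only [tensorSpline, Side.point, edgeKnots, smul_eq_mul, Finset.sum_mul]
    exact Finset.sum_congr rfl fun j _ => Finset.sum_congr rfl fun i _ => by ring
  · refine ⟨fun i => ∑ j : Fin P.knots₂.size, P.knots₂.basis j 1 * c i j, fun r => ?_⟩
    simp only [tensorSpline, Side.point, edgeKnots, smul_eq_mul, Finset.sum_mul]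
    exact Finset.sum_congr rfl fun j _ => Finset.sum_congr rfl fun i _ => by ring

/-- Transversal derivatives on an edge are splines for the knots of the edge. -/
theorem exists_transversal_trace (e : Side) (c : P.Coeff) :
    ∃ b : Fin (P.edgeKnots e).size → ℝ, ∀ r,
      tensorDeriv P.knots₁ P.knots₂ c (e.point r) e.transversal =
        ∑ j, b j * (P.edgeKnots e).basis j r := by
  cases e
  · refine ⟨fun j => ∑ i : Fin P.knots₁.size, P.knots₁.basisDeriv i 0 * c i j, fun r => ?_⟩
    simp [tensorDeriv, Side.point, Side.transversal, edgeKnots, Finset.sum_mul]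
    rw [Finset.sum_comm]
    exact Finset.sum_congr rfl fun j _ => Finset.sum_congr rfl fun i _ => by ring
  · refine ⟨fun j => ∑ i : Fin P.knots₁.size, P.knots₁.basisDeriv i 1 * c i j, fun r => ?_⟩
    simp [tensorDeriv, Side.point, Side.transversal, edgeKnots, Finset.sum_mul]
    rw [Finset.sum_comm]
    exact Finset.sum_congr rfl fun j _ => Finset.sum_congr rfl fun i _ => by ring
  · refine ⟨fun i => ∑ j : Fin P.knots₂.size, P.knots₂.basisDeriv j 0 * c i j, fun r => ?_⟩
    simp [tensorDeriv, Side.point, Side.transversal, edgeKnots, Finset.sum_mul]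
    exact Finset.sum_congr rfl fun j _ => Finset.sum_congr rfl fun i _ => by ring
  · refine ⟨fun i => ∑ j : Fin P.knots₂.size, P.knots₂.basisDeriv j 1 * c i j, fun r => ?_⟩
    simp [tensorDeriv, Side.point, Side.transversal, edgeKnots, Finset.sum_mul]
    exact Finset.sum_congr rfl fun j _ => Finset.sum_congr rfl fun i _ => by ring

/-- Affine functions and their transversal derivatives are splines on the edges. -/
theorem exists_affine_trace (e : Side) (L : Plane →L[ℝ] ℝ) (a : ℝ) :
    (∃ b : Fin (P.edgeKnots e).size → ℝ, ∀ r ∈ Icc (0 : ℝ) 1,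
      L (P.curve e r) + a = ∑ j, b j * (P.edgeKnots e).basis j r) ∧
    ∃ b : Fin (P.edgeKnots e).size → ℝ, ∀ r ∈ Icc (0 : ℝ) 1,
      L (P.transversalDeriv e r) = ∑ j, b j * (P.edgeKnots e).basis j r := by
  obtain ⟨b, hb⟩ := P.exists_trace e (P.affine L a)
  obtain ⟨d, hd⟩ := P.exists_transversal_trace e (P.affine L a)
  refine ⟨⟨b, fun r hr => ?_⟩, d, fun r hr => ?_⟩
  · rw [← hb, ← P.val_map _ (e.point_mem hr), P.val_affine L a (P.map_mem (e.point_mem hr))]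
    rfl
  · rw [← hd, ← P.grad_mapDeriv _ (e.point_mem hr), P.grad_affine L a
      (P.map_mem (e.point_mem hr)), P.transversalDeriv_eq e hr]

/-- An affine function with vanishing Cauchy data on an edge is zero. -/
theorem affine_eq_zero (e : Side) {L : Plane →L[ℝ] ℝ} {a : ℝ}
    (h1 : ∀ r ∈ Icc (0 : ℝ) 1, L (P.curve e r) + a = 0) {r : ℝ} (hr : r ∈ Icc (0 : ℝ) 1)
    (h2 : L (P.transversalDeriv e r) = 0) : L = 0 ∧ a = 0 := by
  have hL : L = 0 := by
    -- Differentiation of `h1` along the edge controls `L` on the tangent; the transversal direction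
    -- at the same point completes a basis of the plane.
    have h3 : L.comp (P.mapDeriv (e.point r)) = 0 := by
      refine e.eq_zero_of_tangent_transversal ?_ ?_
      · have h4 := (L.hasFDerivAt.comp_hasDerivWithinAt r (P.hasDerivWithinAt_curve e hr)).add_const a
        have h5 := ((hasDerivWithinAt_const r (Icc (0 : ℝ) 1) (0 : ℝ)).congr h1 (h1 r hr))
        exact (uniqueDiffOn_Icc one_pos r hr).eq_deriv _ h4 h5
      · rw [ContinuousLinearMap.comp_apply, ← P.transversalDeriv_eq e hr, h2]
    obtain ⟨A, hA⟩ := P.exists_equiv (e.point_mem hr)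
    ext v
    have h4 := congrArg (fun M => M (A.symm v)) h3
    simpa [← hA] using h4
  refine ⟨hL, ?_⟩
  simpa [hL] using h1 r hr

end Patch

/-! ### Abstract solvability; the form and the load as linear maps. -/

/-- A linear variational problem with a definite form on a finite-dimensional subspace has a unique
solution. -/
theorem existsUnique_of_definite {V : Type*} [AddCommGroup V] [Module ℝ V]
    [FiniteDimensional ℝ V] (K : Submodule ℝ V) (B : V →ₗ[ℝ] V →ₗ[ℝ] ℝ) (l : V →ₗ[ℝ] ℝ)
    (h : ∀ u ∈ K, B u u = 0 → u = 0) : ∃! u, u ∈ K ∧ ∀ v ∈ K, B u v = l v := by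
  let T : K →ₗ[ℝ] Module.Dual ℝ K := (K.subtype.dualMap).comp (B.comp K.subtype)
  have hT : ∀ u v : K, T u v = B u v := fun _ _ => rfl
  have hinj : Function.Injective T := by
    rw [injective_iff_map_eq_zero]
    intro u hu
    have h1 := h u u.2 (by rw [← hT, hu]; rfl)
    exact Subtype.ext h1
  have hsurj := (LinearMap.injective_iff_surjective_of_finrank_eq_finrank
    (Subspace.dual_finrank_eq (K := ℝ) (V := K)).symm).mp hinj
  obtain ⟨u, hu⟩ := hsurj (l.comp K.subtype)
  refine ⟨u, ⟨u.2, fun v hv => ?_⟩, fun w hw => ?_⟩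
  · rw [← hT u ⟨v, hv⟩, hu]
    rfl
  · have h1 : (⟨w, hw.1⟩ : K) = u := hinj (by
      rw [hu]
      ext v
      exact hw.2 v v.2)
    rw [← h1]

namespace Patch

variable (P : Patch)

theorem val_zero : P.val 0 = 0 := by
  ext x
  simp [val, tensorSpline]

theorem grad_smul_add (a : ℝ) (c d : P.Coeff) {x : Plane} (hx : x ∈ P.closedDom) :
    P.grad (a • c + d) x = a • P.grad c x + P.grad d x := by
  have h := ((P.hasFDerivWithinAt_val_grad c hx).const_smul a).add
    (P.hasFDerivWithinAt_val_grad d hx)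
  rw [← val_smul, ← val_add] at h
  exact h.fderivWithin (P.uniqueDiffOn_closedDom x hx)

theorem eq_zero_of_affine_eq_zero {L : Plane →L[ℝ] ℝ} {a : ℝ} (h : P.affine L a = 0) :
    L = 0 ∧ a = 0 := by
  obtain ⟨x, hx⟩ := P.regularSet_nonempty
  have hx' := P.regularSet_subset hx
  have h1 := P.fderiv_val_affine L a hx'
  rw [h, val_zero, fderiv_zero] at h1
  have h2 := P.val_affine L a (P.dom_subset_closedDom hx')
  rw [h, val_zero, ← h1] at h2
  exact ⟨h1.symm, by simpa using h2.symm⟩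

theorem affine_zero : P.affine 0 0 = 0 := by
  ext i j
  simp [affine]

theorem integrableOn_density (a : EnergyForm) (c d : P.Coeff) :
    IntegrableOn (a.density (P.val c) (P.val d)) P.dom :=
  (P.isBoundedMeasurable_density a c d).integrableOn

theorem integral_density_add_left (a : EnergyForm) (c d e : P.Coeff) :
    ∫ x in P.dom, a.density (P.val (c + d)) (P.val e) x =
      (∫ x in P.dom, a.density (P.val c) (P.val e) x) +
        ∫ x in P.dom, a.density (P.val d) (P.val e) x := by
  rw [← integral_add (P.integrableOn_density a c e) (P.integrableOn_density a d e)]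
  exact integral_congr_ae (P.ae_mem_regularSet.mono fun x hx => P.density_add_left a c d e hx)

theorem integral_density_smul_left (a : EnergyForm) (t : ℝ) (c e : P.Coeff) :
    ∫ x in P.dom, a.density (P.val (t • c)) (P.val e) x =
      t * ∫ x in P.dom, a.density (P.val c) (P.val e) x := by
  rw [← integral_const_mul]
  exact integral_congr_ae (P.ae_mem_regularSet.mono fun x hx => P.density_smul_left a t c e hx)

end Patch

namespace MultiPatch

variable (D : MultiPatch)

theorem energy_comm (a : EnergyForm) (u v : D.Broken) : D.energy a u v = D.energy a v u := by
  simp only [energy]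
  refine Finset.sum_congr rfl fun k _ => ?_
  congr 1
  ext x
  exact a.density_comm _ _ x

theorem energy_add_left (a : EnergyForm) (u v w : D.Broken) :
    D.energy a (u + v) w = D.energy a u w + D.energy a v w := by
  simp only [energy, Pi.add_apply, Patch.integral_density_add_left, Finset.sum_add_distrib]

theorem energy_smul_left (a : EnergyForm) (t : ℝ) (u w : D.Broken) :
    D.energy a (t • u) w = t * D.energy a u w := by
  simp only [energy, Pi.smul_apply, Patch.integral_density_smul_left, Finset.mul_sum]

/-- The broken bilinear form as a bilinear map. -/
def energyMap (a : EnergyForm) : D.Broken →ₗ[ℝ] D.Broken →ₗ[ℝ] ℝ :=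
  LinearMap.mk₂ ℝ (D.energy a) (D.energy_add_left a) (D.energy_smul_left a)
    (fun u v w => by
      rw [D.energy_comm a, D.energy_add_left, D.energy_comm a v, D.energy_comm a w])
    (fun t u v => by
      rw [D.energy_comm a, D.energy_smul_left, D.energy_comm a v]
      rfl)

theorem density_eq_zero_of_energy_eq_zero {a : EnergyForm} {u : D.Broken}
    (h : D.energy a u u = 0) (k : Fin D.numPatches) : ∀ x ∈ (D.patch k).regularSet,
      a.density ((D.patch k).val (u k)) ((D.patch k).val (u k)) x = 0 := by
  refine (D.patch k).density_eq_zero_of_integral_eq_zero a (u k) ?_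
  rw [energy, Finset.sum_eq_zero_iff_of_nonneg fun k _ =>
    integral_nonneg fun x => Patch.density_self_nonneg a _ x] at h
  exact h k (Finset.mem_univ k)

theorem volume_lt_top : volume D.Ω < ⊤ := by
  have h : IsCompact (closure D.Ω) := by
    rw [D.closure_eq]
    exact isCompact_iUnion fun k => (D.patch k).isCompact_closedDom
  exact (measure_mono subset_closure).trans_lt h.measure_lt_top

/-- `Ω` has finite measure, so `f` is integrable, and broken splines are bounded. -/
theorem integrableOn_mul_toFun {f : Plane → ℝ} (hf : MemLp f 2 (volume.restrict D.Ω))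
    (u : D.Broken) : IntegrableOn (fun x => f x * D.toFun u x) D.Ω := by
  have : IsFiniteMeasure (volume.restrict D.Ω) := ⟨by simpa using D.volume_lt_top⟩
  have hf1 : Integrable f (volume.restrict D.Ω) := hf.integrable one_le_two
  simp only [toFun, Finset.mul_sum]
  refine integrable_finsetSum _ fun k _ => ?_
  obtain ⟨C, hC⟩ := (D.patch k).isCompact_closedDom.exists_bound_of_continuousOn
    ((D.patch k).continuousOn_val (u k))
  refine hf1.mul_bdd (c := max C 0) ?_ (Filter.Eventually.of_forall fun x => ?_)
  · have hm := (D.patch k).isOpen_dom.measurableSet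
    exact ((aestronglyMeasurable_indicator_iff hm).mpr ((((D.patch k).continuousOn_val (u k)).mono
      (D.patch k).dom_subset_closedDom).aestronglyMeasurable hm)).restrict
  · by_cases hx : x ∈ (D.patch k).dom
    · rw [indicator_of_mem hx]
      exact (hC x ((D.patch k).dom_subset_closedDom hx)).trans (le_max_left _ _)
    · simp [indicator_of_notMem hx]

theorem toFun_add (u v : D.Broken) (x : Plane) :
    D.toFun (u + v) x = D.toFun u x + D.toFun v x := by
  simp only [toFun, Pi.add_apply, Patch.val_add, indicator_add', Finset.sum_add_distrib]

theorem toFun_smul (t : ℝ) (u : D.Broken) (x : Plane) :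
    D.toFun (t • u) x = t * D.toFun u x := by
  simp only [toFun, Pi.smul_apply, Patch.val_smul, Finset.mul_sum]
  refine Finset.sum_congr rfl fun k _ => ?_
  by_cases hx : x ∈ (D.patch k).dom <;> simp [hx]

/-- The load as a linear map. -/
def loadMap {f : Plane → ℝ} (hf : MemLp f 2 (volume.restrict D.Ω)) : D.Broken →ₗ[ℝ] ℝ where
  toFun := D.load f
  map_add' u v := by
    rw [load, load, load, ← integral_add (D.integrableOn_mul_toFun hf u)
      (D.integrableOn_mul_toFun hf v)]
    simp only [toFun_add, mul_add]
  map_smul' t u := by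
    rw [load, load, RingHom.id_apply, smul_eq_mul, ← integral_const_mul]
    simp only [toFun_smul]
    congr 1
    ext x
    ring

/-! ### Jumps and the linearity of the constraints. -/

namespace Interface

variable {D} (Γ : D.Interface)

theorem curve_mem_slave {r : ℝ} (hr : r ∈ Icc (0 : ℝ) 1) :
    Γ.curve r ∈ (D.patch Γ.slave).closedDom := (D.patch Γ.slave).curve_mem _ hr

/-- Slave and master share the edge only as a point set; their parametrizations may differ. -/
theorem curve_mem_master {r : ℝ} (hr : r ∈ Icc (0 : ℝ) 1) :
    Γ.curve r ∈ (D.patch Γ.master).closedDom := by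
  have h1 : Γ.curve r ∈ (D.patch Γ.slave).edge Γ.slaveSide := mem_image_of_mem _ hr
  rw [Γ.edge_eq] at h1
  obtain ⟨t, ht, htr⟩ := h1
  rw [← htr]
  exact (D.patch Γ.master).curve_mem _ ht

theorem continuousOn_curve : ContinuousOn Γ.curve (Icc 0 1) :=
  (D.patch Γ.slave).continuousOn_curve _

theorem continuousOn_direction : ContinuousOn Γ.direction (Icc 0 1) :=
  (D.patch Γ.slave).continuousOn_transversalDeriv _

theorem continuousOn_weight (m : EdgeMeasure) : ContinuousOn (Γ.weight m) (Icc 0 1) := by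
  cases m
  · exact ((D.patch Γ.slave).continuousOn_curveDeriv _).norm
  · exact continuousOn_const

theorem weight_pos (m : EdgeMeasure) : ∀ r ∈ Icc (0 : ℝ) 1, 0 < Γ.weight m r := by
  intro r hr
  cases m
  · exact norm_pos_iff.mpr ((D.patch Γ.slave).curveDeriv_ne_zero _ hr)
  · exact one_pos

theorem continuousOn_jump (u : D.Broken) : ContinuousOn (Γ.jump u) (Icc 0 1) :=
  (((D.patch Γ.slave).continuousOn_val _).comp Γ.continuousOn_curve
      fun _ hr => Γ.curve_mem_slave hr).sub
    (((D.patch Γ.master).continuousOn_val _).comp Γ.continuousOn_curve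
      fun _ hr => Γ.curve_mem_master hr)

theorem continuousOn_derivJump (u : D.Broken) : ContinuousOn (Γ.derivJump u) (Icc 0 1) :=
  ((((D.patch Γ.slave).continuousOn_grad _).comp Γ.continuousOn_curve
      fun _ hr => Γ.curve_mem_slave hr).clm_apply Γ.continuousOn_direction).sub
    ((((D.patch Γ.master).continuousOn_grad _).comp Γ.continuousOn_curve
      fun _ hr => Γ.curve_mem_master hr).clm_apply Γ.continuousOn_direction)

theorem jump_smul_add (a : ℝ) (u v : D.Broken) (r : ℝ) :
    Γ.jump (a • u + v) r = a * Γ.jump u r + Γ.jump v r := by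
  simp only [jump, Pi.add_apply, Pi.smul_apply, Patch.val_add, Patch.val_smul, smul_eq_mul]
  ring

theorem derivJump_smul_add (a : ℝ) (u v : D.Broken) {r : ℝ} (hr : r ∈ Icc (0 : ℝ) 1) :
    Γ.derivJump (a • u + v) r = a * Γ.derivJump u r + Γ.derivJump v r := by
  simp only [derivJump, Pi.add_apply, Pi.smul_apply]
  rw [Patch.grad_smul_add _ _ _ _ (Γ.curve_mem_slave hr),
    Patch.grad_smul_add _ _ _ _ (Γ.curve_mem_master hr)]
  simp only [add_apply, smul_apply, smul_eq_mul]
  ring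

end Interface

variable {D}

/-- Orthogonality to all multipliers decouples over the interfaces. -/
theorem forall_finsum_eq_zero_iff (β : DualBasis) (m : EdgeMeasure) (J : D.Interface → ℝ → ℝ) :
    (∀ μ ∈ D.multiplierSpace β m,
        ∑ᶠ Γ : D.Interface, ∫ r in (0 : ℝ)..1, J Γ r * μ Γ r * Γ.weight m r = 0) ↔
      ∀ Γ : D.Interface, ∀ ν ∈ multipliers Γ.knots (Γ.weight m) β,
        ∫ r in (0 : ℝ)..1, J Γ r * ν r * Γ.weight m r = 0 := by
  classical
  refine ⟨fun h Γ ν hν => ?_, fun h μ hμ => ?_⟩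
  -- The test family is supported on one interface, which is admissible since zero lies in every
  -- span.
  · have h1 := h (Function.update 0 Γ ν) fun Γ' => by
      rcases eq_or_ne Γ' Γ with rfl | hne
      · simpa using hν
      · simp [Function.update_of_ne hne]
    rw [finsum_eq_single _ Γ fun Γ' hne => by simp [Function.update_of_ne hne]] at h1
    simpa using h1
  · simp [fun Γ => h Γ (μ Γ) (hμ Γ)]

theorem Interface.integral_smul_add (Γ : D.Interface) {β : DualBasis} {m : EdgeMeasure}
    {ν : ℝ → ℝ} (hν : ν ∈ multipliers Γ.knots (Γ.weight m) β) {J₁ J₂ J : ℝ → ℝ} (a : ℝ)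
    (h1 : ContinuousOn J₁ (Icc 0 1)) (h2 : ContinuousOn J₂ (Icc 0 1))
    (hJ : ∀ r ∈ Icc (0 : ℝ) 1, J r = a * J₁ r + J₂ r) :
    ∫ r in (0 : ℝ)..1, J r * ν r * Γ.weight m r =
      a * (∫ r in (0 : ℝ)..1, J₁ r * ν r * Γ.weight m r) +
        ∫ r in (0 : ℝ)..1, J₂ r * ν r * Γ.weight m r := by
  have hint : ∀ f : ℝ → ℝ, ContinuousOn f (Icc 0 1) →
      IntervalIntegrable (fun r => f r * ν r * Γ.weight m r) volume 0 1 := by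
    intro f hf
    have h01 : uIcc (0 : ℝ) 1 = Icc 0 1 := uIcc_of_le zero_le_one
    exact ((intervalIntegrable_of_mem_multipliers hν 0 1).continuousOn_mul
      (by rwa [h01])).mul_continuousOn (by rw [h01]; exact Γ.continuousOn_weight m)
  rw [← intervalIntegral.integral_const_mul, ← intervalIntegral.integral_add
    ((hint J₁ h1).const_mul a) (hint J₂ h2)]
  refine intervalIntegral.integral_congr fun r hr => ?_
  rw [uIcc_of_le zero_le_one] at hr
  simp only [hJ r hr]
  ring

theorem mem_constrainedSpace_iff {β : DualBasis} {m : EdgeMeasure} {u : D.Broken} :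
    u ∈ D.constrainedSpace β m ↔ D.boundaryCondition u ∧
      (∀ Γ : D.Interface, ∀ ν ∈ multipliers Γ.knots (Γ.weight m) β,
        ∫ r in (0 : ℝ)..1, Γ.jump u r * ν r * Γ.weight m r = 0) ∧
      (∀ Γ : D.Interface, ∀ ν ∈ multipliers Γ.knots (Γ.weight m) β,
        ∫ r in (0 : ℝ)..1, Γ.derivJump u r * ν r * Γ.weight m r = 0) ∧
      (β = .globalCoarse → D.vertexConstraint u) := by
  rw [← forall_finsum_eq_zero_iff β m fun Γ => Γ.jump u,
    ← forall_finsum_eq_zero_iff β m fun Γ => Γ.derivJump u]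
  rfl

theorem smul_add_mem_constrainedSpace {β : DualBasis} {m : EdgeMeasure} {u v : D.Broken} (a : ℝ)
    (hu : u ∈ D.constrainedSpace β m) (hv : v ∈ D.constrainedSpace β m) :
    a • u + v ∈ D.constrainedSpace β m := by
  rw [mem_constrainedSpace_iff] at *
  obtain ⟨hu1, hu2, hu3, hu4⟩ := hu
  obtain ⟨hv1, hv2, hv3, hv4⟩ := hv
  refine ⟨fun k e he r hr => ?_, fun Γ ν hν => ?_, fun Γ ν hν => ?_, fun hβ Γ => ?_⟩
  · have h1 := hu1 k e he r hr
    have h2 := hv1 k e he r hr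
    refine ⟨?_, fun n hn => ?_⟩
    · simp only [Pi.add_apply, Pi.smul_apply, Patch.val_add, Patch.val_smul, h1.1, h2.1,
        smul_zero, add_zero]
    · rw [Pi.add_apply, Pi.smul_apply, Patch.grad_smul_add _ _ _ _ ((D.patch k).curve_mem e hr)]
      simp [h1.2 n hn, h2.2 n hn]
  · rw [Γ.integral_smul_add hν a (Γ.continuousOn_jump u) (Γ.continuousOn_jump v)
      fun r _ => Γ.jump_smul_add a u v r, hu2 Γ ν hν, hv2 Γ ν hν, mul_zero, add_zero]
  · rw [Γ.integral_smul_add hν a (Γ.continuousOn_derivJump u) (Γ.continuousOn_derivJump v)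
      fun r hr => Γ.derivJump_smul_add a u v hr, hu3 Γ ν hν, hv3 Γ ν hν, mul_zero, add_zero]
  · obtain ⟨h1, h2, h3, h4⟩ := hu4 hβ Γ
    obtain ⟨h5, h6, h7, h8⟩ := hv4 hβ Γ
    simp [Γ.jump_smul_add, Γ.derivJump_smul_add, h1, h2, h3, h4, h5, h6, h7, h8]

theorem zero_mem_constrainedSpace (β : DualBasis) (m : EdgeMeasure) :
    (0 : D.Broken) ∈ D.constrainedSpace β m := by
  have hg : ∀ k, (D.patch k).grad 0 = fun _ => 0 := fun k => by
    ext1 x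
    simp [Patch.grad, Patch.val_zero]
  have hj : ∀ (Γ : D.Interface) r, Γ.jump 0 r = 0 := by simp [Interface.jump, Patch.val_zero]
  have hd : ∀ (Γ : D.Interface) r, Γ.derivJump 0 r = 0 := by simp [Interface.derivJump, hg]
  rw [mem_constrainedSpace_iff]
  refine ⟨fun k e he r hr => ?_, fun Γ ν hν => ?_, fun Γ ν hν => ?_, fun hβ Γ => ?_⟩
  · simp [Patch.val_zero, hg]
  · simp [hj]
  · simp [hd]
  · simp [hj, hd]

variable (D)

/-- The constrained discrete space as a subspace. -/
def constrainedSubmodule (β : DualBasis) (m : EdgeMeasure) : Submodule ℝ D.Broken where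
  carrier := D.constrainedSpace β m
  zero_mem' := zero_mem_constrainedSpace β m
  add_mem' {u v} hu hv := by
    have := smul_add_mem_constrainedSpace 1 hu hv
    rwa [one_smul] at this
  smul_mem' a u hu := by
    have := smul_add_mem_constrainedSpace a hu (zero_mem_constrainedSpace β m)
    rwa [add_zero] at this

theorem uniquelySolvable_of_definite {a : EnergyForm} {β : DualBasis} {m : EdgeMeasure}
    {f : Plane → ℝ} (hf : MemLp f 2 (volume.restrict D.Ω))
    (h : ∀ u ∈ D.constrainedSpace β m, D.energy a u u = 0 → u = 0) :
    D.UniquelySolvable a β m f :=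
  existsUnique_of_definite (D.constrainedSubmodule β m) (D.energyMap a) (D.loadMap hf) h

end MultiPatch

/-! ### Connection of every patch to the boundary through interfaces. -/

namespace Patch

variable (P : Patch)

theorem finite_vertices : P.vertices.Finite :=
  ((toFinite _).prod (toFinite _)).image _

theorem exists_eq_curve {x : Plane} (hx : x ∈ P.closedDom) (hd : x ∉ P.dom) :
    ∃ e, x ∈ P.edge e := by
  obtain ⟨s, hs, rfl⟩ := hx
  have h1 : s ∉ openSquare := fun h => hd (mem_image_of_mem _ h)
  obtain ⟨ξ, η⟩ := s
  obtain ⟨hξ, hη⟩ := hs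
  rcases hξ.1.eq_or_lt with h | h0
  · exact ⟨.xi0, η, hη, by rw [curve, Side.point, h]⟩
  rcases hξ.2.eq_or_lt with h | h2
  · exact ⟨.xi1, η, hη, by rw [curve, Side.point, ← h]⟩
  rcases hη.1.eq_or_lt with h | h3
  · exact ⟨.eta0, ξ, hξ, by rw [curve, Side.point, h]⟩
  rcases hη.2.eq_or_lt with h | h4
  · exact ⟨.eta1, ξ, hξ, by rw [curve, Side.point, ← h]⟩
  exact absurd ⟨⟨h0, h2⟩, h3, h4⟩ h1

theorem mem_openEdge {e : Side} {x : Plane} (hx : x ∈ P.edge e) (hv : x ∉ P.vertices) :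
    x ∈ P.openEdge e := by
  obtain ⟨r, hr, rfl⟩ := hx
  have hend : ∀ r : ℝ, r = 0 ∨ r = 1 → P.curve e r ∈ P.vertices := by
    intro r hr
    refine mem_image_of_mem _ ?_
    cases e <;> rcases hr with rfl | rfl <;> simp [Side.point]
  refine ⟨r, ⟨hr.1.lt_of_ne' fun h => hv (hend r (Or.inl h)), hr.2.lt_of_ne fun h =>
    hv (hend r (Or.inr h))⟩, rfl⟩

theorem dom_nonempty : P.dom.Nonempty := P.regularSet_nonempty.mono P.regularSet_subset

end Patch

namespace MultiPatch

variable (D : MultiPatch)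

/-- Every patch is joined to the boundary of the domain by a chain of interfaces. -/
theorem forall_of_boundary_of_interface (Q : Fin D.numPatches → Prop)
    (hb : ∀ k e, (D.patch k).edge e ⊆ frontier D.Ω → Q k)
    (hi : ∀ Γ : D.Interface, Q Γ.slave ↔ Q Γ.master) : ∀ k, Q k := by
  by_contra! hex
  obtain ⟨k₀, hk₀⟩ := hex
  -- If `Q` fails somewhere, `K` has interior points and is compact, hence not the whole plane. Off
  -- the finite vertex set `V`, `K` is shown to be open as well as closed, which contradicts
  -- connectedness of the plane without `V`.
  let K : Set Plane := ⋃ k ∈ {k | ¬ Q k}, (D.patch k).closedDom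
  let R : Set Plane := ⋃ k ∈ {k | Q k}, (D.patch k).closedDom
  let V : Set Plane := ⋃ k, (D.patch k).vertices
  have hK : IsCompact K := (toFinite _).isCompact_biUnion fun k _ => (D.patch k).isCompact_closedDom
  have hR : IsCompact R := (toFinite _).isCompact_biUnion fun k _ => (D.patch k).isCompact_closedDom
  have hV : V.Finite := finite_iUnion fun k => (D.patch k).finite_vertices
  have hdom : ∀ k, ¬ Q k → (D.patch k).dom ⊆ interior K := fun k hk =>
    interior_maximal ((D.patch k).dom_subset_closedDom.trans
      (subset_biUnion_of_mem (u := fun k => (D.patch k).closedDom) hk)) (D.patch k).isOpen_dom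
  have hint : ∀ x ∈ K, x ∉ V → x ∈ interior K := by
    intro x hx hxV
    obtain ⟨k, hk, hxk⟩ := mem_iUnion₂.mp hx
    have hxv : ∀ k, x ∉ (D.patch k).vertices := fun k h => hxV (mem_iUnion.mpr ⟨k, h⟩)
    by_cases hxd : x ∈ (D.patch k).dom
    · exact hdom k hk hxd
    obtain ⟨e, he⟩ := (D.patch k).exists_eq_curve hxk hxd
    have hxΩ : x ∈ D.Ω := by
      rcases D.edge_cases k e with h | h
      · exact absurd (hb k e h) hk
      · exact h ((D.patch k).mem_openEdge he (hxv k))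
    -- Patches that meet at a point other than a vertex share an entire edge; this is an interface,
    -- in one orientation or the other, and `Q` would pass across it.
    have hxR : x ∉ R := by
      intro h
      obtain ⟨l, hl, hxl⟩ := mem_iUnion₂.mp h
      have hkl : k ≠ l := by
        rintro rfl
        exact hk hl
      rcases D.inter k l hkl with h | ⟨v, hv, -, h⟩ | ⟨e₁, e₂, h, h'⟩
      · exact (h ▸ (⟨hxk, hxl⟩ : x ∈ (D.patch k).closedDom ∩ (D.patch l).closedDom) : x ∈ (∅ : Set _))
      · have hxv' : x ∈ ({v} : Set Plane) := h ▸ ⟨hxk, hxl⟩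
        rw [mem_singleton_iff] at hxv'
        exact hxv k (hxv' ▸ hv)
      · by_cases hs : D.isSlave k e₁
        · exact hk ((hi ⟨k, e₁, l, e₂, hkl, h', hs⟩).mpr hl)
        · have hs' : D.isSlave l e₂ := by
            by_contra hs'
            exact hs ((D.slave_iff k e₁ l e₂ hkl h').mpr hs')
          exact hk ((hi ⟨l, e₂, k, e₁, hkl.symm, h'.symm, hs'⟩).mp hl)
    -- The closed patches cover `Ω`, so what `R` leaves of it is an open subset of `K`.
    refine mem_interior.mpr ⟨D.Ω \ R, fun y hy => ?_, D.isOpen.sdiff hR.isClosed, hxΩ, hxR⟩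
    have h1 : y ∈ ⋃ k, (D.patch k).closedDom := D.closure_eq ▸ subset_closure hy.1
    obtain ⟨l, hl⟩ := mem_iUnion.mp h1
    by_cases hQ : Q l
    · exact absurd (mem_iUnion₂.mpr ⟨l, hQ, hl⟩) hy.2
    · exact mem_iUnion₂.mpr ⟨l, hQ, hl⟩
  have hrank : 1 < Module.rank ℝ Plane := by
    rw [← Module.finrank_eq_rank, finrank_euclideanSpace_fin]
    norm_num
  have hconn : IsPreconnected Vᶜ :=
    (hV.countable.isPathConnected_compl_of_one_lt_rank hrank).isConnected.isPreconnected
  have h1 : (Vᶜ ∩ interior K).Nonempty := by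
    obtain ⟨x, hx⟩ := (D.patch k₀).dom_nonempty
    have := (hV.countable.dense_compl ℝ).inter_open_nonempty _ isOpen_interior
      ⟨x, hdom k₀ hk₀ hx⟩
    rwa [inter_comm]
  have h2 : (Vᶜ ∩ Kᶜ).Nonempty := by
    rw [← compl_union, nonempty_compl]
    exact (hV.isCompact.union hK).ne_univ
  obtain ⟨x, -, hx1, hx2⟩ := hconn _ _ isOpen_interior hK.isClosed.isOpen_compl (fun x hx => by
    by_cases hxK : x ∈ K
    · exact Or.inl (hint x hxK hx)
    · exact Or.inr hxK) h1 h2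
  exact hx2 (interior_subset hx1)

variable {D}

/-! ### Gluing of affine pieces across an interface. -/

namespace Interface

variable (Γ : D.Interface) {u : D.Broken} {L : Fin D.numPatches → Plane →L[ℝ] ℝ}
  {a : Fin D.numPatches → ℝ}

theorem jump_affine (hu : ∀ k, u k = (D.patch k).affine (L k) (a k)) {r : ℝ}
    (hr : r ∈ Icc (0 : ℝ) 1) :
    Γ.jump u r = (L Γ.slave - L Γ.master) (Γ.curve r) + (a Γ.slave - a Γ.master) := by
  rw [jump, hu, hu, Patch.val_affine _ _ _ (Γ.curve_mem_slave hr),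
    Patch.val_affine _ _ _ (Γ.curve_mem_master hr), sub_apply]
  ring

theorem derivJump_affine (hu : ∀ k, u k = (D.patch k).affine (L k) (a k)) {r : ℝ}
    (hr : r ∈ Icc (0 : ℝ) 1) :
    Γ.derivJump u r = (L Γ.slave - L Γ.master) (Γ.direction r) := by
  rw [derivJump, hu, hu, Patch.grad_affine _ _ _ (Γ.curve_mem_slave hr),
    Patch.grad_affine _ _ _ (Γ.curve_mem_master hr), sub_apply]

/-- The multipliers for the full trace mesh glue affine functions. -/
theorem affine_eq {β : DualBasis} {m : EdgeMeasure} (hβ : β ≠ .globalCoarse)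
    (hK : u ∈ D.constrainedSpace β m) (hu : ∀ k, u k = (D.patch k).affine (L k) (a k)) :
    L Γ.slave = L Γ.master ∧ a Γ.slave = a Γ.master := by
  obtain ⟨-, h1, h2, -⟩ := mem_constrainedSpace_iff.mp hK
  -- Both jumps are slave splines along the edge, even though the master patch has other knots,
  -- because the master's piece is affine as well.
  obtain ⟨⟨b, hb⟩, d, hd⟩ := (D.patch Γ.slave).exists_affine_trace Γ.slaveSide
    (L Γ.slave - L Γ.master) (a Γ.slave - a Γ.master)
  have hw := Γ.continuousOn_weight m
  have hw0 := Γ.weight_pos m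
  have hj := Γ.knots.eq_zero_of_orthogonal_multipliers hw hw0 hβ
    (fun r hr => (Γ.jump_affine hu hr).trans (hb r hr)) (h1 Γ)
  have hd := Γ.knots.eq_zero_of_orthogonal_multipliers hw hw0 hβ
    (fun r hr => (Γ.derivJump_affine hu hr).trans (hd r hr)) (h2 Γ)
  have h0 : (0 : ℝ) ∈ Icc (0 : ℝ) 1 := ⟨le_rfl, zero_le_one⟩
  obtain ⟨h3, h4⟩ := (D.patch Γ.slave).affine_eq_zero Γ.slaveSide
    (fun r hr => (Γ.jump_affine hu hr).symm.trans (hj r hr)) h0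
    ((Γ.derivJump_affine hu h0).symm.trans (hd 0 h0))
  exact ⟨sub_eq_zero.mp h3, sub_eq_zero.mp h4⟩

/-- Vertex constraints glue affine functions if the transversal direction is not parallel to the
chord. -/
theorem affine_eq_of_vertexConstraint (hT : D.ChordTransversal) (hv : D.vertexConstraint u)
    (hu : ∀ k, u k = (D.patch k).affine (L k) (a k)) :
    L Γ.slave = L Γ.master ∧ a Γ.slave = a Γ.master := by
  have m0 : (0 : ℝ) ∈ Icc (0 : ℝ) 1 := ⟨le_rfl, zero_le_one⟩
  have m1 : (1 : ℝ) ∈ Icc (0 : ℝ) 1 := ⟨zero_le_one, le_rfl⟩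
  obtain ⟨h0, h1, h2, h3⟩ := hv Γ
  rw [Γ.jump_affine hu m0] at h0
  rw [Γ.jump_affine hu m1] at h1
  rw [Γ.derivJump_affine hu m0] at h2
  rw [Γ.derivJump_affine hu m1] at h3
  set M := L Γ.slave - L Γ.master
  obtain ⟨r, hr, hli⟩ := hT Γ
  have hd : M (Γ.direction r) = 0 := by
    rcases hr with rfl | rfl
    exacts [h2, h3]
  -- The two vertex jumps differ by `M` applied to the chord; the constants cancel.
  have hc : M (Γ.curve 1 - Γ.curve 0) = 0 := by
    rw [map_sub]
    linarith
  have hM : M = 0 := by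
    have hspan := hli.span_eq_top_of_card_eq_finrank' (by simp)
    refine ContinuousLinearMap.coe_injective (LinearMap.ext_on_range hspan fun i => ?_)
    fin_cases i
    exacts [hd, hc]
  refine ⟨sub_eq_zero.mp hM, sub_eq_zero.mp ?_⟩
  simpa [hM] using h0

/-- The jump of constants is constant, so one vertex decides; no condition on the direction is
needed. -/
theorem affine_zero_eq_of_vertexConstraint (hv : D.vertexConstraint u)
    (hu : ∀ k, u k = (D.patch k).affine 0 (a k)) : a Γ.slave = a Γ.master := by
  have h0 := (hv Γ).1
  rw [Γ.jump_affine (L := fun _ => 0) hu ⟨le_rfl, zero_le_one⟩] at h0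
  exact sub_eq_zero.mp (by simpa using h0)

end Interface

/-! ### Definiteness of the three forms. -/

theorem eq_zero_of_boundary_edge {u : D.Broken} (hu : D.boundaryCondition u) {k : Fin D.numPatches}
    (hc : ∀ x ∈ (D.patch k).regularSet, pderiv₂ ((D.patch k).val (u k)) 0 0 x +
      pderiv₂ ((D.patch k).val (u k)) 1 1 x = 0) {e : Side}
    (he : (D.patch k).edge e ⊆ frontier D.Ω) : u k = 0 :=
  (D.patch k).eq_zero_of_boundary (u k) hc e (hu k e he)

/-- Piecewise affine functions that are glued on the interfaces and vanish at the boundary. -/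
theorem eq_zero_of_affine {u : D.Broken} (hb : D.boundaryCondition u)
    {L : Fin D.numPatches → Plane →L[ℝ] ℝ} {a : Fin D.numPatches → ℝ}
    (hu : ∀ k, u k = (D.patch k).affine (L k) (a k))
    (hi : ∀ Γ : D.Interface, L Γ.slave = L Γ.master ∧ a Γ.slave = a Γ.master) : u = 0 := by
  have h := D.forall_of_boundary_of_interface (fun k => L k = 0 ∧ a k = 0) (fun k e he => ?_)
    (fun Γ => by simp only [(hi Γ).1, (hi Γ).2])
  · funext k
    rw [hu, (h k).1, (h k).2, Patch.affine_zero]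
    rfl
  · refine (D.patch k).eq_zero_of_affine_eq_zero ?_
    rw [← hu]
    -- Affine functions are harmonic, so the uniqueness result for Cauchy data on an edge applies.
    refine eq_zero_of_boundary_edge hb (fun x hx => ?_) he
    rw [pderiv₂, pderiv₂, hu, Patch.fderiv_fderiv_val_affine _ _ _ hx]
    simp

theorem exists_eq_affine_of_energy_hessian {u : D.Broken} (h : D.energy .hessian u u = 0) :
    ∃ (L : Fin D.numPatches → Plane →L[ℝ] ℝ) (a : Fin D.numPatches → ℝ),
      ∀ k, u k = (D.patch k).affine (L k) (a k) := by
  have h1 : ∀ k, ∃ L a, u k = (D.patch k).affine L a := fun k =>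
    (D.patch k).exists_eq_affine _ ((D.patch k).fderiv_fderiv_val_eq_zero_of_hessian _
      (D.density_eq_zero_of_energy_eq_zero h k))
  choose L a hu using h1
  exact ⟨L, a, hu⟩

theorem exists_eq_affine_of_energy_gradient {u : D.Broken} (h : D.energy .gradient u u = 0) :
    ∃ a : Fin D.numPatches → ℝ, ∀ k, u k = (D.patch k).affine 0 (a k) := by
  have h1 : ∀ k, ∃ a, u k = (D.patch k).affine 0 a := fun k =>
    (D.patch k).exists_eq_affine_zero _ (D.density_eq_zero_of_energy_eq_zero h k)
  choose a hu using h1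
  exact ⟨a, hu⟩

variable (D)

theorem uniquelySolvable_hessian {β : DualBasis} (m : EdgeMeasure)
    (hβ : β = .globalCoarse → D.ChordTransversal) {f : Plane → ℝ}
    (hf : MemLp f 2 (volume.restrict D.Ω)) : D.UniquelySolvable .hessian β m f := by
  refine D.uniquelySolvable_of_definite hf fun u hK hE => ?_
  obtain ⟨L, a, hu⟩ := exists_eq_affine_of_energy_hessian hE
  refine eq_zero_of_affine hK.1 hu fun Γ => ?_
  by_cases h : β = .globalCoarse
  · exact Γ.affine_eq_of_vertexConstraint (hβ h) (hK.2.2.2 h) hu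
  · exact Γ.affine_eq h hK hu

theorem uniquelySolvable_gradient (β : DualBasis) (m : EdgeMeasure) {f : Plane → ℝ}
    (hf : MemLp f 2 (volume.restrict D.Ω)) : D.UniquelySolvable .gradient β m f := by
  refine D.uniquelySolvable_of_definite hf fun u hK hE => ?_
  obtain ⟨a, hu⟩ := exists_eq_affine_of_energy_gradient hE
  refine eq_zero_of_affine (L := fun _ => 0) hK.1 hu fun Γ => ?_
  by_cases h : β = .globalCoarse
  · exact ⟨rfl, Γ.affine_zero_eq_of_vertexConstraint (hK.2.2.2 h) hu⟩
  · exact Γ.affine_eq (L := fun _ => 0) h hK hu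

/-- Zero energy leaves elementwise harmonic functions, and no gluing is involved: each patch is
settled by the Cauchy data on its own boundary edge. -/
theorem uniquelySolvable_laplacian (hD : D.AllPatchesAtBoundary) (β : DualBasis) (m : EdgeMeasure)
    {f : Plane → ℝ} (hf : MemLp f 2 (volume.restrict D.Ω)) :
    D.UniquelySolvable .laplacian β m f := by
  refine D.uniquelySolvable_of_definite hf fun u hK hE => funext fun k => ?_
  obtain ⟨e, he⟩ := hD k
  refine eq_zero_of_boundary_edge hK.1 (fun x hx => ?_) he
  have h := mul_self_eq_zero.mp (D.density_eq_zero_of_energy_eq_zero hE k x hx)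
  rwa [Fin.sum_univ_two] at h

end MultiPatch

end

theorem mainTheorem4 (D : MultiPatch) (m : EdgeMeasure) (f : Plane → ℝ)
    (hf : MeasureTheory.MemLp f 2 (MeasureTheory.volume.restrict D.Ω)) :
    (D.UniquelySolvable .hessian .bezier m f ∧
      D.UniquelySolvable .hessian .globalFull m f ∧
      (D.Coarsenable → D.ChordTransversal → D.UniquelySolvable .hessian .globalCoarse m f)) ∧
    (D.UniquelySolvable .gradient .bezier m f ∧
      D.UniquelySolvable .gradient .globalFull m f ∧
      (D.Coarsenable → D.UniquelySolvable .gradient .globalCoarse m f)) ∧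
    (D.AllPatchesAtBoundary →
      D.UniquelySolvable .laplacian .bezier m f ∧
      D.UniquelySolvable .laplacian .globalFull m f ∧
      (D.Coarsenable → D.UniquelySolvable .laplacian .globalCoarse m f)) := by
  refine ⟨⟨?_, ?_, fun _ hT => ?_⟩, ⟨?_, ?_, fun _ => ?_⟩, fun hD => ⟨?_, ?_, fun _ => ?_⟩⟩
  · exact D.uniquelySolvable_hessian m (fun h => by cases h) hf
  · exact D.uniquelySolvable_hessian m (fun h => by cases h) hf
  · exact D.uniquelySolvable_hessian m (fun _ => hT) hf
  · exact D.uniquelySolvable_gradient _ m hf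
  · exact D.uniquelySolvable_gradient _ m hf
  · exact D.uniquelySolvable_gradient _ m hf
  · exact D.uniquelySolvable_laplacian hD _ m hf
  · exact D.uniquelySolvable_laplacian hD _ m hf
  · exact D.uniquelySolvable_laplacian hD _ m hf
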